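/- Let $\Omega=\mathbb{R}$, or let $\Omega=[0,1]$ with periodic boundary conditions (all functions on $\Omega$ are then extended $1$-periodically). Let $B\in C^2(\mathbb{R})$ with $0\le B\le 1$, let $w_0\in W^{1,1}(\Omega)\cap W^{1,\infty}(\Omega)$ with $w_0'\in BV(\Omega)$, and let $\theta\in[0,1]$. For $\Delta x,\Delta t>0$ put $x_j=j\Delta x$ ($j\in\mathbb{Z}$), $t^n=n\Delta t$ ($n\ge 0$), $x_{j\pm1/2}=(j\pm\tfrac12)\Delta x$, and let $D_+a_j=(a_{j+1}-a_j)/\Delta x$, $D_-a_j=(a_j-a_{j-1})/\Delta x$, $D^2=D_+D_-$, $D_t^+a^n=(a^{n+1}-a^n)/\Delta t$. A solution of the $\theta$-scheme is a grid function $(w^n_j)_{n\ge0,\,j\in\mathbb{Z}}$ with $$D_t^+ w^n_j=B(w^{n+\theta}_j)\,D^2w^{n+\theta}_j,\qquad w^{n+\theta}_j=\theta w^{n+1}_j+(1-\theta)w^n_j,\qquad w^0_j=\frac1{\Delta x}\int_{x_{j-1/2}}^{x_{j+1/2}}w_0\,dx,$$ where for $\Omega=\mathbb{R}$ the sequence $(w^n_j)_j$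 is bounded for each $n$, and in the periodic case $\Delta x=1/N$ for some integer $N\ge1$ and $w^n_{j+N}=w^n_j$. Its interpolation is $$w^{\Delta t}(x,t)=\frac{x_{j+1}-x}{\Delta x}w^n_j+\frac{x-x_j}{\Delta x}w^n_{j+1}\qquad\text{for }x\in[x_j,x_{j+1}),\ t\in[t^n,t^{n+1}).$$ A function $w\in L^\infty(\Omega\times(0,\infty))$ is called a weak solution of $$w_t=B(w)w_{xx}\quad(t>0,\ x\in\Omega),\qquad w(\cdot,0)=w_0,$$ if it has a weak derivative $w_x\in L^\infty(0,\infty;L^2(\Omega))$, if $w\in L^\infty(0,T;H^1(\Omega))$ for every $T>0$ when $\Omega=\mathbb{R}$, respectively $w\in L^\infty(0,\infty;H^1(\Omega))$ in the periodic case, and if $$\int_0^\infty\!\!\int_\Omega \bigl(w\,\phi_t-B(w)\,w_x\,\phi_x-B'(w)\,(w_x)^2\,\phi\bigr)\,dx\,dt+\int_\Omega w_0(x)\,\phi(x,0)\,dx=0\qquad\text{for all }\phi\in C_c^\infty(\Omega\times[0,\infty)).$$ Theorem. Let $\Delta x_k\to0$ and $\Delta t_k\to0$ be sequences of positive numbers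 such that, for every $k$, the CFL condition $\Delta t_k/(\Delta x_k)^2<\frac1{2(1-\theta)}$ holds (no condition if $\theta=1$), and for each $k$ let $w^{(k)}$ be the interpolation of a solution of the $\theta$-scheme with the parameters $\Delta x_k,\Delta t_k$. Then there are a subsequence of $(w^{(k)})_k$ and a function $w\in C([0,\infty),W^{1,1}(\Omega))$ such that the subsequence converges to $w$ in $W^{1,1}(\Omega)$ uniformly for $t$ in every bounded interval $[0,T]$ (that is, in the topology of $C([0,\infty),W^{1,1}(\Omega))$), and $w$ is a weak solution. -/

import Mathlib

open MeasureTheory Set Filter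
open scoped ENNReal Topology ContDiff

namespace ThetaScheme

/-- The two spatial domains: the real line, and `[0,1]` with periodic boundary conditions.
Functions on the periodic interval are represented by their `1`-periodic extensions to `ℝ`. -/
inductive Domain where
  | line : Domain
  | circle : Domain

/-- Functions on `Ω`: all functions on the line, the `1`-periodic ones on the circle. -/
def Domain.IsFunctionOn : Domain → (ℝ → ℝ) → Prop
  | .line, _ => True
  | .circle, f => Function.Periodic f 1

/-- One copy of `Ω` inside `ℝ`. -/
def Domain.cell : Domain → Set ℝ
  | .line => univ
  | .circle => Ico 0 1

/-- Lebesgue measure on `Ω`. -/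
noncomputable def Domain.measure (Ω : Domain) : Measure ℝ := volume.restrict Ω.cell

/-- `g` is the weak derivative of `f` on `ℝ`. For a `1`-periodic `f` this is the same as the weak
derivative on the circle. -/
def HasWeakDeriv (f g : ℝ → ℝ) : Prop :=
  LocallyIntegrable f ∧ LocallyIntegrable g ∧
    ∀ φ : ℝ → ℝ, ContDiff ℝ ∞ φ → HasCompactSupport φ →
      ∫ x, f x * deriv φ x = - ∫ x, g x * φ x

/-- The Sobolev space `W^{1,p}(Ω)`. -/
def MemW1 (Ω : Domain) (p : ℝ≥0∞) (f : ℝ → ℝ) : Prop :=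
  Ω.IsFunctionOn f ∧ MemLp f p Ω.measure ∧
    ∃ g, HasWeakDeriv f g ∧ MemLp g p Ω.measure

/-- The norm of `W^{1,1}(Ω)`. The weak derivative `g` of `f` is unique up to null sets, so that the
infimum is over a constant; it is `⊤` if there is no weak derivative. -/
noncomputable def normW11 (Ω : Domain) (f : ℝ → ℝ) : ℝ≥0∞ :=
  ⨅ (g : ℝ → ℝ) (_ : HasWeakDeriv f g), eLpNorm f 1 Ω.measure + eLpNorm g 1 Ω.measure

/-- `h` is of bounded variation on `Ω` (for the circle: over one closed period, so that a jump
between the end points is counted). -/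
def Domain.BoundedVariation : Domain → (ℝ → ℝ) → Prop
  | .line, h => BoundedVariationOn h univ
  | .circle, h => Function.Periodic h 1 ∧ BoundedVariationOn h (Icc 0 1)

/-- `g ∈ BV(Ω)`: `g` is integrable and has a representative of bounded variation. -/
def MemBV (Ω : Domain) (g : ℝ → ℝ) : Prop :=
  MemLp g 1 Ω.measure ∧ ∃ h : ℝ → ℝ, g =ᵐ[volume] h ∧ Ω.BoundedVariation h

/-- The assumptions on the initial datum: `w₀ ∈ W^{1,1}(Ω) ∩ W^{1,∞}(Ω)`, `w₀' ∈ BV(Ω)`. -/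
structure IsInitialDatum (Ω : Domain) (w₀ : ℝ → ℝ) : Prop where
  memW11 : MemW1 Ω 1 w₀
  memW1inf : MemW1 Ω ⊤ w₀
  deriv_memBV : ∃ g, HasWeakDeriv w₀ g ∧ MemBV Ω g

/-- Forward difference quotient `D_+ a_j`. -/
noncomputable def Dplus (dx : ℝ) (a : ℤ → ℝ) (j : ℤ) : ℝ := (a (j + 1) - a j) / dx

/-- Backward difference quotient `D_- a_j`. -/
noncomputable def Dminus (dx : ℝ) (a : ℤ → ℝ) (j : ℤ) : ℝ := (a j - a (j - 1)) / dx

/-- `w^{n+θ}_j = θ w^{n+1}_j + (1-θ) w^n_j`. -/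
noncomputable def thetaLevel (θ : ℝ) (W : ℕ → ℤ → ℝ) (n : ℕ) (j : ℤ) : ℝ :=
  θ * W (n + 1) j + (1 - θ) * W n j

/-- Grid functions on `Ω`: on the line bounded at each time level; on the circle the mesh size is
`1/N` for a positive integer `N` and the grid function is `N`-periodic in the space index. -/
def Domain.IsGridFunction : Domain → ℝ → (ℕ → ℤ → ℝ) → Prop
  | .line, _, W => ∀ n, ∃ C : ℝ, ∀ j, |W n j| ≤ C
  | .circle, dx, W => ∃ N : ℕ, 0 < N ∧ N * dx = 1 ∧ ∀ n j, W n (j + N) = W n j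

/-- `W n j = w^n_j` solves the `θ`-scheme `D_t^+ w^n_j = B(w^{n+θ}_j) D^2 w^{n+θ}_j` with the cell
averages of `w₀` as initial data. -/
structure IsSchemeSolution (Ω : Domain) (B : ℝ → ℝ) (w₀ : ℝ → ℝ) (θ dx dt : ℝ)
    (W : ℕ → ℤ → ℝ) : Prop where
  grid : Ω.IsGridFunction dx W
  init : ∀ j : ℤ, W 0 j = 1 / dx * ∫ x in ((j - 1 / 2) * dx)..((j + 1 / 2) * dx), w₀ x
  step : ∀ (n : ℕ) (j : ℤ), (W (n + 1) j - W n j) / dt =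
    B (thetaLevel θ W n j) * Dplus dx (Dminus dx (thetaLevel θ W n)) j

/-- The CFL condition `Δt/Δx² < 1/(2(1-θ))`, which is void for `θ = 1`. -/
def CFL (θ dx dt : ℝ) : Prop := θ = 1 ∨ dt / dx ^ 2 < 1 / (2 * (1 - θ))

/-- The interpolation `w^{Δt}(x,t)`, piecewise linear in `x` and piecewise constant in `t`:
for `x ∈ [x_j, x_{j+1})` and `t ∈ [t^n, t^{n+1})` it is
`(x_{j+1}-x)/Δx * w^n_j + (x-x_j)/Δx * w^n_{j+1}`. -/
noncomputable def interp (dx dt : ℝ) (W : ℕ → ℤ → ℝ) (x t : ℝ) : ℝ :=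
  let j : ℤ := ⌊x / dx⌋
  let n : ℕ := ⌊t / dt⌋₊
  (((j + 1 : ℤ) : ℝ) * dx - x) / dx * W n j + (x - (j : ℝ) * dx) / dx * W n (j + 1)

/-- `w ∈ C([0,∞), W^{1,1}(Ω))`, where `w x t` stands for `w(x,t)`. -/
def MemCW11 (Ω : Domain) (w : ℝ → ℝ → ℝ) : Prop :=
  (∀ t, 0 ≤ t → MemW1 Ω 1 (fun x => w x t)) ∧
    ∀ t, 0 ≤ t → Tendsto (fun s => normW11 Ω (fun x => w x s - w x t)) (𝓝[Ici 0] t) (𝓝 0)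

/-- Convergence of `u k` to `w` in the topology of `C([0,∞), W^{1,1}(Ω))`, that is, in
`W^{1,1}(Ω)` uniformly on every bounded time interval. -/
def TendstoCW11 (Ω : Domain) (u : ℕ → ℝ → ℝ → ℝ) (w : ℝ → ℝ → ℝ) : Prop :=
  ∀ T : ℝ, 0 < T →
    Tendsto (fun k => ⨆ t ∈ Icc (0 : ℝ) T, normW11 Ω (fun x => u k x t - w x t)) atTop (𝓝 0)

/-- The support condition for test functions in `C_c^∞(Ω × [0,∞))`. -/
def Domain.HasTestSupport : Domain → (ℝ → ℝ → ℝ) → Prop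
  | .line, φ => ∃ R : ℝ, ∀ x t, R < |x| ∨ R < |t| → φ x t = 0
  | .circle, φ => (∃ R : ℝ, ∀ x t, R < |t| → φ x t = 0) ∧ ∀ t, Function.Periodic (fun x => φ x t) 1

/-- Test functions in `C_c^∞(Ω × [0,∞))`, as restrictions to `t ≥ 0` of smooth functions that are
defined for all `t` (`φ` need not vanish at `t = 0`). -/
def IsTestFunction (Ω : Domain) (φ : ℝ → ℝ → ℝ) : Prop :=
  ContDiff ℝ ∞ (fun p : ℝ × ℝ => φ p.1 p.2) ∧ Ω.HasTestSupport φ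

/-- Essential boundedness in time of the `L²(Ω)` norm over the time set `I`. -/
def EssBoundedL2 (Ω : Domain) (I : Set ℝ) (f : ℝ → ℝ → ℝ) : Prop :=
  ∃ C : NNReal, ∀ᵐ t ∂(volume.restrict I), eLpNorm (fun x => f x t) 2 Ω.measure ≤ C

/-- The time intervals on which the `L²(Ω)` norm of a weak solution is essentially bounded: all of
`(0,∞)` on the circle, every bounded interval `(0,T)` on the line. -/
def Domain.timeIntervals : Domain → Set (Set ℝ)
  | .line => {I | ∃ T : ℝ, 0 < T ∧ I = Ioo 0 T}
  | .circle => {Ioi 0}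

/-- `w` is a weak solution of `w_t = B(w) w_xx`, `w(·,0) = w₀`, on `Ω`. Here `z` is the weak
derivative `w_x`, as a function that is jointly measurable in `(x,t)`; it is unique up to null
sets. All integrands below are integrable by the bounds on `w` and `z`. -/
def IsWeakSolution (Ω : Domain) (B : ℝ → ℝ) (w₀ : ℝ → ℝ) (w : ℝ → ℝ → ℝ) : Prop :=
  (∀ t, 0 < t → Ω.IsFunctionOn (fun x => w x t)) ∧
  MemLp (fun p : ℝ × ℝ => w p.1 p.2) ⊤ (Ω.measure.prod (volume.restrict (Ioi 0))) ∧
  ∃ z : ℝ → ℝ → ℝ,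
    AEStronglyMeasurable (fun p : ℝ × ℝ => z p.1 p.2)
      (Ω.measure.prod (volume.restrict (Ioi 0))) ∧
    (∀ᵐ t ∂(volume.restrict (Ioi (0 : ℝ))), HasWeakDeriv (fun x => w x t) (fun x => z x t)) ∧
    (∀ I ∈ Ω.timeIntervals, EssBoundedL2 Ω I w) ∧
    EssBoundedL2 Ω (Ioi 0) z ∧
    ∀ φ : ℝ → ℝ → ℝ, IsTestFunction Ω φ →
      (∫ t in Ioi (0 : ℝ), ∫ x,
          (w x t * deriv (fun s => φ x s) t
            - B (w x t) * z x t * deriv (fun y => φ y t) x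
            - deriv B (w x t) * z x t ^ 2 * φ x t) ∂Ω.measure)
        + ∫ x, w₀ x * φ x 0 ∂Ω.measure = 0

end ThetaScheme

open ThetaScheme

/-! Everything rests on discrete conservation laws for the differences of a solution. A θ-step is an
implicit Euler step of length θΔt from level n to n+θ, followed by an explicit one of length
(1-θ)Δt, both with the right-hand side taken at level n+θ; the CFL condition keeps the coefficients
of the explicit half nonnegative. The equation for w has nonnegative coefficients row by row, hence
a maximum principle (`abs_le_of_theta_step`). The differences v = D_+w satisfy v_t = D_+(B D_- v), a
symmetric exchange of mass between neighbours, so they obey the maximum principle and an L¹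
contraction. The second differences satisfy U_t = D²(BU): each site sends out mass at the rate B of
that site, which again contracts L¹ (`gridNorm_theta_step`). Hence the sup norm of w, the sup and L¹
norms of w_x and the L¹ norm of w_xx are controlled by the initial datum, uniformly in the mesh;
that w₀' is BV is what bounds the last one. The scheme turns that bound into Lipschitz continuity in
time with values in L¹. Grid functions are treated as step functions and sums as integrals, so that
line and circle share one computation based on translation invariance.

On the line, compactness also needs uniformly small tails. They follow from the same contraction
with the weight min(1,(x/R)²): its second difference is at most 2Δx²/R², so the weighted norms grow
little on [0,T] (`gridNorm_weight_le`, `SchemeFamily.tail_le`).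

Compactness is proved for an abstract `ApproxFamily`. A subsequence converges at all rational
points; the Lipschitz bounds in x, those in t with values in L¹, and the tail bounds upgrade this to
L¹ convergence uniform on [0,T]. The derivatives follow without another subsequence: difference
quotients with step s are within O(s + δ) of the derivative in L¹, uniformly in k, because the
derivatives have bounded variation, and for fixed s the quotients converge (`uniform_deriv`).

For the equation, the scheme is tested with φ and summed by parts (`integral_weak`). Grid functions
are extended to t < 0 by their initial values, so no boundary term appears; the initial integral is
recovered as the integral of w₀ φ_t over negative times. Strong L¹ convergence of the uniformly
bounded derivatives suffices for the quadratic term B'(w) w_x² (`tendsto_flux`, `weak_form`). -/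

namespace ThetaScheme

/-! ### Translation invariance on Ω and exchange of mass -/

/-- `f` lives on `Ω`: no condition on the line, `1`-periodicity on the circle. -/
def Domain.Per {α : Type*} (Ω : Domain) (f : ℝ → α) : Prop :=
  Ω = .circle → Function.Periodic f 1

lemma Domain.isFunctionOn_iff_per {Ω : Domain} {f : ℝ → ℝ} : Ω.IsFunctionOn f ↔ Ω.Per f := by
  cases Ω <;> simp [Domain.IsFunctionOn, Domain.Per]

instance (Ω : Domain) : SFinite Ω.measure := by
  unfold Domain.measure; infer_instance

lemma Domain.measure_line : Domain.line.measure = volume := by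
  simp [Domain.measure, Domain.cell]

lemma Domain.measure_circle : Domain.circle.measure = volume.restrict (Ioc 0 1) := by
  simp only [Domain.measure, Domain.cell]
  exact Measure.restrict_congr_set Ico_ae_eq_Ioc

lemma Domain.measure_le (Ω : Domain) : Ω.measure ≤ volume := Measure.restrict_le_self

lemma Domain.Per.shift {α : Type*} {Ω : Domain} {f : ℝ → α} (hf : Ω.Per f) (a : ℝ) :
    Ω.Per (fun x => f (x + a)) := by
  intro h x
  have := hf h (x + a)
  simpa [add_right_comm] using this

lemma Domain.Per.comp {α β : Type*} {Ω : Domain} {f : ℝ → α} (hf : Ω.Per f) (F : α → β) :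
    Ω.Per (fun x => F (f x)) := fun h x => congrArg F (hf h x)

lemma Domain.Per.comp₂ {α β γ : Type*} {Ω : Domain} {f : ℝ → α} {g : ℝ → β} (hf : Ω.Per f)
    (hg : Ω.Per g) (F : α → β → γ) : Ω.Per (fun x => F (f x) (g x)) := fun h x => by
  simp only [hf h x, hg h x]

lemma Domain.per_const {α : Type*} {Ω : Domain} (c : α) : Ω.Per (fun _ => c) := fun _ _ => rfl

/-- Translation invariance of the integral over `Ω`. -/
lemma Domain.lintegral_shift {Ω : Domain} {f : ℝ → ℝ≥0∞} (hf : Ω.Per f) (a : ℝ) :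
    ∫⁻ x, f (x + a) ∂Ω.measure = ∫⁻ x, f x ∂Ω.measure := by
  cases Ω with
  | line => simp only [Domain.measure_line]; exact lintegral_add_right_eq_self f a
  | circle =>
    have hp := hf rfl
    simp only [Domain.measure_circle]
    have h1 : ∫⁻ x in Ioc (0 : ℝ) 1, f (x + a) = ∫⁻ x in Ioc a (a + 1), f x := by
      have := (measurePreserving_add_right volume a).setLIntegral_comp_preimage_emb
        (MeasurableEquiv.addRight a).measurableEmbedding f (Ioc a (a + 1))
      rw [← this]
      congr 2
      ext x
      simp [add_comm]
    have h2 := (isAddFundamentalDomain_Ioc one_pos a).setLIntegral_eq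
      (isAddFundamentalDomain_Ioc one_pos 0) f hp.map_vadd_zmultiples
    rw [h1, h2]; simp

/-- Translation invariance of the Bochner integral over `Ω`. -/
lemma Domain.integral_shift {Ω : Domain} {f : ℝ → ℝ} (hf : Ω.Per f) (a : ℝ) :
    ∫ x, f (x + a) ∂Ω.measure = ∫ x, f x ∂Ω.measure := by
  cases Ω with
  | line => simp only [Domain.measure_line]; exact integral_add_right_eq_self f a
  | circle =>
    have hp := hf rfl
    simp only [Domain.measure_circle]
    have h1 : ∫ x in Ioc (0 : ℝ) 1, f (x + a) = ∫ x in Ioc a (a + 1), f x := by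
      have := (measurePreserving_add_right volume a).setIntegral_preimage_emb
        (MeasurableEquiv.addRight a).measurableEmbedding f (Ioc a (a + 1))
      rw [← this]
      congr 2
      ext x
      simp [add_comm]
    have h2 := (isAddFundamentalDomain_Ioc one_pos a).setIntegral_eq
      (isAddFundamentalDomain_Ioc one_pos 0) (f := f) hp.map_vadd_zmultiples
    rw [h1, h2]; simp

/-- The weighted mass inequality for a function `A` that is produced from `F` by a flux with the
rates `r` (to the right) and `l` (to the left) out of `U`. -/
lemma lintegral_flux {Ω : Domain} {dx : ℝ} {r l U A F ρ d : ℝ → ℝ≥0∞}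
    (hr : Measurable r) (hl : Measurable l) (hU : Measurable U) (hA : Measurable A)
    (hF : Measurable F) (hρ : Measurable ρ)
    (pr : Ω.Per r) (pl : Ω.Per l) (pU : Ω.Per U) (pρ : Ω.Per ρ)
    (hfin : ∫⁻ x, ρ x * ((r x + l x) * U x) ∂Ω.measure ≠ ⊤)
    (h1 : ∀ x, A x + (r x + l x) * U x ≤
      F x + r (x - dx) * U (x - dx) + l (x + dx) * U (x + dx))
    (h2 : ∀ x, r x * ρ (x + dx) + l x * ρ (x - dx) ≤ (r x + l x) * ρ x + d x) :
    ∫⁻ x, ρ x * A x ∂Ω.measure ≤ ∫⁻ x, ρ x * F x ∂Ω.measure + ∫⁻ x, d x * U x ∂Ω.measure := by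
  -- Mass arriving from the left is counted at the site it left, so that the weight appears at the
  -- arrival point.
  have e1 : ∫⁻ x, ρ x * (r (x - dx) * U (x - dx)) ∂Ω.measure
      = ∫⁻ x, ρ (x + dx) * (r x * U x) ∂Ω.measure := by
    rw [← Domain.lintegral_shift (f := fun x => ρ x * (r (x - dx) * U (x - dx))) _ dx]
    · simp
    · exact pρ.comp₂ ((pr.shift (-dx)).comp₂ (pU.shift (-dx)) (fun a b => a * b))
        (fun a b => a * b)
  have e2 : ∫⁻ x, ρ x * (l (x + dx) * U (x + dx)) ∂Ω.measure
      = ∫⁻ x, ρ (x - dx) * (l x * U x) ∂Ω.measure := by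
    rw [← Domain.lintegral_shift (f := fun x => ρ (x - dx) * (l x * U x)) _ dx]
    · simp
    · exact (pρ.shift (-dx)).comp₂ (pl.comp₂ pU (fun a b => a * b)) (fun a b => a * b)
  -- The weighted outflow stands on both sides because subtraction in `ℝ≥0∞` is truncated; its
  -- finiteness allows the cancellation at the end.
  have key : ∫⁻ x, ρ x * A x ∂Ω.measure + ∫⁻ x, ρ x * ((r x + l x) * U x) ∂Ω.measure ≤
      (∫⁻ x, ρ x * F x ∂Ω.measure + ∫⁻ x, d x * U x ∂Ω.measure) +
        ∫⁻ x, ρ x * ((r x + l x) * U x) ∂Ω.measure := by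
    calc _ = ∫⁻ x, ρ x * (A x + (r x + l x) * U x) ∂Ω.measure := by
          rw [← lintegral_add_left (by fun_prop)]; simp only [mul_add]
      _ ≤ ∫⁻ x, ρ x * (F x + r (x - dx) * U (x - dx) + l (x + dx) * U (x + dx)) ∂Ω.measure := by
          exact lintegral_mono fun x => mul_le_mul_right (h1 x) (ρ x)
      _ = ∫⁻ x, ρ x * F x ∂Ω.measure + (∫⁻ x, ρ x * (r (x - dx) * U (x - dx)) ∂Ω.measure
          + ∫⁻ x, ρ x * (l (x + dx) * U (x + dx)) ∂Ω.measure) := by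
          rw [← lintegral_add_left (by fun_prop), ← lintegral_add_left (by fun_prop)]
          simp only [mul_add, add_assoc]
      _ = ∫⁻ x, ρ x * F x ∂Ω.measure
          + ∫⁻ x, (r x * ρ (x + dx) + l x * ρ (x - dx)) * U x ∂Ω.measure := by
          rw [e1, e2, ← lintegral_add_left (by fun_prop)]
          congr 2; funext x; ring
      _ ≤ ∫⁻ x, ρ x * F x ∂Ω.measure
          + ∫⁻ x, ((r x + l x) * ρ x + d x) * U x ∂Ω.measure := by
          exact add_le_add le_rfl (lintegral_mono fun x => mul_le_mul_left (h2 x) (U x))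
      _ = _ := by
          rw [add_assoc, add_comm (∫⁻ x, d x * U x ∂Ω.measure), ← lintegral_add_left
            (show Measurable fun x => ρ x * ((r x + l x) * U x) by fun_prop)]
          congr 2; ext1 x; ring
  exact (ENNReal.add_le_add_iff_right hfin).1 key

/-- The step function with the values `a j` on `[j dx, (j+1) dx)`. -/
noncomputable def stepFun {α : Type*} (dx : ℝ) (a : ℤ → α) (x : ℝ) : α := a ⌊x / dx⌋

lemma measurable_stepFun {α : Type*} [MeasurableSpace α] (dx : ℝ) (a : ℤ → α) :
    Measurable (stepFun dx a) :=
  (measurable_from_top (f := a)).comp (Int.measurable_floor.comp (measurable_id.div_const dx))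

lemma floor_add_div {dx : ℝ} (hdx : 0 < dx) (x : ℝ) : ⌊(x + dx) / dx⌋ = ⌊x / dx⌋ + 1 := by
  rw [add_div, div_self hdx.ne', Int.floor_add_one]

lemma floor_sub_div {dx : ℝ} (hdx : 0 < dx) (x : ℝ) : ⌊(x - dx) / dx⌋ = ⌊x / dx⌋ - 1 := by
  rw [sub_div, div_self hdx.ne', Int.floor_sub_one]

/-- The two-sided exponential weight on the line, and the constant weight on the circle. -/
noncomputable def expWeight (Ω : Domain) (ε : ℝ) (x : ℝ) : ℝ :=
  match Ω with
  | .line => Real.exp (-(ε * |x|))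
  | .circle => 1

lemma measurable_expWeight (Ω : Domain) (ε : ℝ) : Measurable (expWeight Ω ε) := by
  cases Ω <;> unfold expWeight <;> fun_prop

lemma expWeight_nonneg (Ω : Domain) (ε x : ℝ) : 0 ≤ expWeight Ω ε x := by
  cases Ω <;> simp [expWeight, Real.exp_nonneg]

lemma expWeight_le_one (Ω : Domain) {ε : ℝ} (hε : 0 ≤ ε) (x : ℝ) : expWeight Ω ε x ≤ 1 := by
  cases Ω <;> simp [expWeight]
  positivity

lemma per_expWeight (Ω : Domain) (ε : ℝ) : Ω.Per (expWeight Ω ε) := by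
  intro h; subst h; intro x; rfl

/-- The logarithm of the weight is ε-Lipschitz. The factor tends to 1 as ε → 0, which makes the cost
of this weight disappear in `gridNorm_implicit_le`. -/
lemma expWeight_shift_le (Ω : Domain) {ε : ℝ} (hε : 0 ≤ ε) (x y : ℝ) :
    expWeight Ω ε (x + y) ≤ Real.exp (ε * |y|) * expWeight Ω ε x := by
  cases Ω with
  | line =>
    simp only [expWeight]
    rw [← Real.exp_add]
    gcongr
    have : |x| ≤ |x + y| + |y| := by
      calc |x| = |(x + y) + (-y)| := by ring_nf
        _ ≤ _ := by simpa using abs_add_le (x + y) (-y)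
    nlinarith
  | circle =>
    simp only [expWeight, mul_one]
    exact Real.one_le_exp (by positivity)

/-- Integrability of the weight gives every bounded grid function a finite weighted norm, which is
all that is known a priori about the unknown of an implicit step. -/
lemma lintegral_expWeight_lt_top (Ω : Domain) {ε : ℝ} (hε : 0 < ε) :
    ∫⁻ x, ENNReal.ofReal (expWeight Ω ε x) ∂Ω.measure < ⊤ := by
  cases Ω with
  | line =>
    simp only [expWeight, Domain.measure_line]
    have h : Integrable (fun x : ℝ => Real.exp (-(ε * |x|))) := by
      rw [← integrableOn_univ, ← Iic_union_Ioi (a := (0 : ℝ))]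
      refine IntegrableOn.union ?_ ?_
      · refine (integrableOn_exp_mul_Iic hε 0).congr_fun ?_ measurableSet_Iic
        intro x hx
        simp [abs_of_nonpos (mem_Iic.1 hx)]
      · refine (integrableOn_exp_mul_Ioi (neg_neg_of_pos hε) 0).congr_fun ?_ measurableSet_Ioi
        intro x hx
        simp [abs_of_pos (mem_Ioi.1 hx)]
    exact h.lintegral_lt_top
  | circle => simp [expWeight, Domain.measure_circle]

lemma tendsto_expWeight (Ω : Domain) (x : ℝ) {u : ℕ → ℝ} (hu : Tendsto u atTop (𝓝 0)) :
    Tendsto (fun n => expWeight Ω (u n) x) atTop (𝓝 1) := by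
  cases Ω with
  | line =>
    simp only [expWeight]
    have : Tendsto (fun n => -(u n * |x|)) atTop (𝓝 0) := by
      simpa using (hu.mul_const |x|).neg
    simpa [Function.comp_def] using (Real.continuous_exp.tendsto 0).comp this
  | circle => simp [expWeight]

end ThetaScheme

/-! ### Weighted L¹ norms, contraction and the maximum principle -/

namespace ThetaScheme

/-- The weighted `L¹(Ω)` norm of the step function with the values `a j`. -/
noncomputable def gridNorm (Ω : Domain) (dx : ℝ) (ρ : ℝ → ℝ) (a : ℤ → ℝ) : ℝ≥0∞ :=
  ∫⁻ x, ENNReal.ofReal (ρ x) * ‖stepFun dx a x‖ₑ ∂Ω.measure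

/-- The real-valued form of `lintegral_flux`. Mass that jumps from x changes its weight from `ρ x`
to `ρ (x ± dx)`, and `d` pays for the total gain of weight per unit of mass. The weight need not be
constant on cells. -/
lemma gridNorm_flux {Ω : Domain} {dx lam : ℝ} (hdx : 0 < dx) {r l A F U : ℤ → ℝ} {ρ d : ℝ → ℝ}
    (hr : ∀ j, 0 ≤ r j ∧ r j ≤ lam) (hl : ∀ j, 0 ≤ l j ∧ l j ≤ lam)
    (hρ0 : ∀ x, 0 ≤ ρ x) (hd0 : ∀ x, 0 ≤ d x) (hρ : Measurable ρ)
    (pr : Ω.Per (stepFun dx r)) (pl : Ω.Per (stepFun dx l)) (pU : Ω.Per (stepFun dx U)) (pρ : Ω.Per ρ)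
    (hfin : gridNorm Ω dx ρ U ≠ ⊤)
    (h1 : ∀ j, |A j| + (r j + l j) * |U j| ≤
      |F j| + r (j - 1) * |U (j - 1)| + l (j + 1) * |U (j + 1)|)
    (h2 : ∀ x, r ⌊x / dx⌋ * ρ (x + dx) + l ⌊x / dx⌋ * ρ (x - dx) ≤
      (r ⌊x / dx⌋ + l ⌊x / dx⌋) * ρ x + d x) :
    gridNorm Ω dx ρ A ≤ gridNorm Ω dx ρ F + gridNorm Ω dx d U := by
  have hlam : 0 ≤ lam := (hr 0).1.trans (hr 0).2
  refine lintegral_flux (dx := dx) (r := fun x => ENNReal.ofReal (stepFun dx r x))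
    (l := fun x => ENNReal.ofReal (stepFun dx l x)) (measurable_stepFun dx r).ennreal_ofReal
    (measurable_stepFun dx l).ennreal_ofReal (measurable_stepFun dx U).enorm
    (measurable_stepFun dx A).enorm (measurable_stepFun dx F).enorm hρ.ennreal_ofReal
    (pr.comp _) (pl.comp _) (pU.comp _) (pρ.comp _) ?_ ?_ ?_
  · refine ne_top_of_le_ne_top (ENNReal.mul_ne_top (ENNReal.ofReal_ne_top (r := 2 * lam)) hfin) ?_
    rw [gridNorm, ← lintegral_const_mul' _ _ ENNReal.ofReal_ne_top]
    refine lintegral_mono fun x => ?_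
    have e := ENNReal.ofReal_add (hr ⌊x / dx⌋).1 (hl ⌊x / dx⌋).1
    simp only [stepFun]
    rw [mul_left_comm, ← e]
    gcongr
    have := (hr ⌊x / dx⌋).2; have := (hl ⌊x / dx⌋).2
    linarith
  · intro x
    have h := ENNReal.ofReal_le_ofReal (h1 ⌊x / dx⌋)
    have a1 := fun j => (hr j).1
    have a2 := fun j => (hl j).1
    rw [ENNReal.ofReal_add (abs_nonneg _) (mul_nonneg (add_nonneg (a1 _) (a2 _)) (abs_nonneg _)),
      ENNReal.ofReal_add (add_nonneg (abs_nonneg _) (mul_nonneg (a1 _) (abs_nonneg _)))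
        (mul_nonneg (a2 _) (abs_nonneg _)),
      ENNReal.ofReal_add (abs_nonneg _) (mul_nonneg (a1 _) (abs_nonneg _)),
      ENNReal.ofReal_mul (add_nonneg (a1 _) (a2 _)), ENNReal.ofReal_mul (a1 _),
      ENNReal.ofReal_mul (a2 _), ENNReal.ofReal_add (a1 _) (a2 _)] at h
    simpa only [stepFun, floor_add_div hdx, floor_sub_div hdx, Real.enorm_eq_ofReal_abs] using h
  · intro x
    have h := ENNReal.ofReal_le_ofReal (h2 x)
    have a1 := (hr ⌊x / dx⌋).1
    have a2 := (hl ⌊x / dx⌋).1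
    rw [ENNReal.ofReal_add (mul_nonneg a1 (hρ0 _)) (mul_nonneg a2 (hρ0 _)),
      ENNReal.ofReal_add (mul_nonneg (add_nonneg a1 a2) (hρ0 _)) (hd0 _),
      ENNReal.ofReal_mul a1, ENNReal.ofReal_mul a2, ENNReal.ofReal_mul (add_nonneg a1 a2),
      ENNReal.ofReal_add a1 a2] at h
    exact h

lemma gridNorm_mono {Ω : Domain} {dx : ℝ} {ρ ρ' : ℝ → ℝ} (h : ∀ x, ρ x ≤ ρ' x) (a : ℤ → ℝ) :
    gridNorm Ω dx ρ a ≤ gridNorm Ω dx ρ' a :=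
  lintegral_mono fun x => mul_le_mul_left (ENNReal.ofReal_le_ofReal (h x)) _

lemma gridNorm_mono_abs {Ω : Domain} {dx : ℝ} {ρ : ℝ → ℝ} {a b : ℤ → ℝ}
    (h : ∀ j, |a j| ≤ |b j|) : gridNorm Ω dx ρ a ≤ gridNorm Ω dx ρ b :=
  lintegral_mono fun x => by
    dsimp only
    gcongr
    rw [Real.enorm_eq_ofReal_abs, Real.enorm_eq_ofReal_abs]
    exact ENNReal.ofReal_le_ofReal (h _)

lemma gridNorm_const_mul_weight {Ω : Domain} {dx c : ℝ} (hc : 0 ≤ c) {ρ : ℝ → ℝ}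
    (a : ℤ → ℝ) :
    gridNorm Ω dx (fun x => c * ρ x) a = ENNReal.ofReal c * gridNorm Ω dx ρ a := by
  rw [gridNorm, gridNorm, ← lintegral_const_mul' _ _ ENNReal.ofReal_ne_top]
  simp only [ENNReal.ofReal_mul hc, mul_assoc]

lemma gridNorm_const_mul {Ω : Domain} {dx c : ℝ} {ρ : ℝ → ℝ} (a : ℤ → ℝ) :
    gridNorm Ω dx ρ (fun j => c * a j) = ‖c‖ₑ * gridNorm Ω dx ρ a := by
  rw [gridNorm, gridNorm, ← lintegral_const_mul' _ _ (by simp)]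
  refine lintegral_congr fun x => ?_
  simp only [stepFun, enorm_mul]; ring

lemma gridNorm_add_le {Ω : Domain} {dx : ℝ} {ρ : ℝ → ℝ} (hρ : Measurable ρ) (a b : ℤ → ℝ) :
    gridNorm Ω dx ρ (fun j => a j + b j) ≤ gridNorm Ω dx ρ a + gridNorm Ω dx ρ b := by
  unfold gridNorm
  rw [← lintegral_add_left (show Measurable fun x => ENNReal.ofReal (ρ x) * ‖stepFun dx a x‖ₑ from
    hρ.ennreal_ofReal.mul (measurable_stepFun dx a).enorm)]
  refine lintegral_mono fun x => ?_
  dsimp only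
  rw [← mul_add]
  gcongr
  exact enorm_add_le _ _

lemma gridNorm_shift {Ω : Domain} {dx : ℝ} (hdx : 0 < dx) {a : ℤ → ℝ} (pa : Ω.Per (stepFun dx a)) :
    gridNorm Ω dx (fun _ => 1) (fun j => a (j + 1)) = gridNorm Ω dx (fun _ => 1) a := by
  unfold gridNorm
  simp only [ENNReal.ofReal_one, one_mul]
  rw [← Domain.lintegral_shift (pa.comp (fun y => ‖y‖ₑ)) dx]
  simp only [stepFun, floor_add_div hdx]

/-- The implicit step is a contraction in `L¹(Ω)`. -/
lemma gridNorm_implicit_le {Ω : Domain} {dx lam C : ℝ} (hdx : 0 < dx) {r l f U : ℤ → ℝ}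
    (hr : ∀ j, 0 ≤ r j ∧ r j ≤ lam) (hl : ∀ j, 0 ≤ l j ∧ l j ≤ lam)
    (pr : Ω.Per (stepFun dx r)) (pl : Ω.Per (stepFun dx l)) (pU : Ω.Per (stepFun dx U))
    (hC : ∀ j, |U j| ≤ C)
    (h1 : ∀ j, |U j| + (r j + l j) * |U j| ≤
      |f j| + r (j - 1) * |U (j - 1)| + l (j + 1) * |U (j + 1)|) :
    gridNorm Ω dx (fun _ => 1) U ≤ gridNorm Ω dx (fun _ => 1) f := by
  have hlam : 0 ≤ lam := (hr 0).1.trans (hr 0).2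
  by_cases hG : gridNorm Ω dx (fun _ => 1) f = ⊤
  · rw [hG]; exact le_top
  set g := (gridNorm Ω dx (fun _ => 1) f).toReal with hg
  -- With the weight 1 the flux terms might be infinite and could not be cancelled. The exponential
  -- weights make them finite, and they increase to 1 as ε → 0.
  let ε : ℕ → ℝ := fun n => 1 / ((n : ℝ) + 1)
  have hε : ∀ n, 0 < ε n := fun n => by positivity
  have hε0 : Tendsto ε atTop (𝓝 0) := tendsto_one_div_add_atTop_nhds_zero_nat
  -- Mass leaves a site at a rate of at most `2 * lam`, and one jump multiplies the weight by at
  -- most `exp (ε * dx)`.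
  let c : ℕ → ℝ := fun n => 2 * lam * (Real.exp (ε n * dx) - 1)
  have hc0 : Tendsto c atTop (𝓝 0) := by
    have : Tendsto (fun n => 2 * lam * (Real.exp (ε n * dx) - 1)) atTop
        (𝓝 (2 * lam * (Real.exp (0 * dx) - 1))) :=
      (((Real.continuous_exp.tendsto _).comp (hε0.mul_const dx)).sub_const 1).const_mul _
    simpa using this
  have hcn : ∀ n, 0 ≤ c n := fun n => by
    have : 1 ≤ Real.exp (ε n * dx) := Real.one_le_exp (mul_nonneg (hε n).le hdx.le)
    have : 0 ≤ Real.exp (ε n * dx) - 1 := by linarith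
    positivity
  have hfin : ∀ n, gridNorm Ω dx (expWeight Ω (ε n)) U ≠ ⊤ := fun n => by
    refine ne_top_of_le_ne_top (ENNReal.mul_ne_top (lintegral_expWeight_lt_top Ω (hε n)).ne
      (ENNReal.ofReal_ne_top (r := C))) ?_
    rw [← lintegral_mul_const _ (measurable_expWeight Ω (ε n)).ennreal_ofReal]
    refine lintegral_mono fun x => ?_
    dsimp only
    gcongr
    rw [Real.enorm_eq_ofReal_abs]
    exact ENNReal.ofReal_le_ofReal (hC _)
  have hX : ∀ n, gridNorm Ω dx (expWeight Ω (ε n)) U ≤ gridNorm Ω dx (fun _ => 1) f +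
      ENNReal.ofReal (c n) * gridNorm Ω dx (expWeight Ω (ε n)) U := fun n => by
    rw [← gridNorm_const_mul_weight (hcn n)]
    refine (gridNorm_flux hdx hr hl (expWeight_nonneg Ω (ε n))
      (fun x => mul_nonneg (hcn n) (expWeight_nonneg Ω (ε n) x)) (measurable_expWeight Ω (ε n))
      pr pl pU (per_expWeight Ω (ε n)) (hfin n) h1 ?_).trans
      (add_le_add (gridNorm_mono (expWeight_le_one Ω (hε n).le) f) le_rfl)
    intro x
    have e1 := expWeight_shift_le Ω (hε n).le x dx
    have e2 := expWeight_shift_le Ω (hε n).le x (-dx)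
    rw [abs_neg, ← sub_eq_add_neg] at e2
    rw [abs_of_pos hdx] at e1 e2
    have hw := expWeight_nonneg Ω (ε n) x
    have hE : 0 ≤ (Real.exp (ε n * dx) - 1) * expWeight Ω (ε n) x :=
      mul_nonneg (sub_nonneg.2 (Real.one_le_exp (mul_nonneg (hε n).le hdx.le))) hw
    have a1 := mul_le_mul_of_nonneg_left e1 (hr ⌊x / dx⌋).1
    have a2 := mul_le_mul_of_nonneg_left e2 (hl ⌊x / dx⌋).1
    have b1 := mul_le_mul_of_nonneg_right (hr ⌊x / dx⌋).2 hE
    have b2 := mul_le_mul_of_nonneg_right (hl ⌊x / dx⌋).2 hE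
    simp only [c]
    nlinarith
  -- As soon as `c n < 1`, the error term is absorbed into the left-hand side; both norms are finite
  -- here.
  have hX' : ∀ᶠ n in atTop, gridNorm Ω dx (expWeight Ω (ε n)) U ≤
      ENNReal.ofReal (g / (1 - c n)) := by
    filter_upwards [hc0.eventually (gt_mem_nhds (show (0 : ℝ) < 1 by norm_num))] with n hn
    have h := hX n
    rw [← ENNReal.ofReal_toReal (hfin n), ← ENNReal.ofReal_toReal hG,
      ← ENNReal.ofReal_mul (hcn n), ← ENNReal.ofReal_add ENNReal.toReal_nonneg
        (mul_nonneg (hcn n) ENNReal.toReal_nonneg),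
      ENNReal.ofReal_le_ofReal_iff (add_nonneg ENNReal.toReal_nonneg
        (mul_nonneg (hcn n) ENNReal.toReal_nonneg))] at h
    rw [← ENNReal.ofReal_toReal (hfin n)]
    refine ENNReal.ofReal_le_ofReal ?_
    rw [le_div_iff₀ (by linarith)]
    linarith
  have hlim : Tendsto (fun n => ENNReal.ofReal (g / (1 - c n))) atTop
      (𝓝 (gridNorm Ω dx (fun _ => 1) f)) := by
    rw [← ENNReal.ofReal_toReal hG]
    refine (ENNReal.continuous_ofReal.tendsto _).comp ?_
    have : Tendsto (fun n => g / (1 - c n)) atTop (𝓝 (g / (1 - 0))) :=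
      tendsto_const_nhds.div (hc0.const_sub 1) (by norm_num)
    simpa using this
  -- Fatou's lemma removes the weight and proves at the same time that the unweighted norm is
  -- finite.
  calc gridNorm Ω dx (fun _ => 1) U
      = ∫⁻ x, liminf (fun n => ENNReal.ofReal (expWeight Ω (ε n) x) * ‖stepFun dx U x‖ₑ) atTop
          ∂Ω.measure := by
        refine lintegral_congr fun x => (Tendsto.liminf_eq ?_).symm
        exact ENNReal.Tendsto.mul_const ((ENNReal.continuous_ofReal.tendsto _).comp
          (tendsto_expWeight Ω x hε0)) (Or.inr (by simp))
    _ ≤ liminf (fun n => gridNorm Ω dx (expWeight Ω (ε n)) U) atTop :=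
        lintegral_liminf_le fun n =>
          (measurable_expWeight Ω (ε n)).ennreal_ofReal.mul (measurable_stepFun dx U).enorm
    _ ≤ liminf (fun n => ENNReal.ofReal (g / (1 - c n))) atTop := liminf_le_liminf hX'
    _ = _ := hlim.liminf_eq

/-- The maximum principle for the implicit step. -/
lemma abs_le_of_implicit {lam C K : ℝ} {c p q U : ℤ → ℝ} (hc : ∀ j, c j ≤ lam)
    (hp : ∀ j, 0 ≤ p j) (hq : ∀ j, 0 ≤ q j) (hpq : ∀ j, p j + q j ≤ c j) (hC : ∀ j, |U j| ≤ C)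
    (h1 : ∀ j, (1 + c j) * |U j| ≤ K + p j * |U (j - 1)| + q j * |U (j + 1)|) (j : ℤ) :
    |U j| ≤ K := by
  have hbdd : BddAbove (range fun j => |U j|) := ⟨C, by rintro _ ⟨j, rfl⟩; exact hC j⟩
  set S := ⨆ j, |U j| with hS
  have hle : ∀ j, |U j| ≤ S := fun j => le_ciSup hbdd j
  have hS0 : 0 ≤ S := (abs_nonneg _).trans (hle 0)
  have hc0 : ∀ j, 0 ≤ c j := fun j => (add_nonneg (hp j) (hq j)).trans (hpq j)
  have hlam : 0 ≤ lam := (hc0 0).trans (hc 0)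
  by_contra! hj
  have hK : K < S := hj.trans_le (hle j)
  -- The supremum need not be attained, so a bound independent of `j` is needed. Adding `(lam - c j)
  -- * |U j| ≤ (lam - c j) * S` replaces the local rate `c j` by `lam`.
  have hb : ∀ j, |U j| ≤ (K + lam * S) / (1 + lam) := fun j => by
    rw [le_div_iff₀ (by linarith)]
    have a1 := mul_le_mul_of_nonneg_left (hle (j - 1)) (hp j)
    have a2 := mul_le_mul_of_nonneg_left (hle (j + 1)) (hq j)
    have a3 := mul_le_mul_of_nonneg_right (hpq j) hS0
    have a4 := mul_le_mul_of_nonneg_right (hc j) (sub_nonneg.2 (hle j))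
    nlinarith [h1 j]
  have : S ≤ (K + lam * S) / (1 + lam) := ciSup_le hb
  rw [le_div_iff₀ (by linarith)] at this
  linarith

end ThetaScheme

/-! ### Differences, and one θ-step in flux form -/

namespace ThetaScheme

/-- Undivided forward difference. -/
def diff1 (a : ℤ → ℝ) (j : ℤ) : ℝ := a (j + 1) - a j

/-- Undivided central second difference. -/
def diff2 (a : ℤ → ℝ) (j : ℤ) : ℝ := a (j + 1) - 2 * a j + a (j - 1)

lemma stepFun_shift {dx : ℝ} (hdx : 0 < dx) (a : ℤ → ℝ) (x : ℝ) :
    stepFun dx (fun j => a (j + 1)) x = stepFun dx a (x + dx) := by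
  simp only [stepFun, floor_add_div hdx]

lemma stepFun_shift_neg {dx : ℝ} (hdx : 0 < dx) (a : ℤ → ℝ) (x : ℝ) :
    stepFun dx (fun j => a (j - 1)) x = stepFun dx a (x - dx) := by
  simp only [stepFun, floor_sub_div hdx]

lemma Domain.Per.stepFun_shift {Ω : Domain} {dx : ℝ} (hdx : 0 < dx) {a : ℤ → ℝ}
    (pa : Ω.Per (stepFun dx a)) : Ω.Per (stepFun dx (fun j => a (j + 1))) := by
  have := pa.shift dx
  simpa only [← ThetaScheme.stepFun_shift hdx] using this

lemma Domain.Per.stepFun_shift_neg {Ω : Domain} {dx : ℝ} (hdx : 0 < dx) {a : ℤ → ℝ}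
    (pa : Ω.Per (stepFun dx a)) : Ω.Per (stepFun dx (fun j => a (j - 1))) := by
  have := pa.shift (-dx)
  simp only [← sub_eq_add_neg, ← ThetaScheme.stepFun_shift_neg hdx] at this
  exact this

lemma Domain.Per.diff1 {Ω : Domain} {dx : ℝ} (hdx : 0 < dx) {a : ℤ → ℝ}
    (pa : Ω.Per (stepFun dx a)) : Ω.Per (stepFun dx (diff1 a)) :=
  (pa.stepFun_shift hdx).comp₂ pa (fun u v => u - v)

lemma Domain.Per.diff2 {Ω : Domain} {dx : ℝ} (hdx : 0 < dx) {a : ℤ → ℝ}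
    (pa : Ω.Per (stepFun dx a)) : Ω.Per (stepFun dx (diff2 a)) :=
  ((pa.stepFun_shift hdx).comp₂ pa (fun u v => u - 2 * v)).comp₂ (pa.stepFun_shift_neg hdx)
    (fun u v => u + v)

/-- `L¹` contraction in the two halves of a step of the `θ`-scheme in flux form, with a weight. -/
lemma gridNorm_theta_step {Ω : Domain} {dx lam₁ lam₂ C c : ℝ} (hdx : 0 < dx)
    {r l f U A : ℤ → ℝ} {ψ : ℝ → ℝ}
    (hr : ∀ j, 0 ≤ r j ∧ r j ≤ 1) (hl : ∀ j, 0 ≤ l j ∧ l j ≤ 1)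
    (h₁ : 0 ≤ lam₁) (h₂ : 0 ≤ lam₂) (h₂' : 2 * lam₂ ≤ 1)
    (pr : Ω.Per (stepFun dx r)) (pl : Ω.Per (stepFun dx l)) (pU : Ω.Per (stepFun dx U))
    (hC : ∀ j, |U j| ≤ C)
    (hU : ∀ j, U j - f j =
      lam₁ * (r (j - 1) * U (j - 1) + l (j + 1) * U (j + 1) - (r j + l j) * U j))
    (hA : ∀ j, A j - U j =
      lam₂ * (r (j - 1) * U (j - 1) + l (j + 1) * U (j + 1) - (r j + l j) * U j))
    (hf : gridNorm Ω dx (fun _ => 1) f ≠ ⊤) (pψ : Ω.Per ψ) (mψ : Measurable ψ)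
    (hψ : ∀ x, 0 ≤ ψ x ∧ ψ x ≤ 1) (hc0 : 0 ≤ c)
    (hc : ∀ x, r ⌊x / dx⌋ * (ψ (x + dx) - ψ x) + l ⌊x / dx⌋ * (ψ (x - dx) - ψ x) ≤ c) :
    gridNorm Ω dx (fun _ => 1) U ≤ gridNorm Ω dx (fun _ => 1) f ∧
    gridNorm Ω dx ψ U ≤ gridNorm Ω dx ψ f +
      ENNReal.ofReal (lam₁ * c) * gridNorm Ω dx (fun _ => 1) U ∧
    gridNorm Ω dx ψ A ≤ gridNorm Ω dx ψ U +
      ENNReal.ofReal (lam₂ * c) * gridNorm Ω dx (fun _ => 1) U := by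
  have hr₁ : ∀ j, 0 ≤ lam₁ * r j ∧ lam₁ * r j ≤ lam₁ := fun j =>
    ⟨mul_nonneg h₁ (hr j).1, mul_le_of_le_one_right h₁ (hr j).2⟩
  have hl₁ : ∀ j, 0 ≤ lam₁ * l j ∧ lam₁ * l j ≤ lam₁ := fun j =>
    ⟨mul_nonneg h₁ (hl j).1, mul_le_of_le_one_right h₁ (hl j).2⟩
  have hr₂ : ∀ j, 0 ≤ lam₂ * r j ∧ lam₂ * r j ≤ lam₂ := fun j =>
    ⟨mul_nonneg h₂ (hr j).1, mul_le_of_le_one_right h₂ (hr j).2⟩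
  have hl₂ : ∀ j, 0 ≤ lam₂ * l j ∧ lam₂ * l j ≤ lam₂ := fun j =>
    ⟨mul_nonneg h₂ (hl j).1, mul_le_of_le_one_right h₂ (hl j).2⟩
  have tri : ∀ x y z : ℝ, |x + y + z| ≤ |x| + |y| + |z| := fun x y z =>
    (abs_add_le _ _).trans (add_le_add (abs_add_le _ _) le_rfl)
  -- With the outflow on the left the coefficient of `U j` is at least 1 for every step size: the
  -- implicit half needs no CFL condition.
  have i1 : ∀ j, |U j| + (lam₁ * r j + lam₁ * l j) * |U j| ≤
      |f j| + lam₁ * r (j - 1) * |U (j - 1)| + lam₁ * l (j + 1) * |U (j + 1)| := fun j => by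
    have e : (1 + (lam₁ * r j + lam₁ * l j)) * U j =
        f j + lam₁ * r (j - 1) * U (j - 1) + lam₁ * l (j + 1) * U (j + 1) := by
      linear_combination hU j
    have e' := congrArg abs e
    rw [abs_mul, abs_of_nonneg (by linarith [(hr₁ j).1, (hl₁ j).1])] at e'
    have := tri (f j) (lam₁ * r (j - 1) * U (j - 1)) (lam₁ * l (j + 1) * U (j + 1))
    rw [abs_mul (lam₁ * r (j - 1)), abs_mul (lam₁ * l (j + 1)), abs_of_nonneg (hr₁ _).1,
      abs_of_nonneg (hl₁ _).1] at this
    linarith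
  -- Here `2 * lam₂ ≤ 1` makes the coefficient that stays at the site nonnegative.
  have i2 : ∀ j, |A j| + (lam₂ * r j + lam₂ * l j) * |U j| ≤
      |U j| + lam₂ * r (j - 1) * |U (j - 1)| + lam₂ * l (j + 1) * |U (j + 1)| := fun j => by
    have e : A j = (1 - (lam₂ * r j + lam₂ * l j)) * U j + lam₂ * r (j - 1) * U (j - 1)
        + lam₂ * l (j + 1) * U (j + 1) := by
      linear_combination hA j
    have := tri ((1 - (lam₂ * r j + lam₂ * l j)) * U j) (lam₂ * r (j - 1) * U (j - 1))
      (lam₂ * l (j + 1) * U (j + 1))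
    rw [abs_mul (lam₂ * r (j - 1)), abs_mul (lam₂ * l (j + 1)), abs_mul (1 - _),
      abs_of_nonneg (hr₂ _).1, abs_of_nonneg (hl₂ _).1,
      abs_of_nonneg (a := 1 - _) (by linarith [(hr₂ j).2, (hl₂ j).2]), ← e] at this
    linarith
  have m1 : gridNorm Ω dx (fun _ => 1) U ≤ gridNorm Ω dx (fun _ => 1) f :=
    gridNorm_implicit_le hdx hr₁ hl₁ (pr.comp (lam₁ * ·)) (pl.comp (lam₁ * ·)) pU hC i1
  -- The unweighted contraction comes first, because it supplies the finiteness that `gridNorm_flux`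
  -- requires for the weight `ψ`.
  have hfin : gridNorm Ω dx ψ U ≠ ⊤ :=
    ne_top_of_le_ne_top hf ((gridNorm_mono (fun x => (hψ x).2) U).trans m1)
  refine ⟨m1, ?_, ?_⟩
  · have := gridNorm_flux hdx hr₁ hl₁ (fun x => (hψ x).1) (d := fun _ => lam₁ * c * 1)
      (fun _ => by positivity) mψ (pr.comp (lam₁ * ·)) (pl.comp (lam₁ * ·)) pU pψ hfin i1
      (fun x => by nlinarith [mul_le_mul_of_nonneg_left (hc x) h₁])
    rwa [gridNorm_const_mul_weight (by positivity)] at this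
  · have := gridNorm_flux hdx hr₂ hl₂ (fun x => (hψ x).1) (d := fun _ => lam₂ * c * 1)
      (fun _ => by positivity) mψ (pr.comp (lam₂ * ·)) (pl.comp (lam₂ * ·)) pU pψ hfin i2
      (fun x => by nlinarith [mul_le_mul_of_nonneg_left (hc x) h₂])
    rwa [gridNorm_const_mul_weight (by positivity)] at this

/-- Maximum principle for the two halves of a step of the `θ`-scheme. -/
lemma abs_le_of_theta_step {lam₁ lam₂ C K : ℝ} {p q f U A : ℤ → ℝ}
    (hp : ∀ j, 0 ≤ p j ∧ p j ≤ 1) (hq : ∀ j, 0 ≤ q j ∧ q j ≤ 1)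
    (h₁ : 0 ≤ lam₁) (h₂ : 0 ≤ lam₂) (h₂' : 2 * lam₂ ≤ 1) (hC : ∀ j, |U j| ≤ C)
    (hU : ∀ j, U j - f j = lam₁ * (p j * U (j - 1) + q j * U (j + 1) - (p j + q j) * U j))
    (hA : ∀ j, A j - U j = lam₂ * (p j * U (j - 1) + q j * U (j + 1) - (p j + q j) * U j))
    (hf : ∀ j, |f j| ≤ K) : (∀ j, |U j| ≤ K) ∧ ∀ j, |A j| ≤ K := by
  have tri : ∀ x y z : ℝ, |x + y + z| ≤ |x| + |y| + |z| := fun x y z =>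
    (abs_add_le _ _).trans (add_le_add (abs_add_le _ _) le_rfl)
  have hUK : ∀ j, |U j| ≤ K := by
    refine abs_le_of_implicit (lam := 2 * lam₁) (c := fun j => lam₁ * p j + lam₁ * q j)
      (p := fun j => lam₁ * p j) (q := fun j => lam₁ * q j) (fun j => ?_)
      (fun j => mul_nonneg h₁ (hp j).1) (fun j => mul_nonneg h₁ (hq j).1) (fun j => le_rfl) hC
      fun j => ?_
    · have := mul_le_of_le_one_right h₁ (hp j).2
      have := mul_le_of_le_one_right h₁ (hq j).2
      linarith
    · have e : (1 + (lam₁ * p j + lam₁ * q j)) * U j =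
          f j + lam₁ * p j * U (j - 1) + lam₁ * q j * U (j + 1) := by
        linear_combination hU j
      have e' := congrArg abs e
      have p0 := mul_nonneg h₁ (hp j).1
      have q0 := mul_nonneg h₁ (hq j).1
      rw [abs_mul, abs_of_nonneg (by linarith)] at e'
      have := tri (f j) (lam₁ * p j * U (j - 1)) (lam₁ * q j * U (j + 1))
      rw [abs_mul (lam₁ * p j), abs_mul (lam₁ * q j), abs_of_nonneg p0, abs_of_nonneg q0] at this
      linarith [hf j]
  refine ⟨hUK, fun j => ?_⟩
  have e : A j = (1 - (lam₂ * p j + lam₂ * q j)) * U j + lam₂ * p j * U (j - 1)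
      + lam₂ * q j * U (j + 1) := by
    linear_combination hA j
  have p0 := mul_nonneg h₂ (hp j).1
  have q0 := mul_nonneg h₂ (hq j).1
  have p1 := mul_le_of_le_one_right h₂ (hp j).2
  have q1 := mul_le_of_le_one_right h₂ (hq j).2
  have s0 : 0 ≤ 1 - (lam₂ * p j + lam₂ * q j) := by linarith
  have := tri ((1 - (lam₂ * p j + lam₂ * q j)) * U j) (lam₂ * p j * U (j - 1))
    (lam₂ * q j * U (j + 1))
  rw [abs_mul (lam₂ * p j), abs_mul (lam₂ * q j), abs_mul (1 - _), abs_of_nonneg p0,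
    abs_of_nonneg q0, abs_of_nonneg s0, ← e] at this
  nlinarith [mul_le_mul_of_nonneg_left (hUK j) s0, mul_le_mul_of_nonneg_left (hUK (j - 1)) p0,
    mul_le_mul_of_nonneg_left (hUK (j + 1)) q0]

end ThetaScheme

/-! ### Stability of the θ-scheme -/

namespace ThetaScheme

namespace IsSchemeSolution

variable {Ω : Domain} {B : ℝ → ℝ} {w₀ : ℝ → ℝ} {θ dx dt : ℝ} {W : ℕ → ℤ → ℝ}

lemma per (h : IsSchemeSolution Ω B w₀ θ dx dt W) (n : ℕ) : Ω.Per (stepFun dx (W n)) := by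
  intro hΩ x
  subst hΩ
  obtain ⟨N, hN, hNdx, hW⟩ := h.grid
  have hdx : dx ≠ 0 := by rintro rfl; simp at hNdx
  have : (x + 1) / dx = x / dx + ((N : ℤ) : ℝ) := by
    field_simp; push_cast; linarith
  simp only [stepFun, this, Int.floor_add_intCast, hW]

lemma bounded (h : IsSchemeSolution Ω B w₀ θ dx dt W) (n : ℕ) : ∃ C, ∀ j, |W n j| ≤ C := by
  cases Ω with
  | line => exact h.grid n
  | circle =>
    obtain ⟨N, hN, -, hW⟩ := h.grid
    refine ⟨∑ i ∈ Finset.range N, |W n i|, fun j => ?_⟩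
    have hp : Function.Periodic (W n) (N : ℤ) := hW n
    have hN' : (N : ℤ) ≠ 0 := by exact_mod_cast hN.ne'
    have e : W n j = W n ((j % N).toNat : ℤ) := by
      rw [Int.toNat_of_nonneg (Int.emod_nonneg _ hN'), Int.emod_def, mul_comm]
      exact (hp.sub_int_mul_eq (j / N)).symm
    rw [e]
    refine Finset.single_le_sum (f := fun i : ℕ => |W n i|) (fun i _ => abs_nonneg _) ?_
    rw [Finset.mem_range]
    have := Int.emod_lt_of_pos j (show (0 : ℤ) < N by exact_mod_cast hN)
    have := Int.emod_nonneg j hN'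
    omega

lemma per_thetaLevel (h : IsSchemeSolution Ω B w₀ θ dx dt W) (n : ℕ) :
    Ω.Per (stepFun dx (thetaLevel θ W n)) :=
  (h.per (n + 1)).comp₂ (h.per n) (fun u v => θ * u + (1 - θ) * v)

lemma bounded_thetaLevel (h : IsSchemeSolution Ω B w₀ θ dx dt W) (n : ℕ) :
    ∃ C, ∀ j, |thetaLevel θ W n j| ≤ C := by
  obtain ⟨C₁, h₁⟩ := h.bounded n
  obtain ⟨C₂, h₂⟩ := h.bounded (n + 1)
  refine ⟨|θ| * C₂ + |1 - θ| * C₁, fun j => ?_⟩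
  unfold thetaLevel
  refine (abs_add_le _ _).trans ?_
  rw [abs_mul, abs_mul]
  gcongr
  · exact h₂ j
  · exact h₁ j

lemma step_eq (h : IsSchemeSolution Ω B w₀ θ dx dt W) (hdt : 0 < dt) (n : ℕ)
    (j : ℤ) : W (n + 1) j - W n j =
      dt / dx ^ 2 * (B (thetaLevel θ W n j) * diff2 (thetaLevel θ W n) j) := by
  have e := h.step n j
  rw [div_eq_iff hdt.ne'] at e
  rw [e]
  simp only [Dplus, Dminus, diff2, add_sub_cancel_right]
  field_simp
  ring

/-- Since w^{n+θ} - w^n = θ (w^{n+1} - w^n), a θ-step splits at level n+θ into this implicit Euler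
step and the explicit one of `explicit_eq`, with the same right-hand side. -/
lemma implicit_eq (h : IsSchemeSolution Ω B w₀ θ dx dt W) (hdt : 0 < dt) (n : ℕ)
    (j : ℤ) : thetaLevel θ W n j - W n j =
      θ * (dt / dx ^ 2) * (B (thetaLevel θ W n j) * diff2 (thetaLevel θ W n) j) := by
  rw [mul_assoc, ← h.step_eq hdt, thetaLevel]; ring

lemma explicit_eq (h : IsSchemeSolution Ω B w₀ θ dx dt W) (hdt : 0 < dt) (n : ℕ)
    (j : ℤ) : W (n + 1) j - thetaLevel θ W n j =
      (1 - θ) * (dt / dx ^ 2) * (B (thetaLevel θ W n j) * diff2 (thetaLevel θ W n) j) := by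
  rw [mul_assoc, ← h.step_eq hdt, thetaLevel]; ring

end IsSchemeSolution

/-- The form in which the CFL condition is used: each of the two rates of the explicit half is at
most 1/2. -/
lemma CFL.le {θ dx dt : ℝ} (hθ : θ ∈ Icc (0 : ℝ) 1) (h : CFL θ dx dt) :
    2 * ((1 - θ) * (dt / dx ^ 2)) ≤ 1 := by
  rcases hθ.2.eq_or_lt with rfl | hlt
  · simp
  · rcases h with rfl | h
    · simp
    · rw [lt_div_iff₀ (by linarith)] at h
      linarith

/-- The common hypotheses of the stability estimates. -/
structure StableScheme (Ω : Domain) (B : ℝ → ℝ) (w₀ : ℝ → ℝ) (θ dx dt : ℝ)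
    (W : ℕ → ℤ → ℝ) : Prop where
  sol : IsSchemeSolution Ω B w₀ θ dx dt W
  coeff : ∀ s, 0 ≤ B s ∧ B s ≤ 1
  theta : θ ∈ Icc (0 : ℝ) 1
  dx_pos : 0 < dx
  dt_pos : 0 < dt
  cfl : CFL θ dx dt

namespace StableScheme

variable {Ω : Domain} {B : ℝ → ℝ} {w₀ : ℝ → ℝ} {θ dx dt : ℝ} {W : ℕ → ℤ → ℝ}

lemma rate₁ (h : StableScheme Ω B w₀ θ dx dt W) : 0 ≤ θ * (dt / dx ^ 2) :=
  mul_nonneg h.theta.1 (div_nonneg h.dt_pos.le (sq_nonneg _))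

lemma rate₂ (h : StableScheme Ω B w₀ θ dx dt W) : 0 ≤ (1 - θ) * (dt / dx ^ 2) :=
  mul_nonneg (sub_nonneg.2 h.theta.2) (div_nonneg h.dt_pos.le (sq_nonneg _))

lemma abs_le_step (h : StableScheme Ω B w₀ θ dx dt W) {M : ℝ} {n : ℕ}
    (hM : ∀ j, |W n j| ≤ M) : (∀ j, |thetaLevel θ W n j| ≤ M) ∧ ∀ j, |W (n + 1) j| ≤ M := by
  obtain ⟨C, hC⟩ := h.sol.bounded_thetaLevel n
  refine abs_le_of_theta_step (p := fun j => B (thetaLevel θ W n j))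
    (q := fun j => B (thetaLevel θ W n j)) (fun j => h.coeff _) (fun j => h.coeff _) h.rate₁
    h.rate₂ (h.cfl.le h.theta) hC (fun j => ?_) (fun j => ?_) hM
  · rw [h.sol.implicit_eq h.dt_pos, diff2]; ring
  · rw [h.sol.explicit_eq h.dt_pos, diff2]; ring

lemma abs_le (h : StableScheme Ω B w₀ θ dx dt W) {M : ℝ}
    (hM : ∀ j, |W 0 j| ≤ M) (n : ℕ) : ∀ j, |W n j| ≤ M := by
  induction n with
  | zero => exact hM
  | succ n ih => exact (h.abs_le_step ih).2

/-- The exchange between the sites j-1 and j has the rate B at the grid point j in both directions.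
By this symmetry the first differences obey the maximum principle as well as the L¹ contraction. -/
lemma diff1_implicit (h : StableScheme Ω B w₀ θ dx dt W) (n : ℕ) (j : ℤ) :
    diff1 (thetaLevel θ W n) j - diff1 (W n) j = θ * (dt / dx ^ 2) *
      (B (thetaLevel θ W n j) * diff1 (thetaLevel θ W n) (j - 1) +
        B (thetaLevel θ W n (j + 1)) * diff1 (thetaLevel θ W n) (j + 1) -
        (B (thetaLevel θ W n (j + 1)) + B (thetaLevel θ W n j)) *
          diff1 (thetaLevel θ W n) j) := by
  have e1 := h.sol.implicit_eq h.dt_pos n j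
  have e2 := h.sol.implicit_eq h.dt_pos n (j + 1)
  simp only [diff1, diff2, sub_add_cancel, add_sub_cancel_right] at *
  linear_combination e2 - e1

lemma diff1_explicit (h : StableScheme Ω B w₀ θ dx dt W) (n : ℕ) (j : ℤ) :
    diff1 (W (n + 1)) j - diff1 (thetaLevel θ W n) j = (1 - θ) * (dt / dx ^ 2) *
      (B (thetaLevel θ W n j) * diff1 (thetaLevel θ W n) (j - 1) +
        B (thetaLevel θ W n (j + 1)) * diff1 (thetaLevel θ W n) (j + 1) -
        (B (thetaLevel θ W n (j + 1)) + B (thetaLevel θ W n j)) *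
          diff1 (thetaLevel θ W n) j) := by
  have e1 := h.sol.explicit_eq h.dt_pos n j
  have e2 := h.sol.explicit_eq h.dt_pos n (j + 1)
  simp only [diff1, diff2, sub_add_cancel, add_sub_cancel_right] at *
  linear_combination e2 - e1

lemma bounded_diff1 (h : StableScheme Ω B w₀ θ dx dt W) (n : ℕ) :
    ∃ C, ∀ j, |diff1 (thetaLevel θ W n) j| ≤ C := by
  obtain ⟨C, hC⟩ := h.sol.bounded_thetaLevel n
  exact ⟨C + C, fun j => (abs_sub _ _).trans (add_le_add (hC _) (hC _))⟩

lemma abs_diff1_le (h : StableScheme Ω B w₀ θ dx dt W) {K : ℝ}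
    (hK : ∀ j, |diff1 (W 0) j| ≤ K) (n : ℕ) : ∀ j, |diff1 (W n) j| ≤ K := by
  induction n with
  | zero => exact hK
  | succ n ih =>
    obtain ⟨C, hC⟩ := h.bounded_diff1 n
    refine (abs_le_of_theta_step (p := fun j => B (thetaLevel θ W n j))
      (q := fun j => B (thetaLevel θ W n (j + 1))) (fun j => h.coeff _) (fun j => h.coeff _)
      h.rate₁ h.rate₂ (h.cfl.le h.theta) hC (fun j => ?_) (fun j => ?_) ih).2
    · rw [h.diff1_implicit]; ring
    · rw [h.diff1_explicit]; ring

lemma gridNorm_diff1_le (h : StableScheme Ω B w₀ θ dx dt W) (n : ℕ) :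
    gridNorm Ω dx (fun _ => 1) (diff1 (W n)) ≤ gridNorm Ω dx (fun _ => 1) (diff1 (W 0)) := by
  by_cases hfin : gridNorm Ω dx (fun _ => 1) (diff1 (W 0)) = ⊤
  · rw [hfin]; exact le_top
  induction n with
  | zero => exact le_rfl
  | succ n ih =>
    obtain ⟨C, hC⟩ := h.bounded_diff1 n
    have pa := h.sol.per_thetaLevel n
    have pβ : Ω.Per (stepFun dx (fun j => B (thetaLevel θ W n j))) := pa.comp B
    obtain ⟨m1, -, m2⟩ := gridNorm_theta_step (Ω := Ω) (ψ := fun _ => 1) (c := 0) h.dx_pos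
      (r := fun j => B (thetaLevel θ W n (j + 1))) (l := fun j => B (thetaLevel θ W n j))
      (f := diff1 (W n)) (A := diff1 (W (n + 1)))
      (fun j => h.coeff _) (fun j => h.coeff _) h.rate₁ h.rate₂ (h.cfl.le h.theta)
      (pβ.stepFun_shift h.dx_pos) pβ (pa.diff1 h.dx_pos) hC
      (fun j => by rw [h.diff1_implicit]; simp only [sub_add_cancel])
      (fun j => by rw [h.diff1_explicit]; simp only [sub_add_cancel])
      (ne_top_of_le_ne_top hfin ih)
      (Domain.per_const 1) measurable_const (fun _ => ⟨zero_le_one, le_rfl⟩) le_rfl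
      (fun x => by simp)
    simp only [mul_zero, ENNReal.ofReal_zero, zero_mul, add_zero] at m2
    exact (m2.trans m1).trans ih

/-- Second differences decay in `L¹`; with a weight, they grow at most by the second difference
of the weight. -/
lemma gridNorm_diff2_step (h : StableScheme Ω B w₀ θ dx dt W) (n : ℕ)
    (hfin : gridNorm Ω dx (fun _ => 1) (diff2 (W n)) ≠ ⊤) {ψ : ℝ → ℝ} {c : ℝ} (pψ : Ω.Per ψ)
    (mψ : Measurable ψ) (hψ : ∀ x, 0 ≤ ψ x ∧ ψ x ≤ 1) (hc0 : 0 ≤ c)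
    (hc : ∀ x, ψ (x + dx) - 2 * ψ x + ψ (x - dx) ≤ c) :
    gridNorm Ω dx (fun _ => 1) (diff2 (thetaLevel θ W n)) ≤
      gridNorm Ω dx (fun _ => 1) (diff2 (W n)) ∧
    gridNorm Ω dx ψ (diff2 (thetaLevel θ W n)) ≤ gridNorm Ω dx ψ (diff2 (W n)) +
      ENNReal.ofReal (θ * (dt / dx ^ 2) * c) *
        gridNorm Ω dx (fun _ => 1) (diff2 (thetaLevel θ W n)) ∧
    gridNorm Ω dx ψ (diff2 (W (n + 1))) ≤ gridNorm Ω dx ψ (diff2 (thetaLevel θ W n)) +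
      ENNReal.ofReal ((1 - θ) * (dt / dx ^ 2) * c) *
        gridNorm Ω dx (fun _ => 1) (diff2 (thetaLevel θ W n)) := by
  obtain ⟨C, hC⟩ := h.bounded_diff1 n
  have pa := h.sol.per_thetaLevel n
  have pβ : Ω.Per (stepFun dx (fun j => B (thetaLevel θ W n j))) := pa.comp B
  -- Both rates out of a site equal B at that site, so the weight enters only through its second
  -- difference, multiplied by a number in [0,1].
  refine gridNorm_theta_step (Ω := Ω) (C := C + C) h.dx_pos
      (r := fun j => B (thetaLevel θ W n j)) (l := fun j => B (thetaLevel θ W n j))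
      (f := diff2 (W n)) (A := diff2 (W (n + 1)))
      (fun j => h.coeff _) (fun j => h.coeff _) h.rate₁ h.rate₂ (h.cfl.le h.theta)
      pβ pβ (pa.diff2 h.dx_pos) (fun j => ?_) (fun j => ?_) (fun j => ?_) hfin
      pψ mψ hψ hc0 (fun x => ?_)
  · have : diff2 (thetaLevel θ W n) j =
        diff1 (thetaLevel θ W n) j - diff1 (thetaLevel θ W n) (j - 1) := by
      simp only [diff1, diff2, sub_add_cancel]; ring
    rw [this]
    exact (abs_sub _ _).trans (add_le_add (hC _) (hC _))
  · have e1 := h.sol.implicit_eq h.dt_pos n j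
    have e2 := h.sol.implicit_eq h.dt_pos n (j + 1)
    have e3 := h.sol.implicit_eq h.dt_pos n (j - 1)
    unfold diff2 at *
    linear_combination e2 - 2 * e1 + e3
  · have e1 := h.sol.explicit_eq h.dt_pos n j
    have e2 := h.sol.explicit_eq h.dt_pos n (j + 1)
    have e3 := h.sol.explicit_eq h.dt_pos n (j - 1)
    unfold diff2 at *
    linear_combination e2 - 2 * e1 + e3
  · obtain ⟨b0, b1⟩ := h.coeff (thetaLevel θ W n ⌊x / dx⌋)
    have := hc x
    have h1 := mul_le_mul_of_nonneg_left this b0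
    have h2 := mul_le_mul_of_nonneg_right b1 hc0
    linarith

lemma gridNorm_diff2_le (h : StableScheme Ω B w₀ θ dx dt W) (n : ℕ) :
    gridNorm Ω dx (fun _ => 1) (diff2 (W n)) ≤ gridNorm Ω dx (fun _ => 1) (diff2 (W 0)) ∧
    gridNorm Ω dx (fun _ => 1) (diff2 (thetaLevel θ W n)) ≤
      gridNorm Ω dx (fun _ => 1) (diff2 (W 0)) := by
  by_cases hfin : gridNorm Ω dx (fun _ => 1) (diff2 (W 0)) = ⊤
  · rw [hfin]; exact ⟨le_top, le_top⟩
  have key := fun n (hn : gridNorm Ω dx (fun _ => 1) (diff2 (W n)) ≠ ⊤) =>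
    h.gridNorm_diff2_step n hn (Domain.per_const 1) measurable_const
      (fun _ => ⟨zero_le_one, le_rfl⟩) (c := 0) le_rfl (fun _ => by norm_num)
  simp only [mul_zero, ENNReal.ofReal_zero, zero_mul, add_zero] at key
  induction n with
  | zero => exact ⟨le_rfl, (key 0 hfin).1⟩
  | succ n ih =>
    have i1 := (key n (ne_top_of_le_ne_top hfin ih.1)).2.2.trans ih.2
    exact ⟨i1, (key (n + 1) (ne_top_of_le_ne_top hfin i1)).1.trans i1⟩

/-- Each full step adds at most `dt / dx ^ 2 * c` times the unweighted norm, which does not grow.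
The intermediate level costs the fraction θ of one more step, rounded up to give `n + 1`. -/
lemma gridNorm_weight_diff2_le (h : StableScheme Ω B w₀ θ dx dt W)
    (hfin : gridNorm Ω dx (fun _ => 1) (diff2 (W 0)) ≠ ⊤) {ψ : ℝ → ℝ} {c : ℝ} (pψ : Ω.Per ψ)
    (mψ : Measurable ψ) (hψ : ∀ x, 0 ≤ ψ x ∧ ψ x ≤ 1) (hc0 : 0 ≤ c)
    (hc : ∀ x, ψ (x + dx) - 2 * ψ x + ψ (x - dx) ≤ c) (n : ℕ) :
    gridNorm Ω dx ψ (diff2 (thetaLevel θ W n)) ≤ gridNorm Ω dx ψ (diff2 (W 0)) +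
      ENNReal.ofReal ((n + 1) * (dt / dx ^ 2 * c)) *
        gridNorm Ω dx (fun _ => 1) (diff2 (W 0)) := by
  set G := gridNorm Ω dx (fun _ => 1) (diff2 (W 0))
  have hμ : 0 ≤ dt / dx ^ 2 := div_nonneg h.dt_pos.le (sq_nonneg _)
  have key := fun n => h.gridNorm_diff2_step n
    (ne_top_of_le_ne_top hfin (h.gridNorm_diff2_le n).1) pψ mψ hψ hc0 hc
  have half : ∀ n : ℕ, gridNorm Ω dx ψ (diff2 (W n)) ≤ gridNorm Ω dx ψ (diff2 (W 0)) +
      ENNReal.ofReal (n * (dt / dx ^ 2 * c)) * G →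
      gridNorm Ω dx ψ (diff2 (thetaLevel θ W n)) ≤ gridNorm Ω dx ψ (diff2 (W 0)) +
      ENNReal.ofReal (n * (dt / dx ^ 2 * c) + θ * (dt / dx ^ 2) * c) * G := fun n hn => by
    refine (key n).2.1.trans ?_
    rw [ENNReal.ofReal_add (by positivity) (mul_nonneg h.rate₁ hc0), add_mul, ← add_assoc]
    gcongr
    exact (h.gridNorm_diff2_le n).2
  have main : ∀ n : ℕ, gridNorm Ω dx ψ (diff2 (W n)) ≤ gridNorm Ω dx ψ (diff2 (W 0)) +
      ENNReal.ofReal (n * (dt / dx ^ 2 * c)) * G := fun n => by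
    induction n with
    | zero => simp
    | succ n ih =>
      refine (key n).2.2.trans ((add_le_add (half n ih) (mul_le_mul_right
        (h.gridNorm_diff2_le n).2 _)).trans ?_)
      rw [add_assoc, ← add_mul, ← ENNReal.ofReal_add (add_nonneg (by positivity)
        (mul_nonneg h.rate₁ hc0)) (mul_nonneg h.rate₂ hc0)]
      apply le_of_eq
      congr 3
      push_cast
      ring
  refine (half n (main n)).trans ?_
  gcongr
  have := mul_le_of_le_one_left (mul_nonneg hμ hc0) h.theta.2
  nlinarith

lemma gridNorm_sub_succ_le (h : StableScheme Ω B w₀ θ dx dt W) (ψ : ℝ → ℝ) (n : ℕ) :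
    gridNorm Ω dx ψ (fun j => W (n + 1) j - W n j) ≤
      ENNReal.ofReal (dt / dx ^ 2) * gridNorm Ω dx ψ (diff2 (thetaLevel θ W n)) := by
  have hμ : 0 ≤ dt / dx ^ 2 := div_nonneg h.dt_pos.le (sq_nonneg _)
  rw [← Real.enorm_of_nonneg hμ, ← gridNorm_const_mul]
  refine gridNorm_mono_abs fun j => ?_
  rw [h.sol.step_eq h.dt_pos, abs_mul, abs_mul, abs_mul, abs_of_nonneg hμ]
  obtain ⟨b0, b1⟩ := h.coeff (thetaLevel θ W n j)
  rw [abs_of_nonneg b0]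
  exact mul_le_mul_of_nonneg_left (mul_le_of_le_one_left (abs_nonneg _) b1) hμ

/-- Lipschitz continuity in time with values in `L¹(Ω)`. -/
lemma gridNorm_sub_le (h : StableScheme Ω B w₀ θ dx dt W) (n m : ℕ) :
    gridNorm Ω dx (fun _ => 1) (fun j => W (n + m) j - W n j) ≤
      ENNReal.ofReal (m * (dt / dx ^ 2)) * gridNorm Ω dx (fun _ => 1) (diff2 (W 0)) := by
  have hμ : 0 ≤ dt / dx ^ 2 := div_nonneg h.dt_pos.le (sq_nonneg _)
  induction m with
  | zero => simp [gridNorm, stepFun]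
  | succ m ih =>
    have e : (fun j => W (n + (m + 1)) j - W n j) =
        fun j => (W (n + m + 1) j - W (n + m) j) + (W (n + m) j - W n j) := by
      ext j; rw [add_assoc]; ring
    rw [e]
    refine (gridNorm_add_le measurable_const _ _).trans ((add_le_add
      ((h.gridNorm_sub_succ_le _ _).trans (mul_le_mul_right (h.gridNorm_diff2_le _).2 _))
      ih).trans ?_)
    rw [← add_mul, ← ENNReal.ofReal_add hμ (by positivity)]
    apply le_of_eq
    congr 2
    push_cast
    ring

/-- Growth of the weighted `L¹` norm. -/
lemma gridNorm_weight_le (h : StableScheme Ω B w₀ θ dx dt W)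
    (hfin : gridNorm Ω dx (fun _ => 1) (diff2 (W 0)) ≠ ⊤) {ψ : ℝ → ℝ} {c : ℝ} (pψ : Ω.Per ψ)
    (mψ : Measurable ψ) (hψ : ∀ x, 0 ≤ ψ x ∧ ψ x ≤ 1) (hc0 : 0 ≤ c)
    (hc : ∀ x, ψ (x + dx) - 2 * ψ x + ψ (x - dx) ≤ c) (n : ℕ) :
    gridNorm Ω dx ψ (W n) ≤ gridNorm Ω dx ψ (W 0) + ENNReal.ofReal (n * (dt / dx ^ 2)) *
      (gridNorm Ω dx ψ (diff2 (W 0)) + ENNReal.ofReal (n * (dt / dx ^ 2 * c)) *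
        gridNorm Ω dx (fun _ => 1) (diff2 (W 0))) := by
  have hμ : 0 ≤ dt / dx ^ 2 := div_nonneg h.dt_pos.le (sq_nonneg _)
  set X := fun n : ℕ => gridNorm Ω dx ψ (diff2 (W 0)) + ENNReal.ofReal (n * (dt / dx ^ 2 * c)) *
        gridNorm Ω dx (fun _ => 1) (diff2 (W 0)) with hX
  have hmono : ∀ n m : ℕ, n ≤ m → X n ≤ X m := fun n m hnm => by
    simp only [hX]
    gcongr
  -- The growth bound `X` is frozen at the final level `m`, so that the increments add up linearly
  -- in `n`.
  have main : ∀ m : ℕ, ∀ n ≤ m, gridNorm Ω dx ψ (W n) ≤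
      gridNorm Ω dx ψ (W 0) + ENNReal.ofReal (n * (dt / dx ^ 2)) * X m := fun m n => by
    induction n with
    | zero => simp
    | succ n ih =>
      intro hn
      have e : W (n + 1) = fun j => W n j + (W (n + 1) j - W n j) := by ext j; ring
      rw [e]
      have hX1 : gridNorm Ω dx ψ (diff2 (thetaLevel θ W n)) ≤ X m := by
        refine (h.gridNorm_weight_diff2_le hfin pψ mψ hψ hc0 hc n).trans ?_
        have := hmono (n + 1) m hn
        simp only [hX] at this ⊢
        push_cast at this
        exact this
      refine (gridNorm_add_le mψ _ _).trans ((add_le_add (ih (by omega))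
        ((h.gridNorm_sub_succ_le _ _).trans (mul_le_mul_right hX1 _))).trans ?_)
      rw [add_assoc, ← add_mul, ← ENNReal.ofReal_add (by positivity) hμ]
      apply le_of_eq
      congr 3
      push_cast
      ring
  exact main n n le_rfl

end StableScheme

end ThetaScheme

/-! ### Weak derivatives and Lipschitz representatives -/

namespace ThetaScheme

lemma HasWeakDeriv.sub {f g f' g' : ℝ → ℝ} (hf : HasWeakDeriv f f') (hg : HasWeakDeriv g g') :
    HasWeakDeriv (fun x => f x - g x) (fun x => f' x - g' x) := by
  obtain ⟨f1, f2, f3⟩ := hf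
  obtain ⟨g1, g2, g3⟩ := hg
  refine ⟨f1.sub g1, f2.sub g2, fun φ hφ hc => ?_⟩
  have key : ∀ (u ψ : ℝ → ℝ), LocallyIntegrable u → Continuous ψ → HasCompactSupport ψ →
      Integrable (fun x => u x * ψ x) := fun u ψ hu h1 h2 => by
    simpa [mul_comm] using hu.integrable_smul_left_of_hasCompactSupport h1 h2
  have c1 : Continuous (deriv φ) := hφ.continuous_deriv (by simp)
  have s1 : HasCompactSupport (deriv φ) := hc.deriv
  simp only [sub_mul]
  rw [integral_sub (key _ _ f1 c1 s1) (key _ _ g1 c1 s1),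
    integral_sub (key _ _ f2 hφ.continuous hc) (key _ _ g2 hφ.continuous hc), f3 φ hφ hc,
    g3 φ hφ hc]
  ring

lemma HasWeakDeriv.congr {f f₁ f' f₁' : ℝ → ℝ} (hf : HasWeakDeriv f f') (h : f =ᵐ[volume] f₁)
    (h' : f' =ᵐ[volume] f₁') : HasWeakDeriv f₁ f₁' := by
  obtain ⟨f1, f2, f3⟩ := hf
  refine ⟨f1.congr h, f2.congr h', fun φ hφ hc => ?_⟩
  rw [integral_congr_ae (g := fun x => f x * deriv φ x) (by filter_upwards [h] with x hx; simp [hx]),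
    f3 φ hφ hc, integral_congr_ae (f := fun x => f' x * φ x) (g := fun x => f₁' x * φ x)
    (by filter_upwards [h'] with x hx; simp [hx])]

/-- In one dimension the line derivative in the direction v is v times the derivative, so
integration by parts for Lipschitz functions against compactly supported ones applies with v = 1. -/
lemma hasWeakDeriv_of_lipschitzWith {f : ℝ → ℝ} {K : NNReal} (hf : LipschitzWith K f) :
    HasWeakDeriv f (deriv f) := by
  have e : ∀ (u : ℝ → ℝ) (x v : ℝ), lineDeriv ℝ u x v = v * deriv u x := fun u x v => by
    unfold lineDeriv
    have := deriv_comp_mul_left v (fun t => u (x + t)) 0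
    simp only [mul_zero, smul_eq_mul, deriv_comp_const_add, add_zero] at this
    simpa [mul_comm] using this
  refine ⟨hf.continuous.locallyIntegrable, ?_, fun φ hφ hc => ?_⟩
  · have := hf.locallyIntegrable_lineDeriv (μ := volume) 1
    simpa [e] using this
  · obtain ⟨D, hD⟩ := hφ.lipschitzWith_of_hasCompactSupport hc (by simp)
    have := hf.integral_lineDeriv_mul_eq (μ := volume) hD hc 1
    simp only [e, one_mul, neg_mul, integral_neg] at this
    rw [this, neg_neg]
    simp only [mul_comm]

/-- A locally integrable function with the weak derivative `0` is constant. -/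
lemma exists_ae_eq_const_of_hasWeakDeriv_zero {f : ℝ → ℝ}
    (hf : HasWeakDeriv f (fun _ => 0)) : ∃ c, ∀ᵐ x, f x = c := by
  obtain ⟨f1, -, f3⟩ := hf
  simp only [zero_mul, integral_zero, neg_zero] at f3
  let b : ContDiffBump (0 : ℝ) := ⟨1, 2, one_pos, one_lt_two⟩
  set η : ℝ → ℝ := b.normed volume with hη
  have η1 : ContDiff ℝ ∞ η := b.contDiff_normed
  have η2 : HasCompactSupport η := b.hasCompactSupport_normed
  have η3 : ∫ x, η x = 1 := b.integral_normed
  have key : ∀ (u ψ : ℝ → ℝ), LocallyIntegrable u → Continuous ψ → HasCompactSupport ψ →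
      Integrable (fun x => u x * ψ x) := fun u ψ hu h1 h2 => by
    simpa [mul_comm] using hu.integrable_smul_left_of_hasCompactSupport h1 h2
  refine ⟨∫ x, f x * η x, ?_⟩
  set c := ∫ x, f x * η x with hc
  have : ∀ᵐ x, f x - c = 0 := by
    refine ae_eq_zero_of_integral_contDiff_smul_eq_zero (f1.sub (locallyIntegrable_const c)) ?_
    intro φ hφ hφc
    set m := ∫ x, φ x with hm
    -- Removing the mass of φ by a multiple of the bump η leaves a function of integral zero, hence
    -- the derivative of a compactly supported Φ. Testing `f` with Φ shows that `f` and the constant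
    -- `c` have the same integral against φ.
    set χ : ℝ → ℝ := fun x => φ x - m * η x with hχ
    have χ1 : ContDiff ℝ ∞ χ := hφ.sub (contDiff_const.mul η1)
    have χ2 : HasCompactSupport χ := hφc.sub (η2.mul_left)
    have χi : Integrable χ := χ1.continuous.integrable_of_hasCompactSupport χ2
    have χ3 : ∫ x, χ x = 0 := by
      rw [integral_sub (hφ.continuous.integrable_of_hasCompactSupport hφc)
        ((η1.continuous.integrable_of_hasCompactSupport η2).const_mul m), integral_const_mul, η3]
      simp [hm]
    obtain ⟨R, hR⟩ := χ2.isCompact.isBounded.subset_closedBall 0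
    have χ0 : ∀ x, R < |x| → χ x = 0 := fun x hx => by
      by_contra h
      have := hR (subset_tsupport _ h)
      rw [mem_closedBall_zero_iff, Real.norm_eq_abs] at this
      linarith
    set Φ : ℝ → ℝ := fun x => ∫ t in (-(|R| + 1))..x, χ t with hΦ
    have Φd : ∀ x, HasDerivAt Φ (χ x) x := fun x =>
      intervalIntegral.integral_hasDerivAt_right (χ1.continuous.intervalIntegrable _ _)
        χ1.continuous.stronglyMeasurable.stronglyMeasurableAtFilter χ1.continuous.continuousAt
    have Φ' : deriv Φ = χ := funext fun x => (Φd x).deriv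
    have Φ1 : ContDiff ℝ ∞ Φ := by
      rw [contDiff_infty_iff_deriv]
      exact ⟨fun x => (Φd x).differentiableAt, Φ' ▸ χ1⟩
    have Φ2 : HasCompactSupport Φ := by
      refine HasCompactSupport.intro (isCompact_Icc (a := -(|R| + 1)) (b := |R| + 1))
        fun x hx => ?_
      have hRR := le_abs_self R
      have hR0 := abs_nonneg R
      rcases lt_or_ge x (-(|R| + 1)) with h | h
      · refine intervalIntegral.integral_zero_ae (ae_of_all _ fun t ht => χ0 t ?_)
        rw [uIoc_of_ge h.le] at ht
        rw [abs_of_neg (by linarith [ht.2])]; linarith [ht.2]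
      · have hx' : |R| + 1 < x := by
          by_contra h'
          exact hx ⟨h, not_lt.1 h'⟩
        simp only [hΦ]
        rw [intervalIntegral.integral_of_le h, ← χ3]
        refine setIntegral_eq_integral_of_forall_compl_eq_zero fun t ht => χ0 t ?_
        by_contra! h'
        have := abs_le.1 h'
        exact ht ⟨by linarith, by linarith⟩
    have := f3 Φ Φ1 Φ2
    rw [Φ'] at this
    have e1 : ∫ x, f x * χ x = (∫ x, f x * φ x) - m * c := by
      rw [hc, ← integral_const_mul, ← integral_sub (key _ _ f1 hφ.continuous hφc)
        ((key _ _ f1 η1.continuous η2).const_mul m)]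
      congr 1; ext x; simp only [hχ]; ring
    have e2 : ∫ x, φ x • (f x - c) = (∫ x, f x * φ x) - c * m := by
      rw [hm, ← integral_const_mul, ← integral_sub (key _ _ f1 hφ.continuous hφc)
        ((hφ.continuous.integrable_of_hasCompactSupport hφc).const_mul c)]
      congr 1; ext x; simp only [smul_eq_mul]; ring
    show ∫ x, φ x • (f x - c) = 0
    rw [e2]; linarith
  filter_upwards [this] with x hx
  linarith

/-- A function with a bounded weak derivative has a Lipschitz representative. -/
lemma HasWeakDeriv.exists_lipschitzWith {f g : ℝ → ℝ} (h : HasWeakDeriv f g) {H : NNReal}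
    (hb : ∀ x, |g x| ≤ H) : ∃ F : ℝ → ℝ, f =ᵐ[volume] F ∧ LipschitzWith H F ∧
      ∀ x y, F y - F x = ∫ t in x..y, g t := by
  have hi : ∀ a b, IntervalIntegrable g volume a b := fun a b =>
    (h.2.1.integrableOn_isCompact isCompact_uIcc).intervalIntegrable
  set F : ℝ → ℝ := fun x => ∫ t in (0 : ℝ)..x, g t with hF
  have hsub : ∀ x y, F y - F x = ∫ t in x..y, g t := fun x y =>
    intervalIntegral.integral_interval_sub_left (hi _ _) (hi _ _)
  have hL : LipschitzWith H F := LipschitzWith.of_dist_le_mul fun x y => by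
    rw [Real.dist_eq, Real.dist_eq, hsub]
    have := intervalIntegral.norm_integral_le_of_norm_le_const (a := y) (b := x) (f := g)
      (C := (H : ℝ)) (fun t _ => hb t)
    simpa using this
  -- Lebesgue differentiation identifies the derivative of the primitive, so `f - F` has the weak
  -- derivative zero and is constant.
  have hd : deriv F =ᵐ[volume] g := by
    filter_upwards [LocallyIntegrable.ae_hasDerivAt_integral h.2.1] with x hx
    exact (hx 0).deriv
  have hw : HasWeakDeriv F g := (hasWeakDeriv_of_lipschitzWith hL).congr .rfl hd
  obtain ⟨c, hc⟩ := exists_ae_eq_const_of_hasWeakDeriv_zero (f := fun x => f x - F x)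
    (by simpa using h.sub hw)
  refine ⟨fun x => F x + c, ?_, ?_, fun x y => by rw [← hsub]; ring⟩
  · filter_upwards [hc] with x hx
    linarith
  · exact LipschitzWith.of_dist_le_mul fun x y => by simpa using hL.dist_le_mul x y

end ThetaScheme

/-! ### Functions of bounded variation under translation -/

namespace ThetaScheme

/-- The variation function of `h` on `s`. -/
lemma exists_monotone_variation {h : ℝ → ℝ} {s : Set ℝ} (hs : BoundedVariationOn h s) :
    ∃ P : ℝ → ℝ, Monotone P ∧ (∀ x, 0 ≤ P x ∧ P x ≤ (eVariationOn h s).toReal) ∧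
      ∀ x ∈ s, ∀ y ∈ s, x ≤ y → |h y - h x| ≤ P y - P x := by
  have hfin : ∀ x, eVariationOn h (s ∩ Iic x) ≠ ⊤ := fun x =>
    ne_top_of_le_ne_top hs (eVariationOn.mono h inter_subset_left)
  refine ⟨fun x => (eVariationOn h (s ∩ Iic x)).toReal, fun x y hxy => ?_, fun x => ⟨?_, ?_⟩,
    fun x hx y hy hxy => ?_⟩
  · exact ENNReal.toReal_mono (hfin y)
      (eVariationOn.mono h (inter_subset_inter_right _ (Iic_subset_Iic.2 hxy)))
  · exact ENNReal.toReal_nonneg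
  · exact ENNReal.toReal_mono hs (eVariationOn.mono h inter_subset_left)
  · have h1 : eVariationOn h (s ∩ Iic x) + eVariationOn h {x, y} ≤ eVariationOn h (s ∩ Iic y) := by
      refine (eVariationOn.add_le_union h ?_).trans (eVariationOn.mono h ?_)
      · rintro a ⟨-, ha⟩ b (rfl | rfl)
        · exact ha
        · exact le_trans ha hxy
      · rintro a (⟨ha, ha'⟩ | (rfl | rfl))
        · exact ⟨ha, le_trans ha' hxy⟩
        · exact ⟨hx, hxy⟩
        · exact ⟨hy, self_mem_Iic⟩
    rw [eVariationOn.pair] at h1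
    have h2 := ENNReal.toReal_mono (hfin y) h1
    rw [ENNReal.toReal_add (hfin x) (edist_ne_top _ _), ← dist_edist, Real.dist_eq,
      abs_sub_comm] at h2
    linarith

/-- The integral over (-n,n] telescopes to the integral of P over (n,n+s] minus that over (-n,-n+s],
which is at most s(b-a); monotone convergence in n then covers the line. -/
lemma lintegral_monotone_shift_le {P : ℝ → ℝ} (hP : Monotone P) {a b s : ℝ}
    (hab : ∀ x, a ≤ P x ∧ P x ≤ b) (hs : 0 ≤ s) :
    ∫⁻ x, ENNReal.ofReal (P (x + s) - P x) ≤ ENNReal.ofReal (s * (b - a)) := by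
  have hi : ∀ u v, IntervalIntegrable P volume u v := fun u v => hP.intervalIntegrable
  have hP' : Monotone fun x => P (x + s) := fun x y hxy => hP (by linarith)
  have hU : (⋃ n : ℕ, Ioc (-(n : ℝ)) n) = univ := by
    refine eq_univ_of_forall fun x => mem_iUnion.2 ?_
    obtain ⟨n, hn⟩ := exists_nat_gt |x|
    have := abs_lt.1 hn
    exact ⟨n, this.1, this.2.le⟩
  rw [← setLIntegral_univ, ← hU, setLIntegral_iUnion_of_directed]
  swap
  · exact directed_of_isDirected_le fun m n hmn => Ioc_subset_Ioc
      (neg_le_neg (by exact_mod_cast hmn)) (by exact_mod_cast hmn)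
  refine iSup_le fun n => ?_
  have hn : -(n : ℝ) ≤ n := by linarith [(Nat.cast_nonneg n : (0 : ℝ) ≤ n)]
  have hint : IntervalIntegrable (fun x => P (x + s) - P x) volume (-(n : ℝ)) n :=
    hP'.intervalIntegrable.sub (hi _ _)
  rw [← ofReal_integral_eq_lintegral_ofReal ((intervalIntegrable_iff_integrableOn_Ioc_of_le hn).1
    hint) (ae_of_all _ fun x => sub_nonneg.2 (hP (by linarith)))]
  refine ENNReal.ofReal_le_ofReal ?_
  rw [← intervalIntegral.integral_of_le hn,
    intervalIntegral.integral_sub hP'.intervalIntegrable (hi _ _),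
    intervalIntegral.integral_comp_add_right,
    intervalIntegral.integral_interval_sub_interval_comm (hi _ _) (hi _ _) (hi _ _)]
  have e1 : ∫ x in (n : ℝ)..(n + s), P x ≤ s * b := by
    have := intervalIntegral.integral_mono_on (f := P) (g := fun _ => b) (a := (n : ℝ)) (b := n + s)
      (by linarith) (hi _ _) (by simp) (fun x _ => (hab x).2)
    simpa using this
  have e2 : s * a ≤ ∫ x in (-(n : ℝ))..(-n + s), P x := by
    have := intervalIntegral.integral_mono_on (f := fun _ => a) (g := P) (a := -(n : ℝ))
      (b := -n + s) (by linarith) (by simp) (hi _ _) (fun x _ => (hab x).1)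
    simpa using this
  have e3 := intervalIntegral.integral_symm (f := P) (μ := volume) (n : ℝ) (n + s)
  have e4 := intervalIntegral.integral_symm (f := P) (μ := volume) (-(n : ℝ)) (-n + s)
  linarith

/-- The increments of `h` are dominated by those of its variation function, which is monotone with
values between 0 and the total variation. -/
lemma setLIntegral_shift_sub_le {h : ℝ → ℝ} {S T : Set ℝ} (hS : BoundedVariationOn h S)
    (hT : MeasurableSet T) {s : ℝ} (hs : 0 ≤ s) (hTS : ∀ x ∈ T, x ∈ S ∧ x + s ∈ S) :
    ∫⁻ x in T, ‖h (x + s) - h x‖ₑ ≤ ENNReal.ofReal (s * (eVariationOn h S).toReal) := by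
  obtain ⟨P, hP, hP1, hP2⟩ := exists_monotone_variation hS
  calc _ ≤ ∫⁻ x in T, ENNReal.ofReal (P (x + s) - P x) := by
        refine setLIntegral_mono' hT fun x hx => ?_
        rw [Real.enorm_eq_ofReal_abs]
        exact ENNReal.ofReal_le_ofReal (hP2 _ (hTS x hx).1 _ (hTS x hx).2 (by linarith))
    _ ≤ ∫⁻ x, ENNReal.ofReal (P (x + s) - P x) := setLIntegral_le_lintegral _ _
    _ ≤ _ := by simpa using lintegral_monotone_shift_le hP hP1 hs

/-- Points of one period shifted by at most 1 stay in [0,2], so shift estimates on the circle need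
the variation over two periods. -/
lemma boundedVariationOn_Icc_zero_two {h : ℝ → ℝ} (hp : Function.Periodic h 1)
    (hb : BoundedVariationOn h (Icc 0 1)) : BoundedVariationOn h (Icc 0 2) := by
  have h1 : eVariationOn h (Icc 1 2) ≤ eVariationOn h (Icc 0 1) := by
    have e : h = h ∘ fun x => x - 1 := funext fun x => (hp.sub_eq x).symm
    conv_lhs => rw [e]
    refine eVariationOn.comp_le_of_monotoneOn h _ (fun x _ y _ hxy => by simpa using hxy) ?_
    intro x hx
    exact ⟨by linarith [hx.1], by linarith [hx.2]⟩
  have h2 := eVariationOn.Icc_add_Icc h (s := univ) (zero_le_one' ℝ) (one_le_two) (mem_univ 1)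
  simp only [univ_inter] at h2
  unfold BoundedVariationOn
  rw [← h2]
  exact ENNReal.add_ne_top.2 ⟨hb, ne_top_of_le_ne_top hb h1⟩

/-- What is used of a `BV` function on `Ω`. -/
lemma Domain.BoundedVariation.shift_estimate {Ω : Domain} {h : ℝ → ℝ}
    (hh : Ω.BoundedVariation h) :
    Ω.Per h ∧ Measurable h ∧ (∃ H : NNReal, ∀ x, |h x| ≤ H) ∧
    (∃ V : NNReal, ∀ s, 0 ≤ s → s ≤ 1 →
      ∫⁻ x, ‖h (x + s) - h x‖ₑ ∂Ω.measure ≤ ENNReal.ofReal (s * V)) ∧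
    ∀ ε : ℝ, 0 < ε → ∃ r : ℝ, ∀ s, 0 ≤ s → s ≤ 1 →
      ∫⁻ x in {x | r < |x|}, ‖h (x + s) - h x‖ₑ ∂Ω.measure ≤ ENNReal.ofReal (s * ε) := by
  cases Ω with
  | line =>
    have hb : BoundedVariationOn h univ := hh
    refine ⟨fun h => by simp at h, ?_, ⟨‖h 0‖₊ + (eVariationOn h univ).toNNReal, fun x => ?_⟩,
      ⟨(eVariationOn h univ).toNNReal, fun s hs _ => ?_⟩, fun ε hε => ?_⟩
    · obtain ⟨p, q, hp, hq, e⟩ := hb.locallyBoundedVariationOn.exists_monotoneOn_sub_monotoneOn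
      rw [e]
      exact (monotoneOn_univ.1 hp).measurable.sub (monotoneOn_univ.1 hq).measurable
    · have := hb.dist_le (mem_univ x) (mem_univ 0)
      rw [Real.dist_eq] at this
      have h2 := abs_add_le (h x - h 0) (h 0)
      rw [sub_add_cancel] at h2
      simp only [NNReal.coe_add, coe_nnnorm, Real.norm_eq_abs, ENNReal.coe_toNNReal_eq_toReal]
      linarith
    · have := setLIntegral_shift_sub_le hb MeasurableSet.univ hs (fun x _ => ⟨trivial, trivial⟩)
      simpa [Domain.measure_line, ENNReal.coe_toNNReal_eq_toReal] using this
    · simp only [Domain.measure_line]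
      have hε2 : (0 : ℝ≥0∞) < ENNReal.ofReal (ε / 2) := ENNReal.ofReal_pos.2 (by linarith)
      -- The variation over a half-line vanishes as the half-line recedes; `r₁` and `r₂` are chosen
      -- to leave at most ε/2 on either side.
      have t1 := hb.tendsto_eVariationOn_Ici_zero
      have t2 := hb.tendsto_eVariationOn_Iic_zero
      simp only [principal_univ, top_inf_eq, univ_inter] at t1 t2
      obtain ⟨r₁, hr₁⟩ := (t1.eventually (gt_mem_nhds hε2)).exists
      obtain ⟨r₂, hr₂⟩ := (t2.eventually (gt_mem_nhds hε2)).exists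
      have b₁ : BoundedVariationOn h (Ici r₁) := hb.mono (subset_univ _)
      have b₂ : BoundedVariationOn h (Iic r₂) := hb.mono (subset_univ _)
      have v₁ : (eVariationOn h (Ici r₁)).toReal ≤ ε / 2 :=
        ENNReal.toReal_le_of_le_ofReal (by linarith) hr₁.le
      have v₂ : (eVariationOn h (Iic r₂)).toReal ≤ ε / 2 :=
        ENNReal.toReal_le_of_le_ofReal (by linarith) hr₂.le
      -- The extra 1 absorbs the shift: x ≤ r₂ - 1 and s ≤ 1 keep x + s to the left of r₂. On the
      -- right the shift only moves further out.
      refine ⟨|r₁| + |r₂| + 1, fun s hs hs1 => ?_⟩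
      have hsub : {x : ℝ | |r₁| + |r₂| + 1 < |x|} ⊆ Ici r₁ ∪ Iic (r₂ - 1) := by
        intro x hx
        have hx : |r₁| + |r₂| + 1 < |x| := hx
        have := le_abs_self r₁
        have := neg_abs_le r₂
        have := abs_nonneg r₁
        have := abs_nonneg r₂
        rcases le_total 0 x with h0 | h0
        · rw [abs_of_nonneg h0] at hx
          exact Or.inl (show r₁ ≤ x by linarith)
        · rw [abs_of_nonpos h0] at hx
          exact Or.inr (show x ≤ r₂ - 1 by linarith)
      calc _ ≤ ∫⁻ x in Ici r₁ ∪ Iic (r₂ - 1), ‖h (x + s) - h x‖ₑ := lintegral_mono_set hsub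
        _ ≤ (∫⁻ x in Ici r₁, ‖h (x + s) - h x‖ₑ) + ∫⁻ x in Iic (r₂ - 1), ‖h (x + s) - h x‖ₑ :=
          lintegral_union_le _ _ _
        _ ≤ ENNReal.ofReal (s * (ε / 2)) + ENNReal.ofReal (s * (ε / 2)) := by
          refine add_le_add ((setLIntegral_shift_sub_le b₁ measurableSet_Ici hs fun x hx =>
            ⟨hx, ?_⟩).trans
            (ENNReal.ofReal_le_ofReal (mul_le_mul_of_nonneg_left v₁ hs))) ((setLIntegral_shift_sub_le b₂ measurableSet_Iic hs
            fun x hx => ⟨?_, ?_⟩).trans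
            (ENNReal.ofReal_le_ofReal (mul_le_mul_of_nonneg_left v₂ hs)))
          · have : r₁ ≤ x := hx
            exact show r₁ ≤ x + s by linarith
          · have : x ≤ r₂ - 1 := hx
            exact show x ≤ r₂ by linarith
          · have : x ≤ r₂ - 1 := hx
            exact show x + s ≤ r₂ by linarith
        _ = _ := by
          rw [← ENNReal.ofReal_add (by positivity) (by positivity)]
          congr 1; ring
  | circle =>
    obtain ⟨hp, hb⟩ : Function.Periodic h 1 ∧ BoundedVariationOn h (Icc 0 1) := hh
    have hb2 := boundedVariationOn_Icc_zero_two hp hb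
    refine ⟨fun _ => hp, ?_, ⟨‖h 0‖₊ + (eVariationOn h (Icc 0 1)).toNNReal, fun x => ?_⟩,
      ⟨(eVariationOn h (Icc 0 2)).toNNReal, fun s hs hs1 => ?_⟩, fun ε hε => ⟨1, fun s _ _ => ?_⟩⟩
    · obtain ⟨p, q, hp', hq', e⟩ := hb.locallyBoundedVariationOn.exists_monotoneOn_sub_monotoneOn
      -- The monotone parts live on [0,1] only. Extended monotonically to ℝ and composed with
      -- `Int.fract`, they make the measurability of `h` visible.
      obtain ⟨p₁, hp₁, ep⟩ := hp'.exists_monotone_extension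
        (hp'.map_bddBelow Subset.rfl ⟨0, ⟨fun x hx => hx.1, by simp⟩⟩)
        (hp'.map_bddAbove Subset.rfl ⟨1, ⟨fun x hx => hx.2, by simp⟩⟩)
      obtain ⟨q₁, hq₁, eq⟩ := hq'.exists_monotone_extension
        (hq'.map_bddBelow Subset.rfl ⟨0, ⟨fun x hx => hx.1, by simp⟩⟩)
        (hq'.map_bddAbove Subset.rfl ⟨1, ⟨fun x hx => hx.2, by simp⟩⟩)
      have e2 : h = fun x => p₁ (Int.fract x) - q₁ (Int.fract x) := by
        ext x
        have hx : Int.fract x ∈ Icc (0 : ℝ) 1 := ⟨Int.fract_nonneg x, (Int.fract_lt_one x).le⟩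
        rw [← ep hx, ← eq hx]
        have := hp.sub_int_mul_eq (x := x) ⌊x⌋
        rw [mul_one] at this
        rw [← this]
        simp only [e]
        rfl
      rw [e2]
      exact (hp₁.measurable.comp measurable_fract).sub (hq₁.measurable.comp measurable_fract)
    · have hx : Int.fract x ∈ Icc (0 : ℝ) 1 := ⟨Int.fract_nonneg x, (Int.fract_lt_one x).le⟩
      have e : h x = h (Int.fract x) := by
        have := hp.sub_int_mul_eq (x := x) ⌊x⌋
        rw [mul_one] at this
        exact this.symm
      have := hb.dist_le hx (left_mem_Icc.2 zero_le_one)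
      rw [Real.dist_eq] at this
      have h2 := abs_add_le (h x - h 0) (h 0)
      rw [sub_add_cancel, e] at h2
      simp only [NNReal.coe_add, coe_nnnorm, Real.norm_eq_abs, ENNReal.coe_toNNReal_eq_toReal, e]
      linarith
    · have := setLIntegral_shift_sub_le hb2 measurableSet_Ico (T := Ico 0 1) hs
        (fun x hx => ⟨⟨hx.1, by linarith [hx.2]⟩, by linarith [hx.1], by linarith [hx.2]⟩)
      simpa [Domain.measure, Domain.cell, ENNReal.coe_toNNReal_eq_toReal] using this
    · have : Domain.circle.measure {x | 1 < |x|} = 0 := by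
        rw [Domain.measure, Measure.restrict_apply (measurableSet_lt measurable_const (by fun_prop))]
        convert measure_empty (μ := volume)
        ext x
        simp only [Domain.cell, mem_inter_iff, mem_ofPred_eq, mem_Ico, mem_empty_iff_false, iff_false]
        rintro ⟨h1, h2, h3⟩
        rw [abs_of_nonneg h2] at h1
        linarith
      rw [Measure.restrict_eq_zero.2 this]
      simp

end ThetaScheme

/-! ### The Lipschitz representative of the datum, and averaging inequalities -/

namespace ThetaScheme

lemma Domain.restrict_Ioc_le (Ω : Domain) : volume.restrict (Ioc (0 : ℝ) 1) ≤ Ω.measure := by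
  cases Ω with
  | line => rw [Domain.measure_line]; exact Measure.restrict_le_self
  | circle => rw [Domain.measure_circle]

/-- A Lipschitz function on `Ω` is bounded in terms of its `L¹(Ω)` norm. -/
lemma enorm_le_of_lipschitzWith {Ω : Domain} {f : ℝ → ℝ} {K : NNReal} (hf : LipschitzWith K f)
    (pf : Ω.Per f) {η : ℝ} (hη : 0 < η) (hη1 : η ≤ 1) (x : ℝ) :
    ENNReal.ofReal η * ‖f x‖ₑ ≤ ∫⁻ y, ‖f y‖ₑ ∂Ω.measure + ENNReal.ofReal (η * (K * η)) := by
  -- A window of length η ≤ 1 starting at x fits, after translation, into one copy of Ω; on it `f`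
  -- differs from `f x` by at most Kη.
  have h1 : ∫⁻ s in Ioc 0 η, ‖f (s + x)‖ₑ ≤ ∫⁻ y, ‖f y‖ₑ ∂Ω.measure := by
    rw [← Domain.lintegral_shift (pf.comp (fun y => ‖y‖ₑ)) x]
    exact (lintegral_mono_set (Ioc_subset_Ioc_right hη1)).trans
      (lintegral_mono' Ω.restrict_Ioc_le le_rfl)
  have h2 : ∫⁻ _ in Ioc 0 η, ‖f x‖ₑ ≤
      ∫⁻ s in Ioc 0 η, (‖f (s + x)‖ₑ + ENNReal.ofReal (K * η)) := by
    refine setLIntegral_mono' measurableSet_Ioc fun s hs => ?_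
    have e := hf.dist_le_mul x (s + x)
    have e2 := abs_add_le (f x - f (s + x)) (f (s + x))
    rw [sub_add_cancel] at e2
    rw [Real.dist_eq, Real.dist_eq, abs_sub_comm x, add_sub_cancel_right, abs_of_pos hs.1] at e
    have e3 := mul_le_mul_of_nonneg_left hs.2 K.coe_nonneg
    rw [Real.enorm_eq_ofReal_abs, Real.enorm_eq_ofReal_abs, ← ENNReal.ofReal_add (abs_nonneg _)
      (mul_nonneg K.coe_nonneg hη.le)]
    refine ENNReal.ofReal_le_ofReal ?_
    linarith
  rw [lintegral_add_right _ measurable_const] at h2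
  simp only [lintegral_const, Measure.restrict_apply_univ, Real.volume_Ioc, sub_zero] at h2
  rw [mul_comm, mul_comm η, ENNReal.ofReal_mul (mul_nonneg K.coe_nonneg hη.le)]
  exact h2.trans (by gcongr)

/-- A Lipschitz representative `F` of the initial datum, with derivative `h`. -/
structure InitialRep (Ω : Domain) (w₀ F h : ℝ → ℝ) (H V : NNReal) : Prop where
  ae_eq : w₀ =ᵐ[volume] F
  lip : LipschitzWith H F
  ftc : ∀ x y, F y - F x = ∫ t in x..y, h t
  perF : Ω.Per F
  perh : Ω.Per h
  meas : Measurable h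
  bound : ∀ x, |h x| ≤ H
  shift : ∀ s, 0 ≤ s → s ≤ 1 → ∫⁻ x, ‖h (x + s) - h x‖ₑ ∂Ω.measure ≤ ENNReal.ofReal (s * V)
  tail : ∀ ε : ℝ, 0 < ε → ∃ r : ℝ, ∀ s, 0 ≤ s → s ≤ 1 →
      ∫⁻ x in {x | r < |x|}, ‖h (x + s) - h x‖ₑ ∂Ω.measure ≤ ENNReal.ofReal (s * ε)
  lintegral_ne_top : ∫⁻ x, ‖F x‖ₑ ∂Ω.measure ≠ ⊤
  lintegral_deriv_ne_top : ∫⁻ x, ‖h x‖ₑ ∂Ω.measure ≠ ⊤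

lemma IsInitialDatum.exists_initialRep {Ω : Domain} {w₀ : ℝ → ℝ} (hw : IsInitialDatum Ω w₀) :
    ∃ F h H V, InitialRep Ω w₀ F h H V := by
  obtain ⟨g, hg, hg1, h, hgh, hh⟩ := hw.deriv_memBV
  obtain ⟨perh, meas, ⟨H, hH⟩, ⟨V, hV⟩, ht⟩ := hh.shift_estimate
  obtain ⟨F, hF, hL, hftc⟩ := (hg.congr .rfl hgh).exists_lipschitzWith hH
  have hac : Ω.measure ≪ volume := Measure.absolutelyContinuous_of_le Ω.measure_le
  refine ⟨F, h, H, V, hF, hL, hftc, fun hΩ => ?_, perh, meas, hH, hV, ht, ?_, ?_⟩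
  · have hp : Function.Periodic w₀ 1 := by
      have := hw.memW11.1
      rw [Domain.isFunctionOn_iff_per] at this
      exact this hΩ
    -- `F` inherits periodicity from `w₀` only almost everywhere; continuity then gives it
    -- everywhere.
    have e : (fun x => F (x + 1)) =ᵐ[volume] F := by
      have := (measurePreserving_add_right volume (1 : ℝ)).quasiMeasurePreserving.ae_eq_comp hF
      filter_upwards [this, hF] with x h1 h2
      simp only [Function.comp_apply] at h1
      rw [← h1, hp, h2]
    have := (Continuous.ae_eq_iff_eq volume (hL.continuous.comp (continuous_add_const 1))
      hL.continuous).1 e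
    exact fun x => congrFun this x
  · have := hw.memW11.2.1
    rw [memLp_one_iff_integrable] at this
    rw [← lintegral_congr_ae (f := fun x => ‖w₀ x‖ₑ) (by
      filter_upwards [hac.ae_le hF] with x hx; rw [hx])]
    exact this.2.ne
  · rw [memLp_one_iff_integrable] at hg1
    rw [← lintegral_congr_ae (f := fun x => ‖g x‖ₑ) (by
      filter_upwards [hac.ae_le hgh] with x hx; rw [hx])]
    exact hg1.2.ne

/-- Comparison of the `L¹` norm of cell averages with the norm of the averaged function. -/
lemma gridNorm_le_of_average {Ω : Domain} {dx : ℝ} (hdx : 0 < dx) {G : ℝ → ℝ≥0∞}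
    (mG : Measurable G) (pG : Ω.Per G) {b : ℤ → ℝ} {ρ : ℝ → ℝ} {ρ' : ℝ → ℝ≥0∞}
    (mρ' : Measurable ρ') (pρ' : Ω.Per ρ')
    (hρ : ∀ x y, |x - y| ≤ 2 * dx → ENNReal.ofReal (ρ x) ≤ ρ' y)
    (hb : ∀ j : ℤ, ‖b j‖ₑ ≤ ENNReal.ofReal (1 / dx) *
      ∫⁻ y in Ioc ((j - 1 / 2) * dx) ((j + 1 / 2) * dx), G y) :
    gridNorm Ω dx ρ b ≤ 4 * ∫⁻ y, ρ' y * G y ∂Ω.measure := by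
  -- For x in [j dx, (j+1) dx) the averaging cell around j dx lies within 2 dx of x. The window of
  -- length 4 dx centred at x, together with the factor 1/dx of the average, produces the constant
  -- 4.
  have h1 : ∀ x, ENNReal.ofReal (ρ x) * ‖stepFun dx b x‖ₑ ≤ ENNReal.ofReal (1 / dx) *
      ∫⁻ s in Icc (-(2 * dx)) (2 * dx), ρ' (x + s) * G (x + s) := fun x => by
    have f1 := mul_le_mul_of_nonneg_right (Int.floor_le (x / dx)) hdx.le
    have f2 := mul_lt_mul_of_pos_right (Int.lt_floor_add_one (x / dx)) hdx
    rw [div_mul_cancel₀ _ hdx.ne'] at f1 f2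
    have sub : Ioc (((⌊x / dx⌋ : ℤ) - 1 / 2 : ℝ) * dx) ((⌊x / dx⌋ + 1 / 2) * dx) ⊆
        Icc (x + -(2 * dx)) (x + 2 * dx) := fun y hy =>
      ⟨by linarith [hy.1], by linarith [hy.2]⟩
    have tr : ∫⁻ s in Icc (-(2 * dx)) (2 * dx), ρ' (x + s) * G (x + s) =
        ∫⁻ y in Icc (x + -(2 * dx)) (x + 2 * dx), ρ' y * G y := by
      have := (measurePreserving_add_left volume x).setLIntegral_comp_preimage_emb
        (MeasurableEquiv.addLeft x).measurableEmbedding (fun y => ρ' y * G y)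
        (Icc (x + -(2 * dx)) (x + 2 * dx))
      rw [← this]
      congr 2
      ext s
      simp
    calc ENNReal.ofReal (ρ x) * ‖stepFun dx b x‖ₑ
        ≤ ENNReal.ofReal (ρ x) * (ENNReal.ofReal (1 / dx) *
          ∫⁻ y in Icc (x + -(2 * dx)) (x + 2 * dx), G y) := by
          gcongr
          exact (hb _).trans (by gcongr)
      _ = ENNReal.ofReal (1 / dx) *
          ∫⁻ y in Icc (x + -(2 * dx)) (x + 2 * dx), ENNReal.ofReal (ρ x) * G y := by
          rw [lintegral_const_mul' _ _ ENNReal.ofReal_ne_top]; ring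
      _ ≤ _ := by
          rw [tr]
          refine mul_le_mul_right (setLIntegral_mono' measurableSet_Icc fun y hy => ?_) _
          gcongr
          refine hρ x y (abs_le.2 ⟨by linarith [hy.2], by linarith [hy.1]⟩)
  calc gridNorm Ω dx ρ b ≤ ∫⁻ x, (ENNReal.ofReal (1 / dx) *
        ∫⁻ s in Icc (-(2 * dx)) (2 * dx), ρ' (x + s) * G (x + s)) ∂Ω.measure := lintegral_mono h1
    _ = ENNReal.ofReal (1 / dx) * ∫⁻ s in Icc (-(2 * dx)) (2 * dx),
        ∫⁻ x, ρ' (x + s) * G (x + s) ∂Ω.measure := by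
        rw [lintegral_const_mul' _ _ ENNReal.ofReal_ne_top, lintegral_lintegral_swap]
        exact ((mρ'.mul mG).comp measurable_add).aemeasurable
    _ = ENNReal.ofReal (1 / dx) * ∫⁻ s in Icc (-(2 * dx)) (2 * dx),
        ∫⁻ x, ρ' x * G x ∂Ω.measure := by
        congr 2; ext1 s
        exact Domain.lintegral_shift (pρ'.comp₂ pG (fun u v => u * v)) s
    _ = 4 * ∫⁻ y, ρ' y * G y ∂Ω.measure := by
        rw [setLIntegral_const, Real.volume_Icc, mul_left_comm, ← ENNReal.ofReal_mul (by positivity),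
          mul_comm]
        congr 1
        rw [show 1 / dx * (2 * dx - -(2 * dx)) = 4 by field_simp; norm_num]
        simp

/-- Tonelli and translation invariance: a sliding integral over a length dx costs a factor dx in L¹.
This turns increments of `F` over dx into dx times norms of `h`, with a weight large enough to
survive the shift. -/
lemma lintegral_le_of_slide {Ω : Domain} {dx : ℝ} {G K ρ' ρ'' : ℝ → ℝ≥0∞}
    (mK : Measurable K) (pK : Ω.Per K) (mρ : Measurable ρ'') (pρ : Ω.Per ρ'')
    (hρ : ∀ x s, 0 ≤ s → s ≤ dx → ρ' x ≤ ρ'' (x + s))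
    (hG : ∀ x, G x ≤ ∫⁻ s in Ioc 0 dx, K (x + s)) :
    ∫⁻ x, ρ' x * G x ∂Ω.measure ≤ ENNReal.ofReal dx * ∫⁻ x, ρ'' x * K x ∂Ω.measure := by
  calc ∫⁻ x, ρ' x * G x ∂Ω.measure
      ≤ ∫⁻ x, ∫⁻ s in Ioc 0 dx, ρ'' (x + s) * K (x + s) ∂volume ∂Ω.measure := by
        refine lintegral_mono fun x => ?_
        refine (mul_le_mul_right (hG x) _).trans ?_
        rw [← lintegral_const_mul _ (show Measurable fun s => K (x + s) from
          mK.comp (measurable_const_add x))]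
        refine setLIntegral_mono' measurableSet_Ioc fun s hs => ?_
        gcongr
        exact hρ x s hs.1.le hs.2
    _ = ∫⁻ s in Ioc 0 dx, ∫⁻ x, ρ'' (x + s) * K (x + s) ∂Ω.measure := by
        rw [lintegral_lintegral_swap]
        exact ((mρ.mul mK).comp measurable_add).aemeasurable
    _ = ∫⁻ s in Ioc 0 dx, ∫⁻ x, ρ'' x * K x ∂Ω.measure := by
        congr 1; ext1 s
        exact Domain.lintegral_shift (pρ.comp₂ pK (fun u v => u * v)) s
    _ = _ := by
        rw [setLIntegral_const, Real.volume_Ioc, sub_zero, mul_comm]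

end ThetaScheme

/-! ### Estimates for the discrete initial data -/

namespace ThetaScheme

lemma measurableSet_lt_abs (r : ℝ) : MeasurableSet {x : ℝ | r < |x|} :=
  measurableSet_lt measurable_const (by fun_prop)

/-- Continuity from above of the finite measure with density `f` along sets with empty intersection.
-/
lemma exists_setLIntegral_lt_abs_le {μ : Measure ℝ} {f : ℝ → ℝ≥0∞}
    (hf : ∫⁻ x, f x ∂μ ≠ ⊤) {ε : ℝ≥0∞} (hε : 0 < ε) :
    ∃ n : ℕ, ∫⁻ x in {x : ℝ | (n : ℝ) < |x|}, f x ∂μ ≤ ε := by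
  have : IsFiniteMeasure (μ.withDensity f) := isFiniteMeasure_withDensity hf
  have anti : Antitone fun n : ℕ => {x : ℝ | (n : ℝ) < |x|} := fun m n hmn x hx =>
    lt_of_le_of_lt (by exact_mod_cast hmn) (show (n : ℝ) < |x| from hx)
  have h := tendsto_measure_iInter_atTop (μ := μ.withDensity f)
    (fun n : ℕ => (measurableSet_lt_abs n).nullMeasurableSet) anti ⟨0, measure_ne_top _ _⟩
  have e : ⋂ n : ℕ, {x : ℝ | (n : ℝ) < |x|} = ∅ := by
    refine eq_empty_of_forall_notMem fun x hx => ?_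
    obtain ⟨n, hn⟩ := exists_nat_gt |x|
    have : (n : ℝ) < |x| := mem_iInter.1 hx n
    linarith
  rw [e, measure_empty] at h
  obtain ⟨n, hn⟩ := (h.eventually (ge_mem_nhds hε)).exists
  refine ⟨n, ?_⟩
  rwa [Function.comp_apply, withDensity_apply _ (measurableSet_lt_abs n)] at hn

namespace InitialRep

variable {Ω : Domain} {w₀ F h : ℝ → ℝ} {H V : NNReal} {dx : ℝ} {a : ℤ → ℝ}

/-- The grid function of the cell averages of `w₀`. -/
def IsCellAverage (dx : ℝ) (w₀ : ℝ → ℝ) (a : ℤ → ℝ) : Prop :=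
  ∀ j : ℤ, a j = 1 / dx * ∫ x in ((j - 1 / 2) * dx)..((j + 1 / 2) * dx), w₀ x

lemma average_eq (R : InitialRep Ω w₀ F h H V) (ha : IsCellAverage dx w₀ a) (j : ℤ) :
    a j = 1 / dx * ∫ x in ((j - 1 / 2) * dx)..((j + 1 / 2) * dx), F x := by
  rw [ha j]
  congr 1
  exact intervalIntegral.integral_congr_ae (R.ae_eq.mono fun x hx _ => hx)

lemma average_succ (R : InitialRep Ω w₀ F h H V) (ha : IsCellAverage dx w₀ a) (j : ℤ) :
    a (j + 1) = 1 / dx * ∫ x in ((j - 1 / 2) * dx)..((j + 1 / 2) * dx), F (x + dx) := by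
  rw [R.average_eq ha, intervalIntegral.integral_comp_add_right]
  push_cast
  ring_nf

lemma average_pred (R : InitialRep Ω w₀ F h H V) (ha : IsCellAverage dx w₀ a) (j : ℤ) :
    a (j - 1) = 1 / dx * ∫ x in ((j - 1 / 2) * dx)..((j + 1 / 2) * dx), F (x - dx) := by
  rw [R.average_eq ha, intervalIntegral.integral_comp_sub_right]
  push_cast
  ring_nf

lemma intervalIntegrable (R : InitialRep Ω w₀ F h H V) (c u v : ℝ) :
    IntervalIntegrable (fun x => F (x + c)) volume u v :=
  (R.lip.continuous.comp (continuous_add_const c)).intervalIntegrable _ _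

lemma intervalIntegrable_deriv (R : InitialRep Ω w₀ F h H V) (c u v : ℝ) :
    IntervalIntegrable (fun x => h (x + c)) volume u v := by
  rw [intervalIntegrable_iff]
  refine Measure.integrableOn_of_bounded (M := H) (by simp)
    (R.meas.comp (measurable_add_const c)).aestronglyMeasurable (ae_of_all _ fun x => R.bound _)

lemma sub_eq (R : InitialRep Ω w₀ F h H V) (x s : ℝ) :
    F (x + s) - F x = ∫ t in (0 : ℝ)..s, h (x + t) := by
  rw [R.ftc, intervalIntegral.integral_comp_add_left, add_zero]

lemma diff1_eq (R : InitialRep Ω w₀ F h H V) (ha : IsCellAverage dx w₀ a) (j : ℤ) :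
    diff1 a j = 1 / dx * ∫ x in ((j - 1 / 2) * dx)..((j + 1 / 2) * dx), (F (x + dx) - F x) := by
  rw [diff1, R.average_succ ha, R.average_eq ha, intervalIntegral.integral_sub
    (R.intervalIntegrable _ _ _) (R.lip.continuous.intervalIntegrable _ _), mul_sub]

lemma diff2_eq (R : InitialRep Ω w₀ F h H V) (ha : IsCellAverage dx w₀ a) (j : ℤ) :
    diff2 a j = 1 / dx * ∫ x in ((j - 1 / 2) * dx)..((j + 1 / 2) * dx),
      (F (x + dx) - 2 * F x + F (x - dx)) := by
  have i1 := R.intervalIntegrable dx ((j - 1 / 2) * dx) ((j + 1 / 2) * dx)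
  have i2 := R.intervalIntegrable (-dx) ((j - 1 / 2) * dx) ((j + 1 / 2) * dx)
  have i3 := (R.lip.continuous.intervalIntegrable (μ := volume) ((j - 1 / 2) * dx)
    ((j + 1 / 2) * dx)).const_mul 2
  simp only [← sub_eq_add_neg] at i2
  rw [diff2, R.average_succ ha, R.average_eq ha, R.average_pred ha,
    intervalIntegral.integral_add (i1.sub i3) i2, intervalIntegral.integral_sub i1 i3,
    intervalIntegral.integral_const_mul]
  ring

lemma enorm_average_le (hdx : 0 < dx) (g : ℝ → ℝ) (j : ℤ) :
    ‖1 / dx * ∫ x in ((j - 1 / 2 : ℝ) * dx)..((j + 1 / 2) * dx), g x‖ₑ ≤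
      ENNReal.ofReal (1 / dx) * ∫⁻ x in Ioc ((j - 1 / 2 : ℝ) * dx) ((j + 1 / 2) * dx), ‖g x‖ₑ := by
  rw [enorm_mul, Real.enorm_of_nonneg (by positivity),
    intervalIntegral.integral_of_le (by nlinarith)]
  gcongr
  exact enorm_integral_le_lintegral_enorm _

lemma abs_average_le (R : InitialRep Ω w₀ F h H V) (hdx : 0 < dx) (ha : IsCellAverage dx w₀ a)
    {M : ℝ} (hM : ∀ x, |F x| ≤ M) (j : ℤ) : |a j| ≤ M := by
  rw [R.average_eq ha, abs_mul, abs_of_nonneg (by positivity : (0 : ℝ) ≤ 1 / dx)]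
  have := intervalIntegral.norm_integral_le_of_norm_le_const (f := F) (C := M)
    (a := (j - 1 / 2) * dx) (b := (j + 1 / 2) * dx) (fun x _ => hM x)
  rw [show ((j : ℝ) + 1 / 2) * dx - (j - 1 / 2) * dx = dx by ring, abs_of_pos hdx] at this
  rw [div_mul_eq_mul_div, one_mul, div_le_iff₀ hdx]
  exact this

lemma abs_average_sub_le (R : InitialRep Ω w₀ F h H V) (hdx : 0 < dx)
    (ha : IsCellAverage dx w₀ a) (x : ℝ) : |stepFun dx a x - F x| ≤ H * (2 * dx) := by
  have f1 := mul_le_mul_of_nonneg_right (Int.floor_le (x / dx)) hdx.le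
  have f2 := mul_lt_mul_of_pos_right (Int.lt_floor_add_one (x / dx)) hdx
  rw [div_mul_cancel₀ _ hdx.ne'] at f1 f2
  set j := ⌊x / dx⌋
  have e : a j - F x =
      1 / dx * ∫ y in ((j - 1 / 2) * dx)..((j + 1 / 2) * dx), (F y - F x) := by
    rw [intervalIntegral.integral_sub (R.lip.continuous.intervalIntegrable _ _) (by simp),
      mul_sub, ← R.average_eq ha, intervalIntegral.integral_const, smul_eq_mul]
    rw [show ((j : ℝ) + 1 / 2) * dx - (j - 1 / 2) * dx = dx by ring]
    field_simp
  change |a j - F x| ≤ _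
  rw [e, abs_mul, abs_of_nonneg (by positivity : (0 : ℝ) ≤ 1 / dx)]
  have := intervalIntegral.norm_integral_le_of_norm_le_const (f := fun y => F y - F x)
    (C := H * (2 * dx)) (a := (j - 1 / 2) * dx) (b := (j + 1 / 2) * dx) (fun y hy => by
      rw [uIoc_of_le (by nlinarith)] at hy
      refine (R.lip.dist_le_mul y x).trans (mul_le_mul_of_nonneg_left ?_ H.coe_nonneg)
      rw [Real.dist_eq, abs_le]
      constructor <;> nlinarith [hy.1, hy.2])
  rw [show ((j : ℝ) + 1 / 2) * dx - (j - 1 / 2) * dx = dx by ring, abs_of_pos hdx] at this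
  rw [div_mul_eq_mul_div, one_mul, div_le_iff₀ hdx]
  exact this

lemma abs_diff1_le (R : InitialRep Ω w₀ F h H V) (hdx : 0 < dx) (ha : IsCellAverage dx w₀ a)
    (j : ℤ) : |diff1 a j| ≤ H * dx := by
  rw [R.diff1_eq ha, abs_mul, abs_of_nonneg (by positivity : (0 : ℝ) ≤ 1 / dx)]
  have := intervalIntegral.norm_integral_le_of_norm_le_const (f := fun x => F (x + dx) - F x)
    (C := H * dx) (a := (j - 1 / 2) * dx) (b := (j + 1 / 2) * dx) (fun x _ => by
      have := R.lip.dist_le_mul (x + dx) x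
      rwa [Real.dist_eq, Real.dist_eq, add_sub_cancel_left, abs_of_pos hdx] at this)
  rw [show ((j : ℝ) + 1 / 2) * dx - (j - 1 / 2) * dx = dx by ring, abs_of_pos hdx] at this
  rw [div_mul_eq_mul_div, one_mul, div_le_iff₀ hdx]
  exact this

lemma gridNorm_average_le (R : InitialRep Ω w₀ F h H V) (hdx : 0 < dx)
    (ha : IsCellAverage dx w₀ a) {ρ : ℝ → ℝ} {ρ' : ℝ → ℝ≥0∞}
    (mρ' : Measurable ρ') (pρ' : Ω.Per ρ')
    (hρ : ∀ x y, |x - y| ≤ 2 * dx → ENNReal.ofReal (ρ x) ≤ ρ' y) :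
    gridNorm Ω dx ρ a ≤ 4 * ∫⁻ y, ρ' y * ‖F y‖ₑ ∂Ω.measure := by
  refine gridNorm_le_of_average hdx (R.lip.continuous.measurable.enorm)
    (R.perF.comp (fun y => ‖y‖ₑ)) mρ' pρ' hρ fun j => ?_
  rw [R.average_eq ha]
  exact enorm_average_le hdx F j

lemma gridNorm_diff1_le (R : InitialRep Ω w₀ F h H V) (hdx : 0 < dx)
    (ha : IsCellAverage dx w₀ a) :
    gridNorm Ω dx (fun _ => 1) (diff1 a) ≤
      4 * (ENNReal.ofReal dx * ∫⁻ y, ‖h y‖ₑ ∂Ω.measure) := by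
  have mF := R.lip.continuous.measurable
  refine (gridNorm_le_of_average hdx (G := fun y => ‖F (y + dx) - F y‖ₑ) (ρ' := fun _ => 1)
    ((mF.comp (measurable_add_const dx)).sub mF).enorm
    ((R.perF.shift dx).comp₂ R.perF (fun u v => ‖u - v‖ₑ)) measurable_const (Domain.per_const 1)
    (fun x y _ => by simp) (fun j => ?_)).trans ?_
  · rw [R.diff1_eq ha]
    exact enorm_average_le hdx _ j
  · gcongr
    have := lintegral_le_of_slide (Ω := Ω) (dx := dx) (G := fun y => ‖F (y + dx) - F y‖ₑ)
      (K := fun y => ‖h y‖ₑ) (ρ' := fun _ => 1) (ρ'' := fun _ => 1) R.meas.enorm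
      (R.perh.comp (fun y => ‖y‖ₑ)) measurable_const (Domain.per_const 1) (fun _ _ _ _ => le_rfl)
      (fun x => by
        rw [R.sub_eq, intervalIntegral.integral_of_le hdx.le]
        exact enorm_integral_le_lintegral_enorm _)
    simpa using this

/-- The second difference of `F` is the integral over a length dx of backward differences of `h`,
which gives one factor dx. The variation of `h` supplies the second one later, so second differences
are O(dx²) in L¹. -/
lemma gridNorm_diff2_le (R : InitialRep Ω w₀ F h H V) (hdx : 0 < dx)
    (ha : IsCellAverage dx w₀ a) {ρ : ℝ → ℝ} {ρ' ρ'' : ℝ → ℝ≥0∞}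
    (mρ' : Measurable ρ') (pρ' : Ω.Per ρ') (mρ'' : Measurable ρ'') (pρ'' : Ω.Per ρ'')
    (hρ : ∀ x y, |x - y| ≤ 2 * dx → ENNReal.ofReal (ρ x) ≤ ρ' y)
    (hρ' : ∀ x s, 0 ≤ s → s ≤ dx → ρ' x ≤ ρ'' (x + s)) :
    gridNorm Ω dx ρ (diff2 a) ≤
      4 * (ENNReal.ofReal dx * ∫⁻ y, ρ'' y * ‖h y - h (y - dx)‖ₑ ∂Ω.measure) := by
  have mF := R.lip.continuous.measurable
  refine (gridNorm_le_of_average hdx (G := fun y => ‖F (y + dx) - 2 * F y + F (y - dx)‖ₑ)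
    (((mF.comp (measurable_add_const dx)).sub (mF.const_mul 2)).add
      (mF.comp (measurable_sub_const dx))).enorm
    (((R.perF.shift dx).comp₂ R.perF (fun u v => u - 2 * v)).comp₂ (R.perF.shift (-dx))
      (fun u v => ‖u + v‖ₑ)) mρ' pρ' hρ (fun j => ?_)).trans ?_
  · rw [R.diff2_eq ha]
    exact enorm_average_le hdx _ j
  · gcongr
    refine lintegral_le_of_slide (Ω := Ω) (dx := dx) (K := fun y => ‖h y - h (y - dx)‖ₑ)
      (R.meas.sub (R.meas.comp (measurable_sub_const dx))).enorm
      (R.perh.comp₂ (R.perh.shift (-dx)) (fun u v => ‖u - v‖ₑ)) mρ'' pρ'' hρ' (fun x => ?_)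
    have e : F (x + dx) - 2 * F x + F (x - dx) =
        ∫ s in (0 : ℝ)..dx, (h (x + s) - h (x + s - dx)) := by
      have i1 := R.intervalIntegrable_deriv x 0 dx
      have i2 := R.intervalIntegrable_deriv (x - dx) 0 dx
      have e1 := R.sub_eq x dx
      have e2 := R.sub_eq (x - dx) dx
      rw [sub_add_cancel] at e2
      simp only [add_comm _ x, add_comm _ (x - dx)] at i1 i2
      simp only [add_sub_right_comm x _ dx]
      rw [intervalIntegral.integral_sub i1 i2, ← e1, ← e2]
      ring
    rw [e, intervalIntegral.integral_of_le hdx.le]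
    exact enorm_integral_le_lintegral_enorm _

lemma lintegral_backward (R : InitialRep Ω w₀ F h H V) (dx : ℝ) :
    ∫⁻ y, ‖h y - h (y - dx)‖ₑ ∂Ω.measure = ∫⁻ y, ‖h (y + dx) - h y‖ₑ ∂Ω.measure := by
  rw [← Domain.lintegral_shift (f := fun y => ‖h y - h (y - dx)‖ₑ) _ dx]
  · simp
  · exact R.perh.comp₂ (R.perh.shift (-dx)) (fun u v => ‖u - v‖ₑ)

lemma gridNorm_one_diff2_le (R : InitialRep Ω w₀ F h H V) (hdx : 0 < dx) (hdx1 : dx ≤ 1)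
    (ha : IsCellAverage dx w₀ a) :
    gridNorm Ω dx (fun _ => 1) (diff2 a) ≤ ENNReal.ofReal (dx ^ 2 * (4 * V)) := by
  refine (R.gridNorm_diff2_le hdx ha (ρ' := fun _ => 1) (ρ'' := fun _ => 1) measurable_const
    (Domain.per_const 1) measurable_const (Domain.per_const 1) (by simp) (by simp)).trans ?_
  simp only [one_mul, R.lintegral_backward]
  refine (mul_le_mul_right (mul_le_mul_right (R.shift dx hdx.le hdx1) _) _).trans (le_of_eq ?_)
  rw [← ENNReal.ofReal_mul hdx.le, ← ENNReal.ofReal_ofNat 4, ← ENNReal.ofReal_mul (by norm_num)]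
  congr 1; ring

/-- Smallness of the initial data for weights that are small on a large interval. -/
lemma exists_tail (R : InitialRep .line w₀ F h H V) {ε : ℝ} (hε : 0 < ε) :
    ∃ r : ℝ, 0 < r ∧ ∀ (dx : ℝ) (a : ℤ → ℝ) (τ : ℝ) (ρ : ℝ → ℝ), 0 < dx → dx ≤ 1 →
      IsCellAverage dx w₀ a → 0 ≤ τ → (∀ x, ρ x ≤ 1) → (∀ x, |x| ≤ r → ρ x ≤ τ) →
      gridNorm .line dx ρ a ≤
        4 * (ENNReal.ofReal τ * ∫⁻ x, ‖F x‖ₑ ∂Domain.line.measure + ENNReal.ofReal ε) ∧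
      gridNorm .line dx ρ (diff2 a) ≤ ENNReal.ofReal (dx ^ 2 * (4 * (τ * V + ε))) := by
  obtain ⟨r₁, hr₁⟩ := R.tail ε hε
  obtain ⟨r₂, hr₂⟩ := exists_setLIntegral_lt_abs_le R.lintegral_ne_top
    (ENNReal.ofReal_pos.2 hε)
  have hr1 := le_abs_self r₁
  have hr0 := abs_nonneg r₁
  have hn0 : (0 : ℝ) ≤ r₂ := Nat.cast_nonneg r₂
  set r := |r₁| + r₂ with hr
  -- The radius shrinks from r+4 to r+2 by averaging (2 dx), to r+1 by the sliding integral (dx),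
  -- and to r by recentring the backward difference (dx); each dx is at most 1.
  refine ⟨r + 4, by linarith, fun dx a τ ρ hdx hdx1 ha hτ hρ1 hρ => ?_⟩
  let χ : ℝ → ℝ → ℝ≥0∞ := fun c => fun x => ENNReal.ofReal τ + {x : ℝ | c < |x|}.indicator 1 x
  have mχ : ∀ c, Measurable (χ c) := fun c =>
    Measurable.add (measurable_const (a := ENNReal.ofReal τ))
      ((measurable_const (a := (1 : ℝ≥0∞))).indicator (measurableSet_lt_abs c))
  have pχ : ∀ c, Domain.line.Per (χ c) := fun c h => by simp at h
  have χmono : ∀ c c' x y : ℝ, c' + |x - y| ≤ c → χ c x ≤ χ c' y := fun c c' x y hc => by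
    refine add_le_add le_rfl ?_
    by_cases hx : c < |x|
    · have hy : c' < |y| := by
        have := abs_add_le (x - y) y
        rw [sub_add_cancel] at this
        linarith
      rw [indicator_of_mem (show x ∈ {x : ℝ | c < |x|} from hx),
        indicator_of_mem (show y ∈ {x : ℝ | c' < |x|} from hy)]
      simp
    · rw [indicator_of_notMem (show x ∉ {x : ℝ | c < |x|} from hx)]
      exact zero_le
  have hρχ : ∀ x, ENNReal.ofReal (ρ x) ≤ χ (r + 4) x := fun x => by
    by_cases hx : r + 4 < |x|
    · refine le_trans ?_ le_add_self
      rw [indicator_of_mem (show x ∈ {x : ℝ | r + 4 < |x|} from hx)]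
      simpa using ENNReal.ofReal_le_ofReal (hρ1 x)
    · exact le_trans (ENNReal.ofReal_le_ofReal (hρ x (not_lt.1 hx))) le_self_add
  have hχ : ∀ (c : ℝ) (g : ℝ → ℝ≥0∞), Measurable g → ∫⁻ x, χ c x * g x ∂Domain.line.measure =
      ENNReal.ofReal τ * ∫⁻ x, g x ∂Domain.line.measure +
        ∫⁻ x in {x : ℝ | c < |x|}, g x ∂Domain.line.measure := fun c g hg => by
    rw [← lintegral_const_mul _ hg, ← lintegral_indicator (measurableSet_lt_abs c),
      ← lintegral_add_left (hg.const_mul _)]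
    refine lintegral_congr fun x => ?_
    simp only [χ, add_mul]
    by_cases hx : x ∈ {x : ℝ | c < |x|}
    · simp only [indicator_of_mem hx, Pi.one_apply, one_mul]
    · simp only [indicator_of_notMem hx, zero_mul]
  have hχ2 : ∀ x y, |x - y| ≤ 2 * dx → ENNReal.ofReal (ρ x) ≤ χ (r + 2) y := fun x y hxy =>
    (hρχ x).trans (χmono _ _ _ _ (by linarith))
  constructor
  · refine (R.gridNorm_average_le hdx ha (mχ (r + 2)) (pχ _) hχ2).trans ?_
    rw [hχ _ _ R.lip.continuous.measurable.enorm]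
    gcongr
    refine le_trans (lintegral_mono_set fun x hx => ?_) hr₂
    have hx : r + 2 < |x| := hx
    exact show (r₂ : ℝ) < |x| by linarith
  · refine (R.gridNorm_diff2_le hdx ha (mχ (r + 2)) (pχ _) (mχ (r + 1)) (pχ _) hχ2
      (fun x s hs hs' => χmono _ _ _ _ ?_)).trans ?_
    · rw [sub_add_cancel_left, abs_neg, abs_of_nonneg hs]; linarith
    rw [hχ _ (fun y => ‖h y - h (y - dx)‖ₑ)
      (R.meas.sub (R.meas.comp (measurable_sub_const dx))).enorm, R.lintegral_backward]
    have t : ∫⁻ x in {x : ℝ | r + 1 < |x|}, ‖h x - h (x - dx)‖ₑ ∂Domain.line.measure ≤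
        ENNReal.ofReal (dx * ε) := by
      refine le_trans ?_ (hr₁ dx hdx.le hdx1)
      rw [← lintegral_indicator (measurableSet_lt_abs _),
        ← lintegral_indicator (measurableSet_lt_abs _),
        ← Domain.lintegral_shift (Ω := .line) (fun h => by simp at h) dx]
      refine lintegral_mono fun x => ?_
      by_cases hx : r + 1 < |x + dx|
      · have hx' : r₁ < |x| := by
          have := abs_add_le x dx
          rw [abs_of_pos hdx] at this
          linarith
        dsimp only
        rw [indicator_of_mem (show x + dx ∈ {x : ℝ | r + 1 < |x|} from hx),
          indicator_of_mem (show x ∈ {x : ℝ | r₁ < |x|} from hx'), add_sub_cancel_right]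
      · dsimp only
        rw [indicator_of_notMem (show x + dx ∉ {x : ℝ | r + 1 < |x|} from hx)]
        exact zero_le
    refine (mul_le_mul_right (mul_le_mul_right (add_le_add
      (mul_le_mul_right (R.shift dx hdx.le hdx1) _) t) _) _).trans (le_of_eq ?_)
    rw [← ENNReal.ofReal_mul hτ, ← ENNReal.ofReal_add (by positivity) (by positivity),
      ← ENNReal.ofReal_mul hdx.le, ← ENNReal.ofReal_ofNat 4, ← ENNReal.ofReal_mul (by norm_num)]
    congr 1; ring

end InitialRep

end ThetaScheme

/-! ### L¹ compactness of approximating families -/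

namespace ThetaScheme

lemma lintegral_enorm_sub_triangle {μ : Measure ℝ} {f g k : ℝ → ℝ} (hf : Measurable f)
    (hg : Measurable g) :
    ∫⁻ x, ‖f x - k x‖ₑ ∂μ ≤ ∫⁻ x, ‖f x - g x‖ₑ ∂μ + ∫⁻ x, ‖g x - k x‖ₑ ∂μ := by
  rw [← lintegral_add_left (show Measurable fun x => ‖f x - g x‖ₑ from (hf.sub hg).enorm)]
  refine lintegral_mono fun x => ?_
  have := enorm_add_le (f x - g x) (g x - k x)
  rwa [sub_add_sub_cancel] at this

lemma lintegral_enorm_sub_comm {μ : Measure ℝ} (f g : ℝ → ℝ) :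
    ∫⁻ x, ‖f x - g x‖ₑ ∂μ = ∫⁻ x, ‖g x - f x‖ₑ ∂μ := by
  simp only [enorm_sub_rev]

/-- Fatou's lemma for the `L¹` norm. -/
lemma lintegral_enorm_le_of_tendsto {μ : Measure ℝ} {g : ℕ → ℝ → ℝ} {k : ℝ → ℝ}
    {c : ℕ → ℝ≥0∞} {c₀ : ℝ≥0∞} (hg : ∀ n, Measurable (g n))
    (hlim : ∀ᵐ x ∂μ, Tendsto (fun n => g n x) atTop (𝓝 (k x)))
    (hc : ∀ᶠ n in atTop, ∫⁻ x, ‖g n x‖ₑ ∂μ ≤ c n) (hc₀ : Tendsto c atTop (𝓝 c₀)) :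
    ∫⁻ x, ‖k x‖ₑ ∂μ ≤ c₀ := by
  calc ∫⁻ x, ‖k x‖ₑ ∂μ = ∫⁻ x, liminf (fun n => ‖g n x‖ₑ) atTop ∂μ := by
        refine lintegral_congr_ae ?_
        filter_upwards [hlim] with x hx
        exact (hx.enorm.liminf_eq).symm
    _ ≤ liminf (fun n => ∫⁻ x, ‖g n x‖ₑ ∂μ) atTop := lintegral_liminf_le fun n => (hg n).enorm
    _ ≤ liminf c atTop := liminf_le_liminf hc
    _ = c₀ := hc₀.liminf_eq

/-- Pointwise convergence, a uniform bound and uniformly small tails give `L¹` convergence. -/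
lemma tendsto_lintegral_of_tail {Ω : Domain} {f : ℕ → ℝ → ℝ} {g : ℝ → ℝ} {M : ℝ}
    (hf : ∀ n, Measurable (f n)) (hM : ∀ n x, |f n x| ≤ M)
    (hlim : ∀ x, Tendsto (fun n => f n x) atTop (𝓝 (g x)))
    (htail : ∀ ε : ℝ, 0 < ε → ∃ R : ℝ, ∀ᶠ n in atTop,
      ∫⁻ x in {x | R < |x|}, ‖f n x‖ₑ ∂Ω.measure ≤ ENNReal.ofReal ε) :
    Tendsto (fun n => ∫⁻ x, ‖f n x - g x‖ₑ ∂Ω.measure) atTop (𝓝 0) := by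
  have hg : Measurable g := measurable_of_tendsto_metrizable hf (tendsto_pi_nhds.2 hlim)
  rw [ENNReal.tendsto_nhds_zero]
  intro ε hε
  by_cases hεt : ε = ⊤
  · simp [hεt]
  set e := ε.toReal / 3 with he
  have he0 : 0 < e := div_pos (ENNReal.toReal_pos hε.ne' hεt) (by norm_num)
  obtain ⟨R, hR⟩ := htail e he0
  have hS := measurableSet_lt_abs R
  set S := {x : ℝ | R < |x|}
  have hgt : ∫⁻ x in S, ‖g x‖ₑ ∂Ω.measure ≤ ENNReal.ofReal e :=
    lintegral_enorm_le_of_tendsto hf (ae_of_all _ hlim) hR tendsto_const_nhds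
  have hfin : IsFiniteMeasure (Ω.measure.restrict Sᶜ) := by
    refine ⟨?_⟩
    rw [Measure.restrict_apply_univ]
    refine lt_of_le_of_lt (Ω.measure_le _) ?_
    have : Sᶜ ⊆ Icc (-R) R := fun x hx => abs_le.1 (not_lt.1 hx)
    exact lt_of_le_of_lt (measure_mono this) (by simp)
  have hin : Tendsto (fun n => ∫⁻ x in Sᶜ, ‖f n x - g x‖ₑ ∂Ω.measure) atTop (𝓝 0) := by
    have hgM : ∀ x, |g x| ≤ M := fun x => le_of_tendsto (hlim x).abs (.of_forall fun n => hM n x)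
    have := tendsto_lintegral_of_dominated_convergence (μ := Ω.measure.restrict Sᶜ)
      (F := fun n x => ‖f n x - g x‖ₑ) (f := fun _ => 0) (fun _ => ENNReal.ofReal (M + M))
      (fun n => ((hf n).sub hg).enorm) (fun n => ae_of_all _ fun x => ?_)
      (by
        rw [lintegral_const]
        exact ENNReal.mul_ne_top ENNReal.ofReal_ne_top (measure_ne_top _ _))
      (ae_of_all _ fun x => ?_)
    · simpa using this
    · dsimp only
      rw [Real.enorm_eq_ofReal_abs]
      exact ENNReal.ofReal_le_ofReal ((abs_sub _ _).trans (add_le_add (hM n x) (hgM x)))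
    · have := ((hlim x).sub_const (g x)).enorm
      simpa using this
  filter_upwards [hR, hin.eventually (ge_mem_nhds (ENNReal.ofReal_pos.2 he0))] with n h1 h2
  rw [← lintegral_add_compl _ hS]
  have h3 : ∫⁻ x in S, ‖f n x - g x‖ₑ ∂Ω.measure ≤ ENNReal.ofReal e + ENNReal.ofReal e := by
    calc _ ≤ ∫⁻ x in S, (‖f n x‖ₑ + ‖g x‖ₑ) ∂Ω.measure :=
          lintegral_mono fun x => enorm_sub_le
      _ = ∫⁻ x in S, ‖f n x‖ₑ ∂Ω.measure + ∫⁻ x in S, ‖g x‖ₑ ∂Ω.measure :=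
          lintegral_add_left (hf n).enorm _
      _ ≤ _ := add_le_add h1 hgt
  calc _ ≤ ENNReal.ofReal e + ENNReal.ofReal e + ENNReal.ofReal e := add_le_add h3 h2
    _ = ε := by
      rw [← ENNReal.ofReal_add he0.le he0.le, ← ENNReal.ofReal_add (by linarith) he0.le,
        he, show ε.toReal / 3 + ε.toReal / 3 + ε.toReal / 3 = ε.toReal by ring,
        ENNReal.ofReal_toReal hεt]

/-- A family of approximate solutions `u k` with approximate derivatives `z k`, and the uniform
estimates that give compactness. -/
structure ApproxFamily (Ω : Domain) (u z : ℕ → ℝ → ℝ → ℝ) (δ : ℕ → ℝ) (M : ℝ) (H V : NNReal)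
    (A : ℝ≥0∞) : Prop where
  δ_nonneg : ∀ k, 0 ≤ δ k
  δ_lim : Tendsto δ atTop (𝓝 0)
  per : ∀ k t, Ω.Per (fun x => u k x t)
  bdd : ∀ k x t, |u k x t| ≤ M
  lip : ∀ k t, LipschitzWith H (fun x => u k x t)
  neg : ∀ k x t, t ≤ 0 → u k x t = u k x 0
  meas : ∀ k t, Measurable (fun x => z k x t)
  quot : ∀ k t s, 0 < s → ∫⁻ x, ‖(u k (x + s) t - u k x t) / s - z k x t‖ₑ ∂Ω.measure ≤
    ENNReal.ofReal (V * (s + δ k))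
  time : ∀ k s t, 0 ≤ s → s ≤ t → ∫⁻ x, ‖u k x t - u k x s‖ₑ ∂Ω.measure ≤
    ENNReal.ofReal (V * (t - s + δ k))
  bound_ne_top : A ≠ ⊤
  lintegral_deriv_le : ∀ k t, ∫⁻ x, ‖z k x t‖ₑ ∂Ω.measure ≤ A
  lintegral_init_le : ∀ k, ∫⁻ x, ‖u k x 0‖ₑ ∂Ω.measure ≤ A
  tail : ∀ T ε : ℝ, 0 < ε → ∃ R : ℝ, ∀ᶠ k in atTop, ∀ t, 0 ≤ t → t ≤ T →
    ∫⁻ x in {x | R < |x|}, ‖u k x t‖ₑ ∂Ω.measure ≤ ENNReal.ofReal ε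

namespace ApproxFamily

variable {Ω : Domain} {u z : ℕ → ℝ → ℝ → ℝ} {δ : ℕ → ℝ} {M : ℝ} {H V : NNReal} {A : ℝ≥0∞}

lemma comp (h : ApproxFamily Ω u z δ M H V A) {σ : ℕ → ℕ} (hσ : StrictMono σ) :
    ApproxFamily Ω (fun k => u (σ k)) (fun k => z (σ k)) (fun k => δ (σ k)) M H V A where
  δ_nonneg k := h.δ_nonneg _
  δ_lim := h.δ_lim.comp hσ.tendsto_atTop
  per k := h.per _
  bdd k := h.bdd _
  lip k := h.lip _
  neg k := h.neg _
  meas k := h.meas _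
  quot k := h.quot _
  time k := h.time _
  bound_ne_top := h.bound_ne_top
  lintegral_deriv_le k := h.lintegral_deriv_le _
  lintegral_init_le k := h.lintegral_init_le _
  tail T ε hε := by
    obtain ⟨R, hR⟩ := h.tail T ε hε
    exact ⟨R, hσ.tendsto_atTop.eventually hR⟩

lemma measurable (h : ApproxFamily Ω u z δ M H V A) (k : ℕ) (t : ℝ) :
    Measurable (fun x => u k x t) := (h.lip k t).continuous.measurable

/-- The cube [-M,M] to the power ℚ × ℚ is compact and, the index set being countable, sequentially
compact; this replaces a diagonal argument. -/
lemma exists_subseq_rat (h : ApproxFamily Ω u z δ M H V A) : ∃ σ : ℕ → ℕ, StrictMono σ ∧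
    ∀ (x t : ℚ), ∃ l, Tendsto (fun k => u (σ k) x t) atTop (𝓝 l) := by
  have hK : IsCompact (Set.pi univ fun _ : ℚ × ℚ => Icc (-M) M) :=
    isCompact_univ_pi fun _ => isCompact_Icc
  obtain ⟨a, -, σ, hσ, hlim⟩ := hK.tendsto_subseq (x := fun k (p : ℚ × ℚ) => u k p.1 p.2)
    (fun k p _ => abs_le.1 (h.bdd k p.1 p.2))
  exact ⟨σ, hσ, fun x t => ⟨a (x, t), (tendsto_pi_nhds.1 hlim) (x, t)⟩⟩

/-- The common Lipschitz constant in x carries the Cauchy property from a nearby rational point to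
x. Dividing by `H + 1` rather than `H` allows `H = 0`. -/
lemma exists_tendsto_of_rat (h : ApproxFamily Ω u z δ M H V A) (t : ℝ)
    (hr : ∀ x : ℚ, ∃ l, Tendsto (fun k => u k x t) atTop (𝓝 l)) (x : ℝ) :
    ∃ l, Tendsto (fun k => u k x t) atTop (𝓝 l) := by
  refine cauchySeq_tendsto_of_complete (Metric.cauchySeq_iff.2 fun ε hε => ?_)
  have hη : 0 < ε / (4 * (H + 1)) := by positivity
  obtain ⟨q, hq1, hq2⟩ := exists_rat_btwn (show x < x + ε / (4 * (H + 1)) by linarith)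
  obtain ⟨l, hl⟩ := hr q
  obtain ⟨N, hN⟩ := Metric.cauchySeq_iff.1 hl.cauchySeq (ε / 2) (by linarith)
  have hx : ∀ k, dist (u k x t) (u k q t) ≤ ε / 4 := fun k => by
    refine ((h.lip k t).dist_le_mul x q).trans ?_
    rw [Real.dist_eq, abs_of_neg (by linarith)]
    have : -(x - q) ≤ ε / (4 * (H + 1)) := by linarith
    calc (H : ℝ) * -(x - q) ≤ (H + 1) * (ε / (4 * (H + 1))) := by
          gcongr
          · linarith
          · linarith
      _ = ε / 4 := by field_simp
  refine ⟨N, fun m hm n hn => ?_⟩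
  have h1 := hN m hm n hn
  have h2 := dist_triangle4_right (u m x t) (u n x t) (u m q t) (u n q t)
  linarith [hx m, hx n]

/-- The subsequence is Cauchy in `L¹(Ω)`, uniformly on bounded time intervals. -/
lemma uniform_cauchy (h : ApproxFamily Ω u z δ M H V A)
    (hr : ∀ x t : ℚ, ∃ l, Tendsto (fun k => u k x t) atTop (𝓝 l)) (T ε : ℝ) (hε : 0 < ε) :
    ∃ N, ∀ k ≥ N, ∀ l ≥ N, ∀ t, 0 ≤ t → t ≤ T →
      ∫⁻ x, ‖u k x t - u l x t‖ₑ ∂Ω.measure ≤ ENNReal.ofReal ε := by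
  have hV : (0 : ℝ) < V + 1 := by positivity
  -- A rational time mesh: only finitely many times iη are needed up to T, each has an L¹ limit, and
  -- moving t back to the last mesh time costs at most V(η + δ k).
  obtain ⟨η, hη1, hη2⟩ := exists_rat_btwn (show 0 < ε / (8 * (V + 1)) by positivity)
  obtain ⟨m, hm⟩ := exists_nat_gt (T / η)
  have hrat : ∀ q : ℚ, 0 ≤ q → ∃ g : ℝ → ℝ, Measurable g ∧
      Tendsto (fun k => ∫⁻ x, ‖u k x q - g x‖ₑ ∂Ω.measure) atTop (𝓝 0) := fun q hq => by
    choose g hg using h.exists_tendsto_of_rat q (fun x => hr x q)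
    refine ⟨g, measurable_of_tendsto_metrizable (fun k => h.measurable k q)
      (tendsto_pi_nhds.2 hg), tendsto_lintegral_of_tail (fun k => h.measurable k q)
      (fun k x => h.bdd k x q) hg fun e he => ?_⟩
    obtain ⟨R, hR⟩ := h.tail q e he
    exact ⟨R, hR.mono fun k hk => hk q (by exact_mod_cast hq) le_rfl⟩
  have hη0 : (0 : ℚ) < η := by exact_mod_cast hη1
  choose g mg hg using fun i : ℕ => hrat (i * η) (by positivity)
  have hev : ∀ᶠ k in atTop, ∀ i ∈ Finset.range (m + 1),
      ∫⁻ x, ‖u k x ((i * η : ℚ) : ℝ) - g i x‖ₑ ∂Ω.measure ≤ ENNReal.ofReal (ε / 8) :=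
    (Finset.eventually_all _).2 fun i _ =>
      (hg i).eventually (ge_mem_nhds (ENNReal.ofReal_pos.2 (by linarith)))
  have hδ : ∀ᶠ k in atTop, δ k ≤ ε / (8 * (V + 1)) :=
    h.δ_lim.eventually (ge_mem_nhds (by positivity))
  obtain ⟨N, hN⟩ := eventually_atTop.1 (hev.and hδ)
  refine ⟨N, fun k hk l hl t ht0 htT => ?_⟩
  set i := ⌊t / η⌋₊ with hi
  have hi1 : (i : ℝ) * η ≤ t := by
    have := Nat.floor_le (div_nonneg ht0 hη1.le)
    rwa [le_div_iff₀ hη1] at this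
  have hi2 : t < (i + 1) * η := by
    have := Nat.lt_floor_add_one (t / η)
    rwa [div_lt_iff₀ hη1] at this
  have him : i ∈ Finset.range (m + 1) := by
    rw [Finset.mem_range, Nat.lt_succ_iff]
    have : (i : ℝ) < m := lt_of_le_of_lt ((le_div_iff₀ hη1).2 (hi1.trans htT)) hm
    exact_mod_cast this.le
  have hcast : ((i * η : ℚ) : ℝ) = (i : ℝ) * η := by push_cast; ring
  have A1 : ∀ k ≥ N, ∫⁻ x, ‖u k x t - g i x‖ₑ ∂Ω.measure ≤ ENNReal.ofReal (ε / 2) :=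
    fun k hk => by
    have hkN := hN k hk
    have h1 := h.time k (i * η) t (by positivity) hi1
    have h2 := hkN.1 i him
    rw [hcast] at h2
    refine (lintegral_enorm_sub_triangle (h.measurable k t) (h.measurable k (i * η))).trans
      ((add_le_add h1 h2).trans ?_)
    rw [← ENNReal.ofReal_add (mul_nonneg V.coe_nonneg (add_nonneg (by linarith) (h.δ_nonneg k)))
      (by linarith)]
    refine ENNReal.ofReal_le_ofReal ?_
    have h3 : t - i * η + δ k ≤ ε / (4 * (V + 1)) := by
      have : ε / (4 * ((V : ℝ) + 1)) = ε / (8 * (V + 1)) + ε / (8 * (V + 1)) := by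
        field_simp; norm_num
      linarith [hkN.2]
    have h4 : (V : ℝ) * (t - i * η + δ k) ≤ (V + 1) * (ε / (4 * (V + 1))) := by
      have := h.δ_nonneg k
      gcongr
      · linarith
    have h5 : ((V : ℝ) + 1) * (ε / (4 * (V + 1))) = ε / 4 := by field_simp
    linarith
  refine (lintegral_enorm_sub_triangle (h.measurable k t) (mg i)).trans ?_
  rw [lintegral_enorm_sub_comm (g i)]
  refine (add_le_add (A1 k hk) (A1 l hl)).trans (le_of_eq ?_)
  rw [← ENNReal.ofReal_add (by linarith) (by linarith)]
  congr 1; ring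

end ApproxFamily

end ThetaScheme

/-! ### The limit function and its derivative -/

namespace ThetaScheme

namespace ApproxFamily

variable {Ω : Domain} {u z : ℕ → ℝ → ℝ → ℝ} {δ : ℕ → ℝ} {M : ℝ} {H V : NNReal} {A : ℝ≥0∞}

lemma lipschitzWith_sub {f g : ℝ → ℝ} {K L : NNReal} (hf : LipschitzWith K f)
    (hg : LipschitzWith L g) : LipschitzWith (K + L) (fun x => f x - g x) := by
  have := hf.add hg.neg
  rwa [show (fun x => f x + (-g) x) = fun x => f x - g x from
    funext fun x => (sub_eq_add_neg _ _).symm] at this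

/-- Being Cauchy in L¹ implies being Cauchy at every point for uniformly Lipschitz functions, so the
limit is an honest function of (x,t). Fatou's lemma in the second index converts the Cauchy estimate
into uniform L¹ convergence; times t ≤ 0 reduce to t = 0. -/
lemma exists_limit_aux (h : ApproxFamily Ω u z δ M H V A)
    (hr : ∀ x t : ℚ, ∃ l, Tendsto (fun k => u k x t) atTop (𝓝 l)) :
    ∃ w : ℝ → ℝ → ℝ, (∀ x t, Tendsto (fun k => u k x t) atTop (𝓝 (w x t))) ∧
      ∀ T ε : ℝ, 0 < ε → ∀ᶠ k in atTop, ∀ t, 0 ≤ t → t ≤ T →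
        ∫⁻ x, ‖u k x t - w x t‖ₑ ∂Ω.measure ≤ ENNReal.ofReal ε := by
  have hcau : ∀ x t, 0 ≤ t → ∃ l, Tendsto (fun k => u k x t) atTop (𝓝 l) := fun x t ht => by
    refine cauchySeq_tendsto_of_complete (Metric.cauchySeq_iff'.2 fun ε hε => ?_)
    -- A 2H-Lipschitz function is bounded by its L¹ norm divided by η plus 2Hη. This η makes the
    -- second term at most ε/4, and the L¹ tolerance η ε/2 makes the first at most ε/2.
    set η := min 1 (ε / (8 * (H + 1))) with hη
    have hη0 : 0 < η := lt_min one_pos (by positivity)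
    obtain ⟨N, hN⟩ := h.uniform_cauchy hr t (η * (ε / 2)) (by positivity)
    refine ⟨N, fun n hn => ?_⟩
    have h1 := enorm_le_of_lipschitzWith (lipschitzWith_sub (h.lip n t) (h.lip N t))
      ((h.per n t).comp₂ (h.per N t) (fun a b => a - b)) hη0 (min_le_left _ _) x
    have h2 := h1.trans (add_le_add (hN n hn N le_rfl t ht le_rfl) le_rfl)
    rw [Real.enorm_eq_ofReal_abs, ← ENNReal.ofReal_mul hη0.le,
      ← ENNReal.ofReal_add (by positivity) (by positivity),
      ENNReal.ofReal_le_ofReal_iff (by positivity), ← mul_add, mul_le_mul_iff_right₀ hη0] at h2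
    have h3 : ((H + H : NNReal) : ℝ) * η ≤ ε / 4 := by
      calc ((H + H : NNReal) : ℝ) * η ≤ (2 * (H + 1)) * (ε / (8 * (H + 1))) := by
            gcongr
            · push_cast; linarith
            · exact min_le_right _ _
        _ = ε / 4 := by field_simp; norm_num
    rw [Real.dist_eq]
    linarith
  have hcau' : ∀ x t, ∃ l, Tendsto (fun k => u k x t) atTop (𝓝 l) := fun x t => by
    rcases le_total 0 t with ht | ht
    · exact hcau x t ht
    · simpa only [h.neg _ x t ht] using hcau x 0 le_rfl
  choose w hw using hcau'
  refine ⟨w, hw, fun T ε hε => ?_⟩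
  obtain ⟨N, hN⟩ := h.uniform_cauchy hr T ε hε
  refine eventually_atTop.2 ⟨N, fun k hk t ht htT => ?_⟩
  refine lintegral_enorm_le_of_tendsto (g := fun l x => u k x t - u l x t)
    (fun l => (h.measurable k t).sub (h.measurable l t))
    (ae_of_all _ fun x => (hw x t).const_sub _) ?_ (tendsto_const_nhds (x := ENNReal.ofReal ε))
  exact eventually_atTop.2 ⟨N, fun l hl => hN k hk l hl t ht htT⟩

/-- `w` is the limit of the approximate solutions: everywhere, and in `L¹(Ω)` uniformly on bounded
time intervals. -/
structure IsLimit (Ω : Domain) (u : ℕ → ℝ → ℝ → ℝ) (w : ℝ → ℝ → ℝ) : Prop where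
  pointwise : ∀ x t, Tendsto (fun k => u k x t) atTop (𝓝 (w x t))
  uniform : ∀ T ε : ℝ, 0 < ε → ∀ᶠ k in atTop, ∀ t, 0 ≤ t → t ≤ T →
    ∫⁻ x, ‖u k x t - w x t‖ₑ ∂Ω.measure ≤ ENNReal.ofReal ε

/-- Compactness of families of approximate solutions. -/
theorem exists_limit (h : ApproxFamily Ω u z δ M H V A) :
    ∃ σ : ℕ → ℕ, StrictMono σ ∧ ∃ w, IsLimit Ω (fun k => u (σ k)) w := by
  obtain ⟨σ, hσ, hr⟩ := h.exists_subseq_rat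
  obtain ⟨w, h1, h2⟩ := (h.comp hσ).exists_limit_aux hr
  exact ⟨σ, hσ, w, h1, h2⟩

variable {w : ℝ → ℝ → ℝ}

lemma limit_lip (h : ApproxFamily Ω u z δ M H V A) (hw : IsLimit Ω u w) (t : ℝ) :
    LipschitzWith H (fun x => w x t) :=
  LipschitzWith.of_dist_le_mul fun x y => le_of_tendsto
    ((hw.pointwise x t).dist (hw.pointwise y t)) (.of_forall fun k => (h.lip k t).dist_le_mul x y)

lemma limit_measurable (h : ApproxFamily Ω u z δ M H V A) (hw : IsLimit Ω u w) (t : ℝ) :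
    Measurable (fun x => w x t) := (h.limit_lip hw t).continuous.measurable

lemma limit_per (h : ApproxFamily Ω u z δ M H V A) (hw : IsLimit Ω u w) (t : ℝ) :
    Ω.Per (fun x => w x t) := fun hΩ x =>
  tendsto_nhds_unique (hw.pointwise (x + 1) t)
    ((hw.pointwise x t).congr fun k => (h.per k t hΩ x).symm)

lemma limit_bdd (h : ApproxFamily Ω u z δ M H V A) (hw : IsLimit Ω u w) (x t : ℝ) :
    |w x t| ≤ M := le_of_tendsto (hw.pointwise x t).abs (.of_forall fun k => h.bdd k x t)

lemma limit_neg (h : ApproxFamily Ω u z δ M H V A) (hw : IsLimit Ω u w) (x : ℝ) {t : ℝ}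
    (ht : t ≤ 0) : w x t = w x 0 :=
  tendsto_nhds_unique (hw.pointwise x t)
    ((hw.pointwise x 0).congr fun k => (h.neg k x t ht).symm)

lemma tendsto_ofReal_δ (h : ApproxFamily Ω u z δ M H V A) (a b : ℝ) :
    Tendsto (fun k => ENNReal.ofReal (a + b * δ k)) atTop (𝓝 (ENNReal.ofReal a)) := by
  refine (ENNReal.continuous_ofReal.tendsto _).comp ?_
  simpa using (h.δ_lim.const_mul b).const_add a

lemma limit_time (h : ApproxFamily Ω u z δ M H V A) (hw : IsLimit Ω u w) {s t : ℝ} (hs : 0 ≤ s)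
    (hst : s ≤ t) : ∫⁻ x, ‖w x t - w x s‖ₑ ∂Ω.measure ≤ ENNReal.ofReal (V * (t - s)) := by
  refine lintegral_enorm_le_of_tendsto (g := fun k x => u k x t - u k x s)
    (fun l => (h.measurable l t).sub (h.measurable l s))
    (ae_of_all _ fun x => (hw.pointwise x t).sub (hw.pointwise x s)) (.of_forall fun k => ?_)
    (h.tendsto_ofReal_δ _ V)
  rw [← mul_add]
  exact h.time k s t hs hst

lemma limit_time_abs (h : ApproxFamily Ω u z δ M H V A) (hw : IsLimit Ω u w) (s t : ℝ) :
    ∫⁻ x, ‖w x t - w x s‖ₑ ∂Ω.measure ≤ ENNReal.ofReal (V * |t - s|) := by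
  have key : ∀ s t, s ≤ t →
      ∫⁻ x, ‖w x t - w x s‖ₑ ∂Ω.measure ≤ ENNReal.ofReal (V * (t - s)) := fun s t hst => by
    rcases le_total 0 s with h0 | h0
    · exact h.limit_time hw h0 hst
    · simp only [h.limit_neg hw _ h0]
      rcases le_total 0 t with h1 | h1
      · refine (h.limit_time hw le_rfl h1).trans (ENNReal.ofReal_le_ofReal ?_)
        exact mul_le_mul_of_nonneg_left (by linarith) V.coe_nonneg
      · simp [h.limit_neg hw _ h1]
  rcases le_total s t with hst | hst
  · rw [abs_of_nonneg (sub_nonneg.2 hst)]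
    exact key s t hst
  · rw [abs_sub_comm, abs_of_nonneg (sub_nonneg.2 hst), lintegral_enorm_sub_comm]
    exact key t s hst

lemma limit_lintegral_le (h : ApproxFamily Ω u z δ M H V A) (hw : IsLimit Ω u w) {t : ℝ}
    (ht : 0 ≤ t) : ∫⁻ x, ‖w x t‖ₑ ∂Ω.measure ≤ ENNReal.ofReal (V * t) + A := by
  have h0 : ∫⁻ x, ‖w x 0‖ₑ ∂Ω.measure ≤ A :=
    lintegral_enorm_le_of_tendsto (g := fun k x => u k x 0) (fun k => h.measurable k 0)
      (ae_of_all _ fun x => hw.pointwise x 0) (.of_forall fun k => h.lintegral_init_le k)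
      tendsto_const_nhds
  have h1 := lintegral_enorm_sub_triangle (μ := Ω.measure) (h.limit_measurable hw t)
    (h.limit_measurable hw 0) (k := fun _ => 0)
  simp only [sub_zero] at h1
  have h2 := h.limit_time hw le_rfl ht
  rw [sub_zero] at h2
  exact h1.trans (add_le_add h2 h0)

/-- The limit is jointly continuous. -/
lemma limit_continuous (h : ApproxFamily Ω u z δ M H V A) (hw : IsLimit Ω u w) :
    Continuous (fun p : ℝ × ℝ => w p.2 p.1) := by
  rw [Metric.continuous_iff]
  rintro ⟨t, x⟩ ε hε
  set η := min 1 (ε / (8 * (H + 1))) with hη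
  have hη0 : 0 < η := lt_min one_pos (by positivity)
  -- The first entry serves the Lipschitz bound in x. The second makes the L¹ distance between the
  -- two times at most η ε/4, so that it survives the division by η.
  set κ := min (ε / (8 * (H + 1))) (η * (ε / 4) / (V + 1)) with hκ
  have hκ0 : 0 < κ := lt_min (by positivity) (by positivity)
  refine ⟨κ, hκ0, ?_⟩
  rintro ⟨s, y⟩ hsy
  rw [Prod.dist_eq, max_lt_iff, Real.dist_eq, Real.dist_eq] at hsy
  obtain ⟨hs, hy⟩ := hsy
  dsimp only at hs hy ⊢
  have h1 := enorm_le_of_lipschitzWith (lipschitzWith_sub (h.limit_lip hw s) (h.limit_lip hw t))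
      ((h.limit_per hw s).comp₂ (h.limit_per hw t) (fun a b => a - b)) hη0 (min_le_left _ _) y
  have h2 := h1.trans (add_le_add (h.limit_time_abs hw t s) le_rfl)
  rw [Real.enorm_eq_ofReal_abs, ← ENNReal.ofReal_mul hη0.le,
    ← ENNReal.ofReal_add (by positivity) (by positivity),
    ENNReal.ofReal_le_ofReal_iff (by positivity)] at h2
  have h3 : ((H + H : NNReal) : ℝ) * η ≤ ε / 4 := by
    calc ((H + H : NNReal) : ℝ) * η ≤ (2 * (H + 1)) * (ε / (8 * (H + 1))) := by
          gcongr
          · push_cast; linarith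
          · exact min_le_right _ _
      _ = ε / 4 := by field_simp; norm_num
  have h4 : (V : ℝ) * |s - t| ≤ η * (ε / 4) := by
    calc (V : ℝ) * |s - t| ≤ (V + 1) * (η * (ε / 4) / (V + 1)) := by
          gcongr
          · linarith
          · exact hs.le.trans (min_le_right _ _)
      _ = η * (ε / 4) := by field_simp
  have h5 : |w y s - w y t| ≤ ε / 2 := by
    have h6 : η * |w y s - w y t| ≤ η * (ε / 2) := by
      nlinarith [mul_le_mul_of_nonneg_left h3 hη0.le]
    exact le_of_mul_le_mul_left h6 hη0
  have h7 : dist (w y t) (w x t) ≤ ε / 8 := by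
    refine ((h.limit_lip hw t).dist_le_mul y x).trans ?_
    rw [Real.dist_eq]
    calc (H : ℝ) * |y - x| ≤ (H + 1) * (ε / (8 * (H + 1))) := by
          gcongr
          · linarith
          · exact hy.le.trans (min_le_left _ _)
      _ = ε / 8 := by field_simp
  have h8 := dist_triangle (w y s) (w y t) (w x t)
  rw [Real.dist_eq (w y s)] at h8
  rw [Real.dist_eq (w y s), Real.dist_eq (w y t)] at *
  linarith

/-! Difference quotients and the derivative of the limit. -/

/-- The difference quotient of the approximate solutions and the one of the limit. -/
noncomputable def quotient (f : ℝ → ℝ) (s x : ℝ) : ℝ := (f (x + s) - f x) / s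

lemma measurable_quotient {f : ℝ → ℝ} (hf : Measurable f) (s : ℝ) : Measurable (quotient f s) :=
  ((hf.comp (measurable_add_const s)).sub hf).div_const s

/-- Both quotients of `u k` are close to `z k`, which is eliminated by the triangle inequality since
nothing is known yet about its convergence; Fatou's lemma then passes to the limit. -/
lemma limit_quotient_sub (h : ApproxFamily Ω u z δ M H V A) (hw : IsLimit Ω u w) (t : ℝ)
    {s s' : ℝ} (hs : 0 < s) (hs' : 0 < s') :
    ∫⁻ x, ‖quotient (fun x => w x t) s x - quotient (fun x => w x t) s' x‖ₑ ∂Ω.measure ≤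
      ENNReal.ofReal (V * (s + s')) := by
  refine lintegral_enorm_le_of_tendsto
    (g := fun k x => quotient (fun x => u k x t) s x - quotient (fun x => u k x t) s' x)
    (fun k => (measurable_quotient (h.measurable k t) s).sub
      (measurable_quotient (h.measurable k t) s'))
    (ae_of_all _ fun x => ((((hw.pointwise _ t).sub (hw.pointwise _ t)).div_const s).sub
      (((hw.pointwise _ t).sub (hw.pointwise _ t)).div_const s'))) (.of_forall fun k => ?_)
    (h.tendsto_ofReal_δ _ (2 * V))
  refine (lintegral_enorm_sub_triangle (measurable_quotient (h.measurable k t) s)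
    (h.meas k t)).trans ?_
  rw [lintegral_enorm_sub_comm (fun x => z k x t)]
  refine (add_le_add (h.quot k t s hs) (h.quot k t s' hs')).trans (le_of_eq ?_)
  have := h.δ_nonneg k
  rw [← ENNReal.ofReal_add (by positivity) (by positivity)]
  congr 1; ring

lemma limit_quotient_le (h : ApproxFamily Ω u z δ M H V A) (hw : IsLimit Ω u w) (t : ℝ)
    {s : ℝ} (hs : 0 < s) :
    ∫⁻ x, ‖quotient (fun x => w x t) s x‖ₑ ∂Ω.measure ≤ ENNReal.ofReal (V * s) + A := by
  refine lintegral_enorm_le_of_tendsto (g := fun k x => quotient (fun x => u k x t) s x)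
    (c := fun k => ENNReal.ofReal (V * s + V * δ k) + A)
    (fun k => (measurable_quotient (h.measurable k t) s))
    (ae_of_all _ fun x => (((hw.pointwise _ t).sub (hw.pointwise _ t)).div_const s))
    (.of_forall fun k => ?_) ((h.tendsto_ofReal_δ _ V).add_const A)
  have := lintegral_enorm_sub_triangle (μ := Ω.measure) (measurable_quotient (h.measurable k t) s)
    (h.meas k t) (k := fun _ => 0)
  simp only [sub_zero] at this
  rw [← mul_add]
  exact this.trans (add_le_add (h.quot k t s hs) (h.lintegral_deriv_le k t))

lemma tendsto_quotient {f : ℝ → ℝ} {K : NNReal} (hf : LipschitzWith K f) (μ : Measure ℝ)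
    (hμ : μ ≪ volume) : ∀ᵐ x ∂μ, Tendsto (fun n : ℕ => quotient f (1 / ((n : ℝ) + 1)) x) atTop
      (𝓝 (deriv f x)) := by
  refine hμ.ae_le (hf.ae_differentiableAt.mono fun x hx => ?_)
  have h1 := hx.hasDerivAt.tendsto_slope_zero
  have h2 : Tendsto (fun n : ℕ => 1 / ((n : ℝ) + 1)) atTop (𝓝[≠] 0) :=
    tendsto_nhdsWithin_iff.2 ⟨tendsto_one_div_add_atTop_nhds_zero_nat,
      .of_forall fun n => by simp; positivity⟩
  refine (h1.comp h2).congr fun n => ?_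
  simp only [Function.comp_apply, quotient, smul_eq_mul]
  field_simp

lemma measure_absolutelyContinuous (Ω : Domain) : Ω.measure ≪ volume :=
  Measure.absolutelyContinuous_of_le Ω.measure_le

/-- The second step of `limit_quotient_sub` tends to zero: its quotients converge almost everywhere
to the derivative of the Lipschitz limit. -/
lemma limit_quotient_sub_deriv (h : ApproxFamily Ω u z δ M H V A) (hw : IsLimit Ω u w) (t : ℝ)
    {s : ℝ} (hs : 0 < s) :
    ∫⁻ x, ‖quotient (fun x => w x t) s x - deriv (fun x => w x t) x‖ₑ ∂Ω.measure ≤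
      ENNReal.ofReal (V * s) := by
  refine lintegral_enorm_le_of_tendsto (g := fun n x => quotient (fun x => w x t) s x -
      quotient (fun x => w x t) (1 / ((n : ℝ) + 1)) x)
    (c := fun n : ℕ => ENNReal.ofReal (V * (s + 1 / ((n : ℝ) + 1))))
    (fun n => (measurable_quotient (h.limit_measurable hw t) s).sub
      (measurable_quotient (h.limit_measurable hw t) _)) ?_
    (.of_forall fun n => h.limit_quotient_sub hw t hs (by positivity)) ?_
  · filter_upwards [tendsto_quotient (h.limit_lip hw t) _ (measure_absolutelyContinuous Ω)]
      with x hx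
    exact hx.const_sub _
  · refine (ENNReal.continuous_ofReal.tendsto _).comp ?_
    simpa using (tendsto_one_div_add_atTop_nhds_zero_nat.const_add s).const_mul (V : ℝ)

lemma limit_lintegral_deriv_le (h : ApproxFamily Ω u z δ M H V A) (hw : IsLimit Ω u w) (t : ℝ) :
    ∫⁻ x, ‖deriv (fun x => w x t) x‖ₑ ∂Ω.measure ≤ A := by
  refine lintegral_enorm_le_of_tendsto (g := fun n x =>
      quotient (fun x => w x t) (1 / ((n : ℝ) + 1)) x)
    (c := fun n : ℕ => ENNReal.ofReal (V * (1 / ((n : ℝ) + 1))) + A)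
    (fun n => (measurable_quotient (h.limit_measurable hw t) _))
    (tendsto_quotient (h.limit_lip hw t) _ (measure_absolutelyContinuous Ω))
    (.of_forall fun n => h.limit_quotient_le hw t (by positivity)) ?_
  have : Tendsto (fun n : ℕ => ENNReal.ofReal (V * (1 / ((n : ℝ) + 1)))) atTop (𝓝 0) := by
    rw [← ENNReal.ofReal_zero]
    refine (ENNReal.continuous_ofReal.tendsto _).comp ?_
    simpa using tendsto_one_div_add_atTop_nhds_zero_nat.const_mul (V : ℝ)
  simpa using this.add_const A

lemma lintegral_quotient_sub_le {f g : ℝ → ℝ} (hf : Measurable f) (hg : Measurable g)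
    (pf : Ω.Per f) (pg : Ω.Per g) {s : ℝ} (hs : 0 < s) :
    ∫⁻ x, ‖quotient f s x - quotient g s x‖ₑ ∂Ω.measure ≤
      ENNReal.ofReal (2 / s) * ∫⁻ x, ‖f x - g x‖ₑ ∂Ω.measure := by
  have e1 := Domain.lintegral_shift (pf.comp₂ pg (fun a b => ‖a - b‖ₑ)) s
  calc ∫⁻ x, ‖quotient f s x - quotient g s x‖ₑ ∂Ω.measure
      ≤ ∫⁻ x, ENNReal.ofReal (1 / s) * (‖f (x + s) - g (x + s)‖ₑ + ‖f x - g x‖ₑ) ∂Ω.measure := by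
        refine lintegral_mono fun x => ?_
        dsimp only
        rw [show quotient f s x - quotient g s x =
          1 / s * ((f (x + s) - g (x + s)) - (f x - g x)) by unfold quotient; ring, enorm_mul,
          Real.enorm_of_nonneg (by positivity)]
        gcongr
        exact enorm_sub_le
    _ = ENNReal.ofReal (1 / s) * (2 * ∫⁻ x, ‖f x - g x‖ₑ ∂Ω.measure) := by
        rw [lintegral_const_mul' _ _ ENNReal.ofReal_ne_top, lintegral_add_right _
          (show Measurable fun x => ‖f x - g x‖ₑ from (hf.sub hg).enorm), e1, two_mul]
    _ = _ := by
        rw [← mul_assoc, ← ENNReal.ofReal_ofNat 2, ← ENNReal.ofReal_mul (by positivity)]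
        congr 2; ring

/-- The approximate derivatives converge in `L¹(Ω)`, uniformly on bounded time intervals. -/
lemma uniform_deriv (h : ApproxFamily Ω u z δ M H V A) (hw : IsLimit Ω u w) (T ε : ℝ)
    (hε : 0 < ε) : ∀ᶠ k in atTop, ∀ t, 0 ≤ t → t ≤ T →
      ∫⁻ x, ‖z k x t - deriv (fun x => w x t) x‖ₑ ∂Ω.measure ≤ ENNReal.ofReal ε := by
  set s := ε / (8 * (V + 1)) with hs
  have hs0 : 0 < s := by positivity
  have hVs : (V : ℝ) * s ≤ ε / 8 := by
    calc (V : ℝ) * s ≤ (V + 1) * s := by gcongr; linarith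
      _ = ε / 8 := by rw [hs]; field_simp
  -- The step s is fixed before k. Comparing quotients costs a factor 2/s, which the tolerance
  -- (s/2)(ε/2) cancels; the two comparisons of quotient and derivative contribute V(s + δ k) and V
  -- s.
  filter_upwards [hw.uniform T (s / 2 * (ε / 2)) (by positivity),
    h.δ_lim.eventually (ge_mem_nhds hs0)] with k hk1 hk2 t ht htT
  have mq := measurable_quotient (h.measurable k t) s
  have mq' := measurable_quotient (h.limit_measurable hw t) s
  have a1 := h.quot k t s hs0
  rw [lintegral_enorm_sub_comm] at a1
  have a2 := (lintegral_quotient_sub_le (h.measurable k t) (h.limit_measurable hw t) (h.per k t)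
    (h.limit_per hw t) hs0).trans (mul_le_mul_right (hk1 t ht htT) _)
  have a3 := h.limit_quotient_sub_deriv hw t hs0
  refine (lintegral_enorm_sub_triangle (h.meas k t) mq).trans ((add_le_add a1
    ((lintegral_enorm_sub_triangle mq mq').trans (add_le_add a2 a3))).trans ?_)
  rw [← ENNReal.ofReal_mul (by positivity), ← ENNReal.ofReal_add (by positivity) (by positivity),
    ← ENNReal.ofReal_add (mul_nonneg V.coe_nonneg (add_nonneg hs0.le (h.δ_nonneg k)))
      (by positivity)]
  refine ENNReal.ofReal_le_ofReal ?_
  have e : 2 / s * (s / 2 * (ε / 2)) = ε / 2 := by field_simp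
  have := mul_le_mul_of_nonneg_left hk2 V.coe_nonneg
  rw [e]
  linarith

/-- The derivative of the limit is continuous in time with values in `L¹(Ω)`. -/
lemma limit_deriv_time (h : ApproxFamily Ω u z δ M H V A) (hw : IsLimit Ω u w) {ε : ℝ}
    (hε : 0 < ε) : ∃ κ : ℝ, 0 < κ ∧ ∀ t t', |t - t'| ≤ κ →
      ∫⁻ x, ‖deriv (fun x => w x t) x - deriv (fun x => w x t') x‖ₑ ∂Ω.measure ≤
        ENNReal.ofReal ε := by
  set s := ε / (8 * (V + 1)) with hs
  have hs0 : 0 < s := by positivity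
  have hVs : (V : ℝ) * s ≤ ε / 8 := by
    calc (V : ℝ) * s ≤ (V + 1) * s := by gcongr; linarith
      _ = ε / 8 := by rw [hs]; field_simp
  refine ⟨s / 2 * (ε / 2) / (V + 1), by positivity, fun t t' htt => ?_⟩
  have mq := measurable_quotient (h.limit_measurable hw t) s
  have mq' := measurable_quotient (h.limit_measurable hw t') s
  have a1 := h.limit_quotient_sub_deriv hw t hs0
  rw [lintegral_enorm_sub_comm] at a1
  have hV : (V : ℝ) * |t - t'| ≤ s / 2 * (ε / 2) := by
    calc (V : ℝ) * |t - t'| ≤ (V + 1) * (s / 2 * (ε / 2) / (V + 1)) := by gcongr; linarith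
      _ = _ := by field_simp
  have a2 := (lintegral_quotient_sub_le (h.limit_measurable hw t) (h.limit_measurable hw t')
    (h.limit_per hw t) (h.limit_per hw t') hs0).trans (mul_le_mul_right
    ((h.limit_time_abs hw t' t).trans (ENNReal.ofReal_le_ofReal hV)) _)
  have a3 := h.limit_quotient_sub_deriv hw t' hs0
  refine (lintegral_enorm_sub_triangle (measurable_deriv _) mq).trans ((add_le_add a1
    ((lintegral_enorm_sub_triangle mq mq').trans (add_le_add a2 a3))).trans ?_)
  rw [← ENNReal.ofReal_mul (by positivity), ← ENNReal.ofReal_add (by positivity) (by positivity),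
    ← ENNReal.ofReal_add (by positivity) (by positivity)]
  refine ENNReal.ofReal_le_ofReal ?_
  have e : 2 / s * (s / 2 * (ε / 2)) = ε / 2 := by field_simp
  rw [e]
  linarith

end ApproxFamily

end ThetaScheme

/-! ### Piecewise linear interpolation -/

namespace ThetaScheme

/-- Piecewise linear interpolation of a grid function. -/
noncomputable def linInterp (dx : ℝ) (a : ℤ → ℝ) (x : ℝ) : ℝ :=
  stepFun dx a x + Int.fract (x / dx) * stepFun dx (diff1 a) x

lemma interp_eq_linInterp {dx : ℝ} (hdx : 0 < dx) (dt : ℝ) (W : ℕ → ℤ → ℝ) (x t : ℝ) :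
    interp dx dt W x t = linInterp dx (W ⌊t / dt⌋₊) x := by
  simp only [interp, linInterp, stepFun, diff1, Int.fract]
  push_cast
  field_simp
  ring

section

variable {Ω : Domain} {dx : ℝ} {a : ℤ → ℝ}

/-- The affine formula holds also at the right end point, where the floor has already jumped to j+1.
This agreement of neighbouring pieces is the source of continuity. -/
lemma linInterp_eq_of_mem (hdx : 0 < dx) {j : ℤ} {x : ℝ} (h1 : j * dx ≤ x)
    (h2 : x ≤ (j + 1) * dx) : linInterp dx a x = a j + (x / dx - j) * diff1 a j := by
  rcases h2.lt_or_eq with h | h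
  · have : ⌊x / dx⌋ = j := by
      rw [Int.floor_eq_iff, le_div_iff₀ hdx, div_lt_iff₀ hdx]
      exact ⟨h1, h⟩
    simp only [linInterp, stepFun, Int.fract, this]
  · have e : x / dx = ((j + 1 : ℤ) : ℝ) := by
      rw [h]; push_cast; field_simp
    simp only [linInterp, stepFun, e, Int.fract_intCast, Int.floor_intCast, diff1]
    push_cast
    ring

lemma abs_linInterp_le_add (x : ℝ) :
    |linInterp dx a x| ≤ |stepFun dx a x| + |stepFun dx (fun j => a (j + 1)) x| := by
  have e : linInterp dx a x = (1 - Int.fract (x / dx)) * stepFun dx a x +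
      Int.fract (x / dx) * stepFun dx (fun j => a (j + 1)) x := by
    simp only [linInterp, stepFun, diff1]; ring
  have h0 := Int.fract_nonneg (x / dx)
  have h1 := (Int.fract_lt_one (x / dx)).le
  rw [e]
  refine (abs_add_le _ _).trans ?_
  rw [abs_mul, abs_mul, abs_of_nonneg h0, abs_of_nonneg (sub_nonneg.2 h1)]
  exact add_le_add (mul_le_of_le_one_left (abs_nonneg _) (by linarith))
    (mul_le_of_le_one_left (abs_nonneg _) h1)

lemma abs_linInterp_le {M : ℝ} (hM : ∀ j, |a j| ≤ M) (x : ℝ) : |linInterp dx a x| ≤ M := by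
  have e : linInterp dx a x = (1 - Int.fract (x / dx)) * stepFun dx a x +
      Int.fract (x / dx) * stepFun dx (fun j => a (j + 1)) x := by
    simp only [linInterp, stepFun, diff1]; ring
  have h0 := Int.fract_nonneg (x / dx)
  have h1 := (Int.fract_lt_one (x / dx)).le
  rw [e]
  refine (abs_add_le _ _).trans ?_
  rw [abs_mul, abs_mul, abs_of_nonneg h0, abs_of_nonneg (sub_nonneg.2 h1)]
  calc _ ≤ (1 - Int.fract (x / dx)) * M + Int.fract (x / dx) * M :=
        add_le_add (mul_le_mul_of_nonneg_left (hM _) (sub_nonneg.2 h1))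
          (mul_le_mul_of_nonneg_left (hM _) h0)
    _ = M := by ring

lemma abs_linInterp_sub_le {K : ℝ} (hK : ∀ j, |diff1 a j| ≤ K) (x : ℝ) :
    |linInterp dx a x - stepFun dx a x| ≤ K := by
  rw [linInterp, add_sub_cancel_left, abs_mul, abs_of_nonneg (Int.fract_nonneg _)]
  exact (mul_le_of_le_one_left (abs_nonneg _) (Int.fract_lt_one _).le).trans (hK _)

lemma linInterp_sub (a b : ℤ → ℝ) (x : ℝ) :
    linInterp dx a x - linInterp dx b x = linInterp dx (fun j => a j - b j) x := by
  simp only [linInterp, stepFun, diff1]; ring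

lemma continuous_linInterp (hdx : 0 < dx) (a : ℤ → ℝ) : Continuous (linInterp dx a) := by
  have hc : ∀ j : ℤ, Continuous (fun x : ℝ => a j + (x / dx - j) * diff1 a j) := fun j => by
    fun_prop
  refine continuous_iff_continuousAt.2 fun x => continuousAt_iff_continuous_left_right.2 ⟨?_, ?_⟩
  -- From the left the relevant cell has the index ⌈x/dx⌉ - 1, which differs from the floor exactly
  -- at grid points.
  · have h1 : ((⌈x / dx⌉ - 1 : ℤ) : ℝ) * dx < x := by
      rw [← lt_div_iff₀ hdx]
      have := Int.ceil_lt_add_one (x / dx)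
      push_cast
      linarith
    have h2 : x ≤ (((⌈x / dx⌉ - 1 : ℤ) : ℝ) + 1) * dx := by
      rw [← div_le_iff₀ hdx]
      push_cast
      linarith [Int.le_ceil (x / dx)]
    refine ((hc (⌈x / dx⌉ - 1)).continuousWithinAt).congr_of_eventuallyEq ?_
      (linInterp_eq_of_mem hdx h1.le h2)
    filter_upwards [Ioc_mem_nhdsLE h1] with y hy
    exact linInterp_eq_of_mem hdx hy.1.le (hy.2.trans h2)
  · have h1 : (⌊x / dx⌋ : ℝ) * dx ≤ x := (le_div_iff₀ hdx).1 (Int.floor_le _)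
    have h2 : x < ((⌊x / dx⌋ : ℝ) + 1) * dx := (div_lt_iff₀ hdx).1 (Int.lt_floor_add_one _)
    refine ((hc ⌊x / dx⌋).continuousWithinAt).congr_of_eventuallyEq ?_
      (linInterp_eq_of_mem hdx h1 h2.le)
    filter_upwards [Ico_mem_nhdsGE h2] with y hy
    exact linInterp_eq_of_mem hdx (h1.trans hy.1) hy.2.le

/-- At grid points the slopes on the two sides may differ. The right derivative exists everywhere
and suffices for the fundamental theorem of calculus. -/
lemma hasDerivWithinAt_linInterp (hdx : 0 < dx) (a : ℤ → ℝ) (x : ℝ) :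
    HasDerivWithinAt (linInterp dx a) (stepFun dx (diff1 a) x / dx) (Ici x) x := by
  have h1 : (⌊x / dx⌋ : ℝ) * dx ≤ x := (le_div_iff₀ hdx).1 (Int.floor_le _)
  have h2 : x < ((⌊x / dx⌋ : ℝ) + 1) * dx := (div_lt_iff₀ hdx).1 (Int.lt_floor_add_one _)
  unfold stepFun
  generalize ⌊x / dx⌋ = j at *
  have hd : HasDerivAt (fun x : ℝ => a j + (x / dx - j) * diff1 a j) (diff1 a j / dx) x := by
    have := ((((hasDerivAt_id x).div_const dx).sub_const (j : ℝ)).mul_const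
      (diff1 a j)).const_add (a j)
    rwa [one_div_mul_eq_div] at this
  refine hd.hasDerivWithinAt.congr_of_eventuallyEq ?_ (linInterp_eq_of_mem hdx h1 h2.le)
  filter_upwards [Ico_mem_nhdsGE h2] with y hy
  exact linInterp_eq_of_mem hdx (h1.trans hy.1) hy.2.le

lemma intervalIntegrable_stepFun {b : ℤ → ℝ} {K : ℝ} (hK : ∀ j, |b j| ≤ K) (x y : ℝ) :
    IntervalIntegrable (stepFun dx b) volume x y := by
  refine intervalIntegrable_const (c := K) |>.mono_fun
    (measurable_stepFun dx b).aestronglyMeasurable (ae_of_all _ fun z => ?_)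
  exact (hK _).trans (le_abs_self K)

lemma linInterp_sub_eq_integral (hdx : 0 < dx) {K : ℝ} (hK : ∀ j, |diff1 a j| ≤ K) (x y : ℝ) :
    linInterp dx a y - linInterp dx a x = ∫ t in x..y, stepFun dx (diff1 a) t / dx :=
  (intervalIntegral.integral_eq_sub_of_hasDeriv_right (continuous_linInterp hdx a).continuousOn
    (fun t _ => (hasDerivWithinAt_linInterp hdx a t).mono Ioi_subset_Ici_self)
    ((intervalIntegrable_stepFun hK x y).div_const dx)).symm

lemma lipschitzWith_linInterp (hdx : 0 < dx) {H : NNReal} (hH : ∀ j, |diff1 a j| ≤ H * dx) :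
    LipschitzWith H (linInterp dx a) := by
  refine LipschitzWith.of_dist_le_mul fun y x => ?_
  rw [Real.dist_eq, linInterp_sub_eq_integral hdx hH, Real.dist_eq]
  refine intervalIntegral.norm_integral_le_of_norm_le_const
    (f := fun t => stepFun dx (diff1 a) t / dx) fun t _ => ?_
  rw [Real.norm_eq_abs, abs_div, abs_of_pos hdx, div_le_iff₀ hdx]
  exact hH _

lemma hasWeakDeriv_linInterp (hdx : 0 < dx) {H : NNReal} (hH : ∀ j, |diff1 a j| ≤ H * dx) :
    HasWeakDeriv (linInterp dx a) (fun x => stepFun dx (diff1 a) x / dx) := by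
  have hL := lipschitzWith_linInterp hdx hH
  refine (hasWeakDeriv_of_lipschitzWith hL).congr .rfl ?_
  filter_upwards [hL.ae_differentiableAt] with x hx
  exact (uniqueDiffOn_Ici x x self_mem_Ici).eq_deriv _ hx.hasDerivAt.hasDerivWithinAt
    (hasDerivWithinAt_linInterp hdx a x)

lemma per_linInterp (hdx : 0 < dx) (pa : Ω.Per (stepFun dx a))
    (pf : Ω.Per fun x => Int.fract (x / dx)) : Ω.Per (linInterp dx a) :=
  pa.comp₂ (pf.comp₂ (Domain.Per.diff1 hdx pa) (fun u v => u * v)) (fun u v => u + v)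

lemma stepFun_add_nat (hdx : 0 < dx) (b : ℤ → ℝ) (l : ℕ) (x : ℝ) :
    stepFun dx b (x + l * dx) = b (⌊x / dx⌋ + l) := by
  have : (x + l * dx) / dx = x / dx + (l : ℕ) := by field_simp
  rw [stepFun, this, Int.floor_add_natCast]

/-- `L¹` shift estimate for grid functions. -/
lemma lintegral_stepFun_shift_le (hdx : 0 < dx) {b : ℤ → ℝ} (pb : Ω.Per (stepFun dx b)) {r : ℝ}
    (hr : 0 ≤ r) : ∫⁻ x, ‖stepFun dx b (x + r) - stepFun dx b x‖ₑ ∂Ω.measure ≤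
      ENNReal.ofReal ((r + dx) / dx) * gridNorm Ω dx (fun _ => 1) (diff1 b) := by
  -- A shift by r crosses at most this many grid points, so the difference telescopes into at most L
  -- first differences.
  set L := ⌊r / dx⌋₊ + 1 with hL
  have hpt : ∀ x, ‖stepFun dx b (x + r) - stepFun dx b x‖ₑ ≤
      ∑ l ∈ Finset.range L, ‖stepFun dx (diff1 b) (x + l * dx)‖ₑ := fun x => by
    obtain ⟨m, hm⟩ : ∃ m : ℕ, ⌊(x + r) / dx⌋ = ⌊x / dx⌋ + m := by
      have : ⌊x / dx⌋ ≤ ⌊(x + r) / dx⌋ := Int.floor_le_floor (by gcongr; linarith)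
      exact ⟨(⌊(x + r) / dx⌋ - ⌊x / dx⌋).toNat, by omega⟩
    have hmL : m ≤ L := by
      have h1 := Int.floor_le ((x + r) / dx)
      have h2 := Int.lt_floor_add_one (x / dx)
      have h3 := Nat.lt_floor_add_one (r / dx)
      rw [hm, add_div] at h1
      push_cast at h1
      have : (m : ℝ) < L + 1 := by rw [hL]; push_cast; linarith
      exact Nat.lt_succ_iff.1 (by exact_mod_cast this)
    have e : ∀ i : ℤ, ‖b (i + m) - b i‖ₑ ≤ ∑ l ∈ Finset.range m, ‖diff1 b (i + l)‖ₑ := fun i => by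
      have := Finset.sum_range_sub (fun l : ℕ => b (i + l)) m
      push_cast at this
      rw [add_zero] at this
      rw [← this]
      refine (enorm_sum_le _ _).trans (le_of_eq ?_)
      simp only [diff1, add_assoc]
    rw [stepFun, stepFun, hm]
    refine (e _).trans ?_
    simp only [stepFun_add_nat hdx]
    exact Finset.sum_le_sum_of_subset (Finset.range_mono hmL)
  have pd := Domain.Per.diff1 hdx pb
  have hs : ∀ l : ℕ, ∫⁻ x, ‖stepFun dx (diff1 b) (x + l * dx)‖ₑ ∂Ω.measure =
      gridNorm Ω dx (fun _ => 1) (diff1 b) := fun l => by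
    rw [Domain.lintegral_shift (pd.comp fun v => ‖v‖ₑ) (l * dx)]
    simp [gridNorm]
  refine (lintegral_mono hpt).trans ?_
  rw [lintegral_finsetSum _ fun (l : ℕ) _ => show Measurable fun x =>
    ‖stepFun dx (diff1 b) (x + l * dx)‖ₑ from ((measurable_stepFun dx (diff1 b)).comp
    (measurable_add_const _)).enorm]
  simp only [hs, Finset.sum_const, Finset.card_range, nsmul_eq_mul]
  gcongr
  rw [← ENNReal.ofReal_natCast]
  refine ENNReal.ofReal_le_ofReal ?_
  rw [hL, add_div, div_self hdx.ne']
  push_cast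
  linarith [Nat.floor_le (div_nonneg hr hdx.le)]

/-- The iterated forward difference is the central second difference shifted by one index. -/
lemma gridNorm_diff1_diff1 (hdx : 0 < dx) (pa : Ω.Per (stepFun dx a)) :
    gridNorm Ω dx (fun _ => 1) (diff1 (diff1 a)) = gridNorm Ω dx (fun _ => 1) (diff2 a) := by
  rw [← gridNorm_shift hdx (Domain.Per.diff2 hdx pa)]
  congr 1
  funext j
  simp only [diff1, diff2, add_sub_cancel_right]
  ring

/-- The difference quotients of the interpolation are close to its derivative. -/
lemma lintegral_quotient_linInterp_le (hdx : 0 < dx) (pa : Ω.Per (stepFun dx a)) {K V : ℝ}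
    (hK : ∀ j, |diff1 a j| ≤ K) (hV0 : 0 ≤ V)
    (hV : gridNorm Ω dx (fun _ => 1) (diff2 a) ≤ ENNReal.ofReal (dx ^ 2 * V)) {s : ℝ}
    (hs : 0 < s) :
    ∫⁻ x, ‖(linInterp dx a (x + s) - linInterp dx a x) / s - stepFun dx (diff1 a) x / dx‖ₑ
      ∂Ω.measure ≤ ENNReal.ofReal (V * (s + dx)) := by
  set z := fun x => stepFun dx (diff1 a) x / dx with hz
  have mz : Measurable z := (measurable_stepFun dx (diff1 a)).div_const dx
  have hint : ∀ x y, IntervalIntegrable z volume x y := fun x y =>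
    (intervalIntegrable_stepFun hK x y).div_const dx
  have hpt : ∀ x, ‖(linInterp dx a (x + s) - linInterp dx a x) / s - z x‖ₑ ≤
      ENNReal.ofReal (1 / s) * ∫⁻ r in Ioc 0 s, ‖z (x + r) - z x‖ₑ := fun x => by
    -- The quotient is the mean of the slope over [x, x+s], so its error is a mean of translation
    -- errors of the slope.
    have e : (linInterp dx a (x + s) - linInterp dx a x) / s - z x =
        1 / s * ∫ r in (0 : ℝ)..s, (z (x + r) - z x) := by
      have h1 : ∫ r in (0 : ℝ)..s, z (x + r) = ∫ t in x..(x + s), z t := by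
        simp [intervalIntegral.integral_comp_add_left]
      rw [linInterp_sub_eq_integral hdx hK, intervalIntegral.integral_sub ?_ (by simp), h1,
        intervalIntegral.integral_const]
      · rw [← hz, smul_eq_mul, sub_zero]
        field_simp
      · have := (hint x (x + s)).comp_add_left x
        simpa using this
    rw [e, enorm_mul, Real.enorm_of_nonneg (by positivity), intervalIntegral.integral_of_le hs.le]
    gcongr
    exact enorm_integral_le_lintegral_enorm _
  have hin : ∀ r, 0 ≤ r → r ≤ s → ∫⁻ x, ‖z (x + r) - z x‖ₑ ∂Ω.measure ≤
      ENNReal.ofReal (V * (s + dx)) := fun r hr hrs => by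
    have e : ∀ x, ‖z (x + r) - z x‖ₑ = ENNReal.ofReal (1 / dx) *
        ‖stepFun dx (diff1 a) (x + r) - stepFun dx (diff1 a) x‖ₑ := fun x => by
      rw [hz, ← sub_div, div_eq_mul_one_div, mul_comm, enorm_mul,
        Real.enorm_of_nonneg (by positivity)]
    simp only [e]
    rw [lintegral_const_mul' _ _ ENNReal.ofReal_ne_top]
    have h1 := lintegral_stepFun_shift_le hdx (Domain.Per.diff1 hdx pa) hr
    rw [gridNorm_diff1_diff1 hdx pa] at h1
    refine (mul_le_mul_right (h1.trans (mul_le_mul_right hV _)) _).trans ?_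
    rw [← ENNReal.ofReal_mul (by positivity), ← ENNReal.ofReal_mul (by positivity)]
    refine ENNReal.ofReal_le_ofReal ?_
    calc 1 / dx * ((r + dx) / dx * (dx ^ 2 * V)) = V * (r + dx) := by field_simp
      _ ≤ V * (s + dx) := by gcongr
  refine (lintegral_mono hpt).trans ?_
  have mj : Measurable (fun p : ℝ × ℝ => ‖z (p.1 + p.2) - z p.1‖ₑ) :=
    ((mz.comp (measurable_fst.add measurable_snd)).sub (mz.comp measurable_fst)).enorm
  rw [lintegral_const_mul' _ _ ENNReal.ofReal_ne_top, lintegral_lintegral_swap mj.aemeasurable]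
  calc ENNReal.ofReal (1 / s) * ∫⁻ r in Ioc 0 s, (∫⁻ x, ‖z (x + r) - z x‖ₑ ∂Ω.measure)
      ≤ ENNReal.ofReal (1 / s) * ∫⁻ r in Ioc 0 s, ENNReal.ofReal (V * (s + dx)) := by
        exact mul_le_mul_right (setLIntegral_mono' measurableSet_Ioc
          fun r hr => hin r hr.1.le hr.2) _
    _ = ENNReal.ofReal (V * (s + dx)) := by
        rw [setLIntegral_const, Real.volume_Ioc, sub_zero, mul_left_comm,
          ← ENNReal.ofReal_mul (by positivity), one_div, inv_mul_cancel₀ hs.ne',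
          ENNReal.ofReal_one, mul_one]

lemma lintegral_linInterp_le (hdx : 0 < dx) (pa : Ω.Per (stepFun dx a)) :
    ∫⁻ x, ‖linInterp dx a x‖ₑ ∂Ω.measure ≤ 2 * gridNorm Ω dx (fun _ => 1) a := by
  have h1 := gridNorm_shift hdx pa
  calc _ ≤ ∫⁻ x, (‖stepFun dx a x‖ₑ + ‖stepFun dx (fun j => a (j + 1)) x‖ₑ) ∂Ω.measure := by
        refine lintegral_mono fun x => ?_
        simp only [Real.enorm_eq_ofReal_abs]
        rw [← ENNReal.ofReal_add (abs_nonneg _) (abs_nonneg _)]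
        exact ENNReal.ofReal_le_ofReal (abs_linInterp_le_add x)
    _ = _ := by
        rw [lintegral_add_left (measurable_stepFun dx a).enorm, two_mul]
        nth_rewrite 2 [← h1]
        simp [gridNorm]

/-- The interpolation at x only involves the step function at x and x + dx, and both points stay
outside radius R when |x| > R+1. The weight may be any function that is at least 1 there. -/
lemma setLIntegral_linInterp_le (hdx : 0 < dx) (hdx1 : dx ≤ 1) {ρ : ℝ → ℝ} {R : ℝ}
    (mρ : Measurable ρ) (hρ : ∀ x, R < |x| → 1 ≤ ρ x) :
    ∫⁻ x in {x | R + 1 < |x|}, ‖linInterp dx a x‖ₑ ∂Domain.line.measure ≤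
      2 * gridNorm .line dx ρ a := by
  rw [← lintegral_indicator (measurableSet_lt_abs _)]
  set g := fun x => ENNReal.ofReal (ρ x) * ‖stepFun dx a x‖ₑ with hg
  have hsh : ∫⁻ x, g (x + dx) ∂Domain.line.measure = ∫⁻ x, g x ∂Domain.line.measure :=
    Domain.lintegral_shift (fun h => by cases h) dx
  have key : ∀ y, R < |y| → ‖stepFun dx a y‖ₑ ≤ g y := fun y hy => by
    have h1 : 1 ≤ ENNReal.ofReal (ρ y) := by simpa using hρ y hy
    simpa using mul_le_mul_left h1 ‖stepFun dx a y‖ₑ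
  calc _ ≤ ∫⁻ x, (g x + g (x + dx)) ∂Domain.line.measure := by
        refine lintegral_mono fun x => ?_
        rw [indicator_apply]
        split_ifs with hx
        swap
        · exact bot_le
        replace hx : R + 1 < |x| := hx
        calc ‖linInterp dx a x‖ₑ ≤ ‖stepFun dx a x‖ₑ + ‖stepFun dx a (x + dx)‖ₑ := by
              rw [← stepFun_shift hdx]
              simp only [Real.enorm_eq_ofReal_abs]
              rw [← ENNReal.ofReal_add (abs_nonneg _) (abs_nonneg _)]
              exact ENNReal.ofReal_le_ofReal (abs_linInterp_le_add x)
          _ ≤ _ := by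
              refine add_le_add (key _ (by linarith)) (key _ ?_)
              have := abs_sub_abs_le_abs_sub x (x + dx)
              rw [show x - (x + dx) = -dx by ring, abs_neg, abs_of_pos hdx] at this
              linarith
    _ ≤ _ := by
        have mg : Measurable g := mρ.ennreal_ofReal.mul (measurable_stepFun dx a).enorm
        rw [lintegral_add_left mg, hsh, two_mul]
        rfl

end

end ThetaScheme

/-! ### The interpolations as an approximating family -/

namespace ThetaScheme

lemma IsSchemeSolution.per_fract {Ω : Domain} {B : ℝ → ℝ} {w₀ : ℝ → ℝ} {θ dx dt : ℝ}
    {W : ℕ → ℤ → ℝ} (h : IsSchemeSolution Ω B w₀ θ dx dt W) (hdx : 0 < dx) :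
    Ω.Per (fun x => Int.fract (x / dx)) := by
  rintro rfl x
  obtain ⟨N, -, hN, -⟩ := h.grid
  have : (x + 1) / dx = x / dx + (N : ℕ) := by
    rw [add_div]
    congr 1
    rw [div_eq_iff hdx.ne', hN]
  simp only [this, Int.fract_add_natCast]

/-- A sequence of stable schemes with the same initial datum and vanishing mesh sizes. -/
structure SchemeFamily (Ω : Domain) (B w₀ F h : ℝ → ℝ) (H V : NNReal) (θ : ℝ) (dx dt : ℕ → ℝ)
    (W : ℕ → ℕ → ℤ → ℝ) : Prop where
  stable : ∀ k, StableScheme Ω B w₀ θ (dx k) (dt k) (W k)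
  rep : InitialRep Ω w₀ F h H V
  dx_le : ∀ k, dx k ≤ 1
  dt_le : ∀ k, dt k ≤ 1
  dx_lim : Tendsto dx atTop (𝓝 0)
  dt_lim : Tendsto dt atTop (𝓝 0)

lemma InitialRep.exists_bound {Ω : Domain} {w₀ F h : ℝ → ℝ} {H V : NNReal}
    (R : InitialRep Ω w₀ F h H V) : ∃ M, ∀ x, |F x| ≤ M := by
  refine ⟨(∫⁻ y, ‖F y‖ₑ ∂Ω.measure + ENNReal.ofReal (1 * (H * 1))).toReal, fun x => ?_⟩
  have h1 := enorm_le_of_lipschitzWith R.lip R.perF one_pos le_rfl x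
  rw [ENNReal.ofReal_one, one_mul, Real.enorm_eq_ofReal_abs] at h1
  refine (ENNReal.ofReal_le_iff_le_toReal ?_).1 h1
  exact ENNReal.add_ne_top.2 ⟨R.lintegral_ne_top, ENNReal.ofReal_ne_top⟩

namespace SchemeFamily

variable {Ω : Domain} {B w₀ F h : ℝ → ℝ} {H V : NNReal} {θ : ℝ} {dx dt : ℕ → ℝ}
  {W : ℕ → ℕ → ℤ → ℝ}

lemma comp (S : SchemeFamily Ω B w₀ F h H V θ dx dt W) {σ : ℕ → ℕ} (hσ : StrictMono σ) :
    SchemeFamily Ω B w₀ F h H V θ (fun k => dx (σ k)) (fun k => dt (σ k)) (fun k => W (σ k)) where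
  stable _ := S.stable _
  rep := S.rep
  dx_le _ := S.dx_le _
  dt_le _ := S.dt_le _
  dx_lim := S.dx_lim.comp hσ.tendsto_atTop
  dt_lim := S.dt_lim.comp hσ.tendsto_atTop

lemma dx_pos (S : SchemeFamily Ω B w₀ F h H V θ dx dt W) (k : ℕ) : 0 < dx k := (S.stable k).dx_pos

lemma dt_pos (S : SchemeFamily Ω B w₀ F h H V θ dx dt W) (k : ℕ) : 0 < dt k := (S.stable k).dt_pos

lemma init (S : SchemeFamily Ω B w₀ F h H V θ dx dt W) (k : ℕ) :
    InitialRep.IsCellAverage (dx k) w₀ (W k 0) := (S.stable k).sol.init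

lemma abs_le (S : SchemeFamily Ω B w₀ F h H V θ dx dt W) {M : ℝ} (hM : ∀ x, |F x| ≤ M)
    (k n : ℕ) : ∀ j, |W k n j| ≤ M :=
  (S.stable k).abs_le (S.rep.abs_average_le (S.dx_pos k) (S.init k) hM) n

lemma abs_diff1_le (S : SchemeFamily Ω B w₀ F h H V θ dx dt W) (k n : ℕ) :
    ∀ j, |diff1 (W k n) j| ≤ H * dx k :=
  (S.stable k).abs_diff1_le (S.rep.abs_diff1_le (S.dx_pos k) (S.init k)) n

lemma gridNorm_diff1_le (S : SchemeFamily Ω B w₀ F h H V θ dx dt W) (k n : ℕ) :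
    gridNorm Ω (dx k) (fun _ => 1) (diff1 (W k n)) ≤
      4 * (ENNReal.ofReal (dx k) * ∫⁻ y, ‖h y‖ₑ ∂Ω.measure) :=
  ((S.stable k).gridNorm_diff1_le n).trans (S.rep.gridNorm_diff1_le (S.dx_pos k) (S.init k))

lemma gridNorm_diff2_init_le (S : SchemeFamily Ω B w₀ F h H V θ dx dt W) (k : ℕ) :
    gridNorm Ω (dx k) (fun _ => 1) (diff2 (W k 0)) ≤ ENNReal.ofReal (dx k ^ 2 * (4 * V)) :=
  S.rep.gridNorm_one_diff2_le (S.dx_pos k) (S.dx_le k) (S.init k)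

lemma gridNorm_diff2_le (S : SchemeFamily Ω B w₀ F h H V θ dx dt W) (k n : ℕ) :
    gridNorm Ω (dx k) (fun _ => 1) (diff2 (W k n)) ≤ ENNReal.ofReal (dx k ^ 2 * (4 * V)) :=
  ((S.stable k).gridNorm_diff2_le n).1.trans (S.gridNorm_diff2_init_le k)

lemma gridNorm_init_le (S : SchemeFamily Ω B w₀ F h H V θ dx dt W) (k : ℕ) :
    gridNorm Ω (dx k) (fun _ => 1) (W k 0) ≤ 4 * ∫⁻ y, ‖F y‖ₑ ∂Ω.measure := by
  simpa using S.rep.gridNorm_average_le (S.dx_pos k) (S.init k) (ρ := fun _ => 1)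
    (ρ' := fun _ => 1) measurable_const (Domain.per_const 1) (fun _ _ _ => by simp)

lemma interp_eq (S : SchemeFamily Ω B w₀ F h H V θ dx dt W) (k : ℕ) (x t : ℝ) :
    interp (dx k) (dt k) (W k) x t = linInterp (dx k) (W k ⌊t / dt k⌋₊) x :=
  interp_eq_linInterp (S.dx_pos k) _ _ _ _

/-- Each step costs dt/dx² times a second difference of size O(dx²), so the mesh ratio cancels and
only the elapsed time m dt remains. -/
lemma time_le (S : SchemeFamily Ω B w₀ F h H V θ dx dt W) (k n m : ℕ) :
    gridNorm Ω (dx k) (fun _ => 1) (fun j => W k (n + m) j - W k n j) ≤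
      ENNReal.ofReal (m * dt k * (4 * V)) := by
  refine ((S.stable k).gridNorm_sub_le n m).trans
    ((mul_le_mul_right (S.gridNorm_diff2_init_le k) _).trans (le_of_eq ?_))
  have := S.dx_pos k
  have := S.dt_pos k
  rw [← ENNReal.ofReal_mul (by positivity)]
  congr 1
  field_simp

/-- The mass far away is small, uniformly in the mesh sizes. -/
lemma tail_le (S : SchemeFamily .line B w₀ F h H V θ dx dt W) (T : ℝ) {ε : ℝ}
    (hε : 0 < ε) : ∃ R : ℝ, ∀ (k n : ℕ), n * dt k ≤ T →
      ∫⁻ x in {x | R < |x|}, ‖linInterp (dx k) (W k n) x‖ₑ ∂Domain.line.measure ≤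
        ENNReal.ofReal ε := by
  wlog hT : 0 ≤ T
  · obtain ⟨R, hR⟩ := this S 0 hε le_rfl
    refine ⟨R, fun k n hn => hR k n (hn.trans (not_le.1 hT).le)⟩
  set I := (∫⁻ x, ‖F x‖ₑ ∂Domain.line.measure).toReal with hI
  have hI' : ∫⁻ x, ‖F x‖ₑ ∂Domain.line.measure = ENNReal.ofReal I :=
    (ENNReal.ofReal_toReal S.rep.lintegral_ne_top).symm
  have hI0 : 0 ≤ I := ENNReal.toReal_nonneg
  set e := ε / (16 * (1 + T)) with he
  have he0 : 0 < e := by positivity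
  obtain ⟨r, hr, htail⟩ := S.rep.exists_tail he0
  -- This is the bound that `gridNorm_weight_le` will give for the weighted norm, as a function of
  -- R. The core radius r is fixed, and as R → ∞ only the terms in `e` survive.
  have hlim : Tendsto (fun R : ℝ => 4 * ((r / R) ^ 2 * I + e) + T * (4 * ((r / R) ^ 2 * V + e) +
      T * (2 / R ^ 2) * (4 * V))) atTop (𝓝 (4 * (0 ^ 2 * I + e) + T * (4 * (0 ^ 2 * V + e) +
      T * 0 * (4 * V)))) := by
    have h1 : Tendsto (fun R : ℝ => r / R) atTop (𝓝 0) := tendsto_const_nhds.div_atTop tendsto_id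
    have h2 : Tendsto (fun R : ℝ => 2 / R ^ 2) atTop (𝓝 0) :=
      tendsto_const_nhds.div_atTop (tendsto_pow_atTop two_ne_zero)
    exact (((((h1.pow 2).mul_const I).add_const e).const_mul 4)).add
      ((((((h1.pow 2).mul_const _).add_const e).const_mul 4).add
        ((h2.const_mul T).mul_const _)).const_mul T)
  have hval : 4 * (0 ^ 2 * I + e) + T * (4 * (0 ^ 2 * V + e) + T * 0 * (4 * V)) < ε / 2 := by
    have : 4 * (0 ^ 2 * I + e) + T * (4 * (0 ^ 2 * V + e) + T * 0 * (4 * V)) =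
        4 * ((1 + T) * e) := by ring
    rw [this, he]
    have : (1 + T) * (ε / (16 * (1 + T))) = ε / 16 := by field_simp
    rw [this]
    linarith
  obtain ⟨R, hR, hR0⟩ := ((hlim.eventually (gt_mem_nhds hval)).and (eventually_gt_atTop 0)).exists
  refine ⟨R + 1, fun k n hn => ?_⟩
  have hdx := S.dx_pos k
  have hdt := S.dt_pos k
  -- The weight equals 1 for |x| ≥ R and is at most (r/R)² on the core. Its second difference is
  -- O(dx²/R²), which compensates the factor dt/dx² per step.
  set ψ : ℝ → ℝ := fun x => min 1 ((x / R) ^ 2) with hψ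
  have mψ : Measurable ψ := measurable_const.min ((measurable_id.div_const R).pow_const 2)
  have hψ1 : ∀ x, ψ x ≤ 1 := fun x => min_le_left _ _
  have hψ0 : ∀ x, 0 ≤ ψ x := fun x => le_min zero_le_one (sq_nonneg _)
  -- Where ψ = 1 the second difference is at most 0, since 1 is the maximum; elsewhere the
  -- neighbours are bounded by the parabola, whose second difference is exact.
  have hψc : ∀ x, ψ (x + dx k) - 2 * ψ x + ψ (x - dx k) ≤ 2 * dx k ^ 2 / R ^ 2 := fun x => by
    rcases le_total 1 ((x / R) ^ 2) with h1 | h1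
    · have : ψ x = 1 := min_eq_left h1
      have h2 : 0 ≤ 2 * dx k ^ 2 / R ^ 2 := by positivity
      linarith [hψ1 (x + dx k), hψ1 (x - dx k)]
    · have h2 : ψ x = (x / R) ^ 2 := min_eq_right h1
      have h3 : ψ (x + dx k) ≤ ((x + dx k) / R) ^ 2 := min_le_right _ _
      have h4 : ψ (x - dx k) ≤ ((x - dx k) / R) ^ 2 := min_le_right _ _
      have h5 : ((x + dx k) / R) ^ 2 - 2 * (x / R) ^ 2 + ((x - dx k) / R) ^ 2 =
        2 * dx k ^ 2 / R ^ 2 := by field_simp; ring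
      linarith
  have hψr : ∀ x, |x| ≤ r → ψ x ≤ (r / R) ^ 2 := fun x hx => by
    refine (min_le_right _ _).trans (sq_le_sq' ?_ ?_)
    · rw [← neg_div]
      gcongr
      exact (_root_.abs_le.1 hx).1
    · gcongr
      exact (_root_.abs_le.1 hx).2
  obtain ⟨h1, h2⟩ := htail (dx k) (W k 0) ((r / R) ^ 2) ψ hdx (S.dx_le k) (S.init k)
    (sq_nonneg _) hψ1 hψr
  have h3 := S.gridNorm_diff2_init_le k
  have h4 := (S.stable k).gridNorm_weight_le (ne_top_of_le_ne_top ENNReal.ofReal_ne_top h3)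
    (fun h => by cases h) mψ (fun x => ⟨hψ0 x, hψ1 x⟩) (by positivity) hψc n
  have h5 : gridNorm .line (dx k) ψ (W k n) ≤ ENNReal.ofReal (ε / 2) := by
    refine h4.trans ((add_le_add h1 (mul_le_mul_right (add_le_add h2
      (mul_le_mul_right h3 _)) _)).trans ?_)
    rw [hI', ← ENNReal.ofReal_mul (by positivity), ← ENNReal.ofReal_add (by positivity)
      (by positivity), ← ENNReal.ofReal_mul (by positivity), ← ENNReal.ofReal_add (by positivity)
      (by positivity), ← ENNReal.ofReal_mul (by positivity), ← ENNReal.ofReal_ofNat 4,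
      ← ENNReal.ofReal_mul (by positivity), ← ENNReal.ofReal_add (by positivity) (by positivity)]
    refine ENNReal.ofReal_le_ofReal (le_trans (le_of_eq ?_) (le_trans (add_le_add le_rfl
      (mul_le_mul hn (add_le_add le_rfl (mul_le_mul_of_nonneg_right (mul_le_mul_of_nonneg_right hn
        ?_) ?_)) ?_ hT)) hR.le))
    · field_simp
    all_goals positivity
  refine (setLIntegral_linInterp_le hdx (S.dx_le k) mψ fun x hx => ?_).trans
    ((mul_le_mul_right h5 2).trans (le_of_eq ?_))
  · refine le_min le_rfl ?_
    rw [div_pow, le_div_iff₀ (by positivity), one_mul, ← sq_abs x]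
    exact pow_le_pow_left₀ hR0.le hx.le 2
  · rw [← ENNReal.ofReal_ofNat 2, ← ENNReal.ofReal_mul (by norm_num)]
    congr 1; ring

/-- The interpolations satisfy the uniform estimates of an approximating family. -/
theorem approxFamily (S : SchemeFamily Ω B w₀ F h H V θ dx dt W) {M : ℝ} (hM : ∀ x, |F x| ≤ M) :
    ApproxFamily Ω (fun k => interp (dx k) (dt k) (W k))
      (fun k x t => stepFun (dx k) (diff1 (W k ⌊t / dt k⌋₊)) x / dx k) (fun k => dx k + dt k) M H
      (8 * V) (8 * ∫⁻ y, ‖F y‖ₑ ∂Ω.measure + 4 * ∫⁻ y, ‖h y‖ₑ ∂Ω.measure) where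
  δ_nonneg k := add_nonneg (S.dx_pos k).le (S.dt_pos k).le
  δ_lim := by simpa using S.dx_lim.add S.dt_lim
  per k t := by
    simp only [S.interp_eq]
    exact per_linInterp (S.dx_pos k) ((S.stable k).sol.per _) ((S.stable k).sol.per_fract
      (S.dx_pos k))
  bdd k x t := by
    rw [S.interp_eq]
    exact abs_linInterp_le (S.abs_le hM k _) x
  lip k t := by
    simp only [S.interp_eq]
    exact lipschitzWith_linInterp (S.dx_pos k) (S.abs_diff1_le k _)
  -- `Nat.floor` is 0 at negative arguments, so the interpolation is frozen at its initial value for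
  -- t ≤ 0.
  neg k x t ht := by
    simp only [S.interp_eq, zero_div, Nat.floor_zero,
      Nat.floor_of_nonpos (div_nonpos_of_nonpos_of_nonneg ht (S.dt_pos k).le)]
  meas k t := (measurable_stepFun _ _).div_const _
  quot k t s hs := by
    simp only [S.interp_eq]
    refine (lintegral_quotient_linInterp_le (S.dx_pos k) ((S.stable k).sol.per _)
      (S.abs_diff1_le k _) (by positivity) (S.gridNorm_diff2_le k _) hs).trans
      (ENNReal.ofReal_le_ofReal ?_)
    have h1 := S.dx_pos k
    have h2 := S.dt_pos k
    have h3 : (4 * V : ℝ) * (s + dx k) ≤ (8 * V) * (s + (dx k + dt k)) := by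
      gcongr
      · norm_num
      · linarith
    exact_mod_cast h3
  time k s t hs hst := by
    have hdt := S.dt_pos k
    simp only [S.interp_eq, linInterp_sub]
    obtain ⟨m, hm⟩ := Nat.exists_eq_add_of_le (Nat.floor_le_floor (div_le_div_of_nonneg_right hst
      hdt.le))
    rw [hm]
    -- Rounding both times down to the mesh can lengthen the interval by one step; this is the dt in
    -- the error `δ`.
    have hmt : m * dt k ≤ t - s + dt k := by
      have h1 := Nat.floor_le (div_nonneg (hs.trans hst) hdt.le)
      have h2 := Nat.lt_floor_add_one (s / dt k)
      rw [hm] at h1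
      rw [div_lt_iff₀ hdt] at h2
      rw [le_div_iff₀ hdt] at h1
      push_cast at h1
      linarith
    have hp : Ω.Per (stepFun (dx k) fun j => W k (⌊s / dt k⌋₊ + m) j - W k ⌊s / dt k⌋₊ j) :=
      ((S.stable k).sol.per (⌊s / dt k⌋₊ + m)).comp₂ ((S.stable k).sol.per ⌊s / dt k⌋₊)
        (fun a b => a - b)
    -- The constant 8V is the 4V of the second differences, doubled because the interpolation uses
    -- two neighbouring values.
    refine (lintegral_linInterp_le (S.dx_pos k) hp).trans ((mul_le_mul_right (S.time_le k _ m)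
      2).trans ?_)
    rw [← ENNReal.ofReal_ofNat 2, ← ENNReal.ofReal_mul (by norm_num)]
    refine ENNReal.ofReal_le_ofReal ?_
    have h3 : 2 * (m * dt k * (4 * V)) ≤ (8 * V : ℝ) * (t - s + (dx k + dt k)) := by
      calc _ = (8 * V : ℝ) * (m * dt k) := by ring
        _ ≤ _ := by gcongr; linarith [S.dx_pos k]
    exact_mod_cast h3
  bound_ne_top := ENNReal.add_ne_top.2 ⟨ENNReal.mul_ne_top (by norm_num) S.rep.lintegral_ne_top,
    ENNReal.mul_ne_top (by norm_num) S.rep.lintegral_deriv_ne_top⟩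
  lintegral_deriv_le k t := by
    have hdx := S.dx_pos k
    refine le_trans ?_ le_add_self
    have e : ∀ x, ‖stepFun (dx k) (diff1 (W k ⌊t / dt k⌋₊)) x / dx k‖ₑ =
        ENNReal.ofReal (1 / dx k) * ‖stepFun (dx k) (diff1 (W k ⌊t / dt k⌋₊)) x‖ₑ := fun x => by
      rw [div_eq_mul_one_div, mul_comm, enorm_mul, Real.enorm_of_nonneg (by positivity)]
    simp only [e]
    rw [lintegral_const_mul' _ _ ENNReal.ofReal_ne_top]
    have h1 := S.gridNorm_diff1_le k ⌊t / dt k⌋₊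
    simp only [gridNorm, ENNReal.ofReal_one, one_mul] at h1
    refine (mul_le_mul_right h1 _).trans (le_of_eq ?_)
    rw [mul_left_comm, ← mul_assoc (ENNReal.ofReal _) (ENNReal.ofReal _),
      ← ENNReal.ofReal_mul (by positivity), one_div_mul_cancel hdx.ne', ENNReal.ofReal_one, one_mul]
  lintegral_init_le k := by
    refine le_trans ?_ le_self_add
    simp only [S.interp_eq, zero_div, Nat.floor_zero]
    refine (lintegral_linInterp_le (S.dx_pos k) ((S.stable k).sol.per 0)).trans
      ((mul_le_mul_right (S.gridNorm_init_le k) 2).trans (le_of_eq ?_))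
    rw [← mul_assoc]
    norm_num
  tail T ε hε := by
    cases Ω with
    | line =>
      obtain ⟨R, hR⟩ := S.tail_le T hε
      refine ⟨R, .of_forall fun k t ht htT => ?_⟩
      simp only [S.interp_eq]
      refine hR k _ (le_trans ?_ htT)
      have := Nat.floor_le (div_nonneg ht (S.dt_pos k).le)
      rwa [le_div_iff₀ (S.dt_pos k)] at this
    | circle =>
      refine ⟨1, .of_forall fun k t _ _ => ?_⟩
      have : Domain.circle.measure {x : ℝ | 1 < |x|} = 0 := by
        rw [Domain.measure_circle, Measure.restrict_apply (measurableSet_lt_abs 1)]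
        convert measure_empty (μ := volume) using 2
        ext x
        simp only [mem_inter_iff, mem_Ioc, mem_empty_iff_false, iff_false, not_and]
        intro h1 h2 h3
        exact absurd (_root_.abs_le.2 ⟨by linarith, h3⟩) (not_le.2 (show 1 < |x| from h1))
      rw [Measure.restrict_eq_zero.2 this, lintegral_zero_measure]
      exact bot_le

end SchemeFamily

end ThetaScheme

/-! ### Test functions -/

namespace ThetaScheme

section

variable {Ω : Domain} {φ : ℝ → ℝ → ℝ}

lemma IsTestFunction.per (hφ : IsTestFunction Ω φ) (t : ℝ) : Ω.Per (fun x => φ x t) := by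
  rintro rfl
  exact hφ.2.2 t

lemma IsTestFunction.exists_bound_time (hφ : IsTestFunction Ω φ) :
    ∃ R : ℝ, ∀ x t, R < |t| → φ x t = 0 := by
  cases Ω with
  | line =>
    obtain ⟨R, hR⟩ := hφ.2
    exact ⟨R, fun x t ht => hR x t (.inr ht)⟩
  | circle => exact hφ.2.1

lemma IsTestFunction.exists_bound (hφ : IsTestFunction Ω φ) : ∃ C, ∀ x t, |φ x t| ≤ C := by
  have key : ∀ R : ℝ, ∃ C, ∀ x t, |x| ≤ R → |t| ≤ R → |φ x t| ≤ C := fun R => by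
    obtain ⟨C, hC⟩ := ((isCompact_Icc (a := -R) (b := R)).prod
      (isCompact_Icc (a := -R) (b := R))).exists_bound_of_continuousOn hφ.1.continuous.continuousOn
    exact ⟨C, fun x t hx ht => hC (x, t) ⟨abs_le.1 hx, abs_le.1 ht⟩⟩
  cases Ω with
  | line =>
    obtain ⟨R, hR⟩ := hφ.2
    obtain ⟨C, hC⟩ := key R
    refine ⟨max C 0, fun x t => ?_⟩
    by_cases h : R < |x| ∨ R < |t|
    · rw [hR x t h]
      simp
    · rw [not_or, not_lt, not_lt] at h
      exact (hC x t h.1 h.2).trans (le_max_left _ _)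
  | circle =>
    obtain ⟨⟨R, hR⟩, hp⟩ := hφ.2
    obtain ⟨C, hC⟩ := key (max 1 R)
    refine ⟨max C 0, fun x t => ?_⟩
    by_cases h : R < |t|
    · rw [hR x t h]
      simp
    · have e : φ x t = φ (Int.fract x) t := by
        have := (hp t).sub_int_mul_eq ⌊x⌋ (x := x)
        rw [mul_one] at this
        exact this.symm
      rw [e]
      refine (hC _ t ?_ ((not_lt.1 h).trans (le_max_right _ _))).trans (le_max_left _ _)
      rw [abs_of_nonneg (Int.fract_nonneg x)]
      exact (Int.fract_lt_one x).le.trans (le_max_left _ _)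

lemma IsTestFunction.hasFDerivAt (hφ : IsTestFunction Ω φ) (p : ℝ × ℝ) :
    HasFDerivAt (fun p : ℝ × ℝ => φ p.1 p.2) (fderiv ℝ (fun p : ℝ × ℝ => φ p.1 p.2) p) p :=
  (hφ.1.differentiable (by simp) p).hasFDerivAt

lemma IsTestFunction.hasDerivAt_space' (hφ : IsTestFunction Ω φ) (x t : ℝ) :
    HasDerivAt (fun y => φ y t) (fderiv ℝ (fun p : ℝ × ℝ => φ p.1 p.2) (x, t) (1, 0)) x :=
  HasFDerivAt.comp_hasDerivAt (f := fun y => (y, t)) x (hφ.hasFDerivAt (x, t))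
    ((hasDerivAt_id x).prodMk (hasDerivAt_const x t))

lemma IsTestFunction.hasDerivAt_time' (hφ : IsTestFunction Ω φ) (x t : ℝ) :
    HasDerivAt (fun s => φ x s) (fderiv ℝ (fun p : ℝ × ℝ => φ p.1 p.2) (x, t) (0, 1)) t :=
  HasFDerivAt.comp_hasDerivAt (f := fun s => (x, s)) t (hφ.hasFDerivAt (x, t))
    ((hasDerivAt_const t x).prodMk (hasDerivAt_id t))

lemma IsTestFunction.hasDerivAt_space (hφ : IsTestFunction Ω φ) (x t : ℝ) :
    HasDerivAt (fun y => φ y t) (deriv (fun y => φ y t) x) x :=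
  (hφ.hasDerivAt_space' x t).differentiableAt.hasDerivAt

lemma IsTestFunction.hasDerivAt_time (hφ : IsTestFunction Ω φ) (x t : ℝ) :
    HasDerivAt (fun s => φ x s) (deriv (fun s => φ x s) t) t :=
  (hφ.hasDerivAt_time' x t).differentiableAt.hasDerivAt

lemma IsTestFunction.deriv_space (hφ : IsTestFunction Ω φ) :
    IsTestFunction Ω (fun x t => deriv (fun y => φ y t) x) := by
  refine ⟨?_, ?_⟩
  · have e : (fun p : ℝ × ℝ => deriv (fun y => φ y p.2) p.1) =
        fun p => fderiv ℝ (fun p : ℝ × ℝ => φ p.1 p.2) p (1, 0) :=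
      funext fun p => (hφ.hasDerivAt_space' p.1 p.2).deriv
    rw [e]
    exact (hφ.1.fderiv_right (m := ((⊤ : ℕ∞) : WithTop ℕ∞)) (by simp)).clm_apply contDiff_const
  · have h0 : ∀ x t, (∀ᶠ y in 𝓝 x, φ y t = 0) → deriv (fun y => φ y t) x = 0 := fun x t h => by
      rw [Filter.EventuallyEq.deriv_eq (f := fun _ => 0) h, deriv_const]
    cases Ω with
    | line =>
      obtain ⟨R, hR⟩ := hφ.2
      refine ⟨R, fun x t hxt => h0 x t ?_⟩
      rcases hxt with h | h
      · filter_upwards [(isOpen_lt continuous_const continuous_abs).mem_nhds h] with y hy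
        exact hR y t (.inl hy)
      · exact .of_forall fun y => hR y t (.inr h)
    | circle =>
      obtain ⟨⟨R, hR⟩, hp⟩ := hφ.2
      refine ⟨⟨R, fun x t h => h0 x t (.of_forall fun y => hR y t h)⟩, fun t x => ?_⟩
      have e : (fun y => φ (y + 1) t) = fun y => φ y t := funext (hp t)
      have := deriv_comp_add_const (fun y => φ y t) 1 x
      rw [e] at this
      exact this.symm

lemma IsTestFunction.deriv_time (hφ : IsTestFunction Ω φ) :
    IsTestFunction Ω (fun x t => deriv (fun s => φ x s) t) := by
  refine ⟨?_, ?_⟩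
  · have e : (fun p : ℝ × ℝ => deriv (fun s => φ p.1 s) p.2) =
        fun p => fderiv ℝ (fun p : ℝ × ℝ => φ p.1 p.2) p (0, 1) :=
      funext fun p => (hφ.hasDerivAt_time' p.1 p.2).deriv
    rw [e]
    exact (hφ.1.fderiv_right (m := ((⊤ : ℕ∞) : WithTop ℕ∞)) (by simp)).clm_apply contDiff_const
  · have h0 : ∀ x t, (∀ᶠ s in 𝓝 t, φ x s = 0) → deriv (fun s => φ x s) t = 0 := fun x t h => by
      rw [Filter.EventuallyEq.deriv_eq (f := fun _ => 0) h, deriv_const]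
    have h1 : ∀ {R t : ℝ}, R < |t| → ∀ᶠ s in 𝓝 t, R < |s| := fun h =>
      (isOpen_lt continuous_const continuous_abs).mem_nhds h
    cases Ω with
    | line =>
      obtain ⟨R, hR⟩ := hφ.2
      refine ⟨R, fun x t hxt => h0 x t ?_⟩
      rcases hxt with h | h
      · exact .of_forall fun s => hR x s (.inl h)
      · exact (h1 h).mono fun s hs => hR x s (.inr hs)
    | circle =>
      obtain ⟨⟨R, hR⟩, hp⟩ := hφ.2
      refine ⟨⟨R, fun x t h => h0 x t ((h1 h).mono fun s hs => hR x s hs)⟩, fun t x => ?_⟩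
      simp only [show (fun s => φ (x + 1) s) = fun s => φ x s from funext fun s => hp s x]

end

/-- Quantitative data of a test function: up to unit shifts in space it is supported in `K`, it is
supported in `[-R,R]` in time, and `C` bounds it together with its first derivatives. -/
structure TestData (Ω : Domain) (φ : ℝ → ℝ → ℝ) (K : Set ℝ) (R C : ℝ) : Prop where
  test : IsTestFunction Ω φ
  measurableSet : MeasurableSet K
  measure_ne_top : Ω.measure K ≠ ⊤
  R_nonneg : 0 ≤ R
  space : ∀ x t s, x ∉ K → |s| ≤ 1 → φ (x + s) t = 0
  time : ∀ x t, R < |t| → φ x t = 0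
  bound : ∀ x t, |φ x t| ≤ C
  bound_space : ∀ x t s, |φ (x + s) t - φ x t| ≤ C * |s|
  bound_time : ∀ x t s, |φ x (t + s) - φ x t| ≤ C * |s|
  bound_deriv_time : ∀ x t, |deriv (fun s => φ x s) t| ≤ C
  bound_deriv_space : ∀ x t, |deriv (fun y => φ y t) x| ≤ C

lemma IsTestFunction.exists_testData {Ω : Domain} {φ : ℝ → ℝ → ℝ} (hφ : IsTestFunction Ω φ) :
    ∃ K R C, TestData Ω φ K R C := by
  obtain ⟨C₀, h0⟩ := hφ.exists_bound
  obtain ⟨C₁, h1⟩ := hφ.deriv_space.exists_bound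
  obtain ⟨C₂, h2⟩ := hφ.deriv_time.exists_bound
  obtain ⟨R, hR⟩ := hφ.exists_bound_time
  obtain ⟨K, hK1, hK2, hK3⟩ : ∃ K : Set ℝ, MeasurableSet K ∧ Ω.measure K ≠ ⊤ ∧
      ∀ x t s, x ∉ K → |s| ≤ 1 → φ (x + s) t = 0 := by
    cases Ω with
    | line =>
      obtain ⟨r, hr⟩ := hφ.2
      -- The margin 1 makes φ vanish also after the shifts by |s| ≤ 1 that difference quotients
      -- produce.
      refine ⟨Icc (-(r + 1)) (r + 1), measurableSet_Icc, ?_, fun x t s hx hs => hr _ _ (.inl ?_)⟩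
      · rw [Domain.measure_line, Real.volume_Icc]
        exact ENNReal.ofReal_ne_top
      · have h3 : r + 1 < |x| := not_le.1 fun h => hx (abs_le.1 h)
        have := abs_sub_abs_le_abs_sub x (x + s)
        rw [show x - (x + s) = -s by ring, abs_neg] at this
        linarith
    | circle =>
      refine ⟨univ, MeasurableSet.univ, ?_, fun x t s hx => absurd (mem_univ x) hx⟩
      rw [Domain.measure_circle, Measure.restrict_apply_univ, Real.volume_Ioc]
      exact ENNReal.ofReal_ne_top
  have hd : ∀ {f : ℝ → ℝ} {D : ℝ} (x s : ℝ), (∀ y, DifferentiableAt ℝ f y) →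
      (∀ y, |deriv f y| ≤ D) → |f (x + s) - f x| ≤ D * |s| := fun {f D} x s hf hD => by
    have := convex_univ.norm_image_sub_le_of_norm_deriv_le (fun y _ => hf y)
      (fun y _ => hD y) (mem_univ x) (mem_univ (x + s))
    simpa using this
  set C := max C₀ (max C₁ C₂)
  have e0 : C₀ ≤ C := le_max_left _ _
  have e1 : C₁ ≤ C := (le_max_left _ _).trans (le_max_right _ _)
  have e2 : C₂ ≤ C := (le_max_right _ _).trans (le_max_right _ _)
  exact ⟨K, max R 0, C, hφ, hK1, hK2, le_max_right _ _,
    hK3, fun x t ht => hR x t ((le_max_left _ _).trans_lt ht),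
    fun x t => (h0 x t).trans e0,
    fun x t s => hd x s (fun y => (hφ.hasDerivAt_space y t).differentiableAt)
      (fun y => (h1 y t).trans e1),
    fun x t s => hd t s (fun r => (hφ.hasDerivAt_time x r).differentiableAt)
      (fun r => (h2 x r).trans e2),
    fun x t => (h2 x t).trans e2, fun x t => (h1 x t).trans e1⟩

end ThetaScheme

/-! ### The weak form of the scheme -/

namespace ThetaScheme

lemma integrable_of_support {μ : Measure ℝ} {f : ℝ → ℝ} {K : Set ℝ} {c : ℝ} (hf : Measurable f)
    (hK : MeasurableSet K) (hμ : μ K ≠ ⊤) (hc : ∀ x, |f x| ≤ c) (h0 : ∀ x, x ∉ K → f x = 0) :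
    Integrable f μ := by
  have h1 : IntegrableOn f K μ := by
    refine Measure.integrableOn_of_bounded hμ hf.aestronglyMeasurable (M := c) ?_
    exact ae_of_all _ fun x => hc x
  rw [← integrable_indicator_iff hK] at h1
  refine h1.congr (ae_of_all _ fun x => ?_)
  by_cases hx : x ∈ K
  · rw [indicator_of_mem hx]
  · rw [indicator_of_notMem hx, h0 x hx]

lemma measurable_integral_left {Ω : Domain} {f : ℝ → ℝ → ℝ}
    (hf : Measurable (fun p : ℝ × ℝ => f p.1 p.2)) :
    Measurable (fun t => ∫ x, f x t ∂Ω.measure) :=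
  (StronglyMeasurable.integral_prod_left (f := f) hf.stronglyMeasurable).measurable

lemma measurable_grid (dx dt : ℝ) (Q : ℕ → ℤ → ℝ) :
    Measurable (fun p : ℝ × ℝ => stepFun dx (Q ⌊p.2 / dt⌋₊) p.1) := by
  have h1 : Measurable (fun p : ℝ × ℝ => ((⌊p.2 / dt⌋₊ : ℕ), (⌊p.1 / dx⌋ : ℤ))) :=
    (Nat.measurable_floor.comp (measurable_snd.div_const dt)).prodMk
      (Int.measurable_floor.comp (measurable_fst.div_const dx))
  exact (measurable_of_countable (fun q : ℕ × ℤ => Q q.1 q.2)).comp h1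

lemma abs_integral_le_of_support {μ : Measure ℝ} {f : ℝ → ℝ} {K : Set ℝ} {c : ℝ}
    (hμ : μ K ≠ ⊤) (hc : ∀ x, |f x| ≤ c)
    (h0 : ∀ x, x ∉ K → f x = 0) : |∫ x, f x ∂μ| ≤ c * μ.real K := by
  rw [← setIntegral_eq_integral_of_forall_compl_eq_zero h0]
  exact norm_setIntegral_le_of_norm_le_const (f := f) (lt_top_iff_ne_top.2 hμ) fun x _ => hc x

/-- The integrand of the discrete weak form of `B(w) w_xx`, tested with `f`. -/
noncomputable def fluxIntegrand (B : ℝ → ℝ) (dx : ℝ) (a : ℤ → ℝ) (f : ℝ → ℝ) (x : ℝ) : ℝ :=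
  B (stepFun dx a (x + dx)) * ((f (x + dx) - f x) / dx) * (stepFun dx (diff1 a) x / dx) +
    (B (stepFun dx a (x + dx)) - B (stepFun dx a x)) / dx * f x * (stepFun dx (diff1 a) x / dx)

namespace StableScheme

variable {Ω : Domain} {B : ℝ → ℝ} {w₀ : ℝ → ℝ} {θ dx dt : ℝ} {W : ℕ → ℤ → ℝ}

/-- Discrete integration by parts in space. -/
lemma integral_flux (h : StableScheme Ω B w₀ θ dx dt W) (hB : Continuous B) (n : ℕ) {f : ℝ → ℝ}
    (pf : Ω.Per f) (hf : Integrable f Ω.measure)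
    (hf' : Integrable (fun x => f (x + dx)) Ω.measure) :
    ∫ x, (stepFun dx (W (n + 1)) x - stepFun dx (W n) x) / dt * f x ∂Ω.measure =
      -∫ x, fluxIntegrand B dx (thetaLevel θ W n) f x ∂Ω.measure := by
  have hdx := h.dx_pos
  set Θ := thetaLevel θ W n with hΘ
  have pΘ : Ω.Per (stepFun dx Θ) := h.sol.per_thetaLevel n
  have pd := Domain.Per.diff1 hdx pΘ
  obtain ⟨K, hK⟩ := h.bounded_diff1 n
  set Z := stepFun dx (diff1 Θ) with hZ
  have mZ : Measurable Z := measurable_stepFun dx _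
  have mB : Measurable (fun x => B (stepFun dx Θ x)) := hB.measurable.comp (measurable_stepFun dx _)
  have hBb : ∀ s, ‖B s‖ ≤ 1 := fun s => by
    rw [Real.norm_eq_abs, abs_of_nonneg (h.coeff s).1]
    exact (h.coeff s).2
  have key : ∀ (g : ℝ → ℝ) (a b : ℝ), Integrable g Ω.measure →
      Integrable (fun x => B (stepFun dx Θ (x + a)) * (g x * Z (x + b))) Ω.measure :=
    fun g a b hg => by
    refine (hg.mul_bdd (c := K) (mZ.comp (measurable_add_const b)).aestronglyMeasurable
      (ae_of_all _ fun x => hK _)).bdd_mul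
      (mB.comp (measurable_add_const a)).aestronglyMeasurable (c := 1)
      (ae_of_all _ fun x => hBb _)
  have i1 := key f 0 0 hf
  have i2 := key f 0 (-dx) hf
  have i3 := key _ dx 0 hf'
  simp only [add_zero, ← sub_eq_add_neg] at i1 i2 i3
  have pBΘ := pΘ.comp B
  -- Translating only the term with the backward slope is the summation by parts.
  have hsh : ∫ x, B (stepFun dx Θ x) * (f x * Z (x - dx)) ∂Ω.measure =
      ∫ x, B (stepFun dx Θ (x + dx)) * (f (x + dx) * Z x) ∂Ω.measure := by
    have := Domain.integral_shift (pBΘ.comp₂ (pf.comp₂ (pd.shift (-dx)) (fun u v => u * v))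
      (fun u v => u * v)) dx
    simp only [← sub_eq_add_neg, add_sub_cancel_right] at this
    exact this.symm
  have e1 : ∀ x, (stepFun dx (W (n + 1)) x - stepFun dx (W n) x) / dt * f x =
      1 / dx ^ 2 * (B (stepFun dx Θ x) * (f x * Z x) - B (stepFun dx Θ x) * (f x * Z (x - dx))) :=
    fun x => by
    have h1 := h.sol.step_eq h.dt_pos n ⌊x / dx⌋
    have h2 : Z (x - dx) = diff1 Θ (⌊x / dx⌋ - 1) := by
      rw [hZ, stepFun, floor_sub_div hdx]
    have h3 : diff2 Θ ⌊x / dx⌋ = Z x - Z (x - dx) := by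
      rw [h2]
      simp only [hZ, stepFun, diff1, diff2, sub_add_cancel]
      ring
    rw [show stepFun dx (W (n + 1)) x - stepFun dx (W n) x =
      W (n + 1) ⌊x / dx⌋ - W n ⌊x / dx⌋ from rfl, h1, ← hΘ, h3]
    have := h.dt_pos
    simp only [stepFun]
    field_simp
  -- The discrete product rule: the forward difference of B·f, with the coefficient at x + dx in
  -- front of the difference of `f`.
  have e2 : ∀ x, fluxIntegrand B dx Θ f x =
      1 / dx ^ 2 * (B (stepFun dx Θ (x + dx)) * (f (x + dx) * Z x) -
        B (stepFun dx Θ x) * (f x * Z x)) := fun x => by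
    simp only [fluxIntegrand, ← hZ]
    field_simp
    ring
  simp only [e1, e2]
  rw [integral_const_mul, integral_const_mul, integral_sub i1 i2, integral_sub i3 i1, hsh]
  ring

/-- The scheme in weak form. For negative times the grid function is extended by its initial
value, so that no boundary terms arise. -/
lemma integral_weak (h : StableScheme Ω B w₀ θ dx dt W) (hB : Continuous B) (hdx1 : dx ≤ 1)
    {M : ℝ} (hM : ∀ n j, |W n j| ≤ M) {φ : ℝ → ℝ → ℝ} {K : Set ℝ} {R C : ℝ}
    (D : TestData Ω φ K R C) :
    ∫ t, (∫ x, stepFun dx (W ⌊t / dt⌋₊) x * ((φ x t - φ x (t - dt)) / dt) ∂Ω.measure) =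
      ∫ t in Ioi (0 : ℝ), (∫ x, fluxIntegrand B dx (thetaLevel θ W ⌊t / dt⌋₊) (fun x => φ x t) x
        ∂Ω.measure) := by
  have hdx := h.dx_pos
  have hdt := h.dt_pos
  have mφ := D.test.1.continuous.measurable
  have mS := measurable_grid dx dt W
  have hM0 : 0 ≤ M := (abs_nonneg _).trans (hM 0 0)
  have z0 : ∀ x t, x ∉ K → φ x t = 0 := fun x t hx => by
    simpa using D.space x t 0 hx (by simp)
  have mx : ∀ t, Measurable (fun x => φ x t) := fun t =>
    mφ.comp (measurable_id.prodMk measurable_const)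
  have hprod : ∀ (a b : ℝ) , Measurable (fun p : ℝ × ℝ =>
      stepFun dx (W ⌊(p.2 + a) / dt⌋₊) p.1 * φ p.1 (p.2 + b)) := fun a b =>
    (mS.comp (measurable_fst.prodMk (measurable_snd.add_const a))).mul
      (mφ.comp (measurable_fst.prodMk (measurable_snd.add_const b)))
  have hb : ∀ (a b x t : ℝ), |stepFun dx (W ⌊(t + a) / dt⌋₊) x * φ x (t + b)| ≤ M * C :=
    fun a b x t => by
    rw [abs_mul]
    exact mul_le_mul (hM _ _) (D.bound _ _) (abs_nonneg _) hM0
  have hix : ∀ (a b t : ℝ), Integrable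
      (fun x => stepFun dx (W ⌊(t + a) / dt⌋₊) x * φ x (t + b)) Ω.measure := fun a b t =>
    integrable_of_support ((hprod a b).comp (measurable_id.prodMk measurable_const))
      D.measurableSet D.measure_ne_top (fun x => hb a b x t)
      (fun x hx => by rw [z0 x _ hx, mul_zero])
  have hit : ∀ a b : ℝ, Integrable
      (fun t => ∫ x, stepFun dx (W ⌊(t + a) / dt⌋₊) x * φ x (t + b) ∂Ω.measure) := fun a b => by
    refine integrable_of_support (K := Icc (-(R + |b|)) (R + |b|))
      (measurable_integral_left (hprod a b)) measurableSet_Icc (by simp)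
      (fun t => abs_integral_le_of_support D.measure_ne_top
      (fun x => hb a b x t) (fun x hx => by rw [z0 x _ hx, mul_zero])) fun t ht => ?_
    have h1 : R + |b| < |t| := not_le.1 fun h => ht (_root_.abs_le.1 h)
    have h2 : R < |t + b| := by
      have := abs_sub_abs_le_abs_sub t (-b)
      rw [sub_neg_eq_add, abs_neg] at this
      linarith
    simp only [D.time _ _ h2, mul_zero, integral_zero]
  have i1 := hit 0 0
  have i2 := hit 0 (-dt)
  have i3 := hit dt 0
  -- Summation by parts in time is a translation by dt over the whole time axis, hence without
  -- boundary terms.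
  have s2 : ∫ t, (∫ x, stepFun dx (W ⌊(t + 0) / dt⌋₊) x * φ x (t + -dt) ∂Ω.measure) =
      ∫ t, (∫ x, stepFun dx (W ⌊(t + dt) / dt⌋₊) x * φ x (t + 0) ∂Ω.measure) := by
    rw [← integral_add_right_eq_self _ dt]
    simp only [add_zero, add_neg_cancel_right]
  have e1 : ∀ t, ∫ x, stepFun dx (W ⌊t / dt⌋₊) x * ((φ x t - φ x (t - dt)) / dt) ∂Ω.measure =
      1 / dt * ((∫ x, stepFun dx (W ⌊(t + 0) / dt⌋₊) x * φ x (t + 0) ∂Ω.measure) -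
        ∫ x, stepFun dx (W ⌊(t + 0) / dt⌋₊) x * φ x (t + -dt) ∂Ω.measure) := fun t => by
    rw [← integral_sub (hix 0 0 t) (hix 0 (-dt) t), ← integral_const_mul]
    congr 1
    funext x
    simp only [add_zero, ← sub_eq_add_neg]
    ring
  have e2 : ∀ t, ∫ x, (stepFun dx (W ⌊(t + dt) / dt⌋₊) x - stepFun dx (W ⌊t / dt⌋₊) x) / dt *
      φ x t ∂Ω.measure =
      1 / dt * ((∫ x, stepFun dx (W ⌊(t + dt) / dt⌋₊) x * φ x (t + 0) ∂Ω.measure) -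
        ∫ x, stepFun dx (W ⌊(t + 0) / dt⌋₊) x * φ x (t + 0) ∂Ω.measure) := fun t => by
    rw [← integral_sub (hix dt 0 t) (hix 0 0 t), ← integral_const_mul]
    congr 1
    funext x
    simp only [add_zero]
    ring
  have e3 : ∫ t, (∫ x, stepFun dx (W ⌊t / dt⌋₊) x * ((φ x t - φ x (t - dt)) / dt) ∂Ω.measure) =
      -∫ t, (∫ x, (stepFun dx (W ⌊(t + dt) / dt⌋₊) x - stepFun dx (W ⌊t / dt⌋₊) x) / dt *
      φ x t ∂Ω.measure) := by
    simp only [e1, e2]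
    rw [integral_const_mul, integral_const_mul, integral_sub i1 i2, integral_sub i3 i1, s2]
    ring
  -- For t < 0 also t + dt < dt, so both levels are 0 by the convention for `Nat.floor` and the time
  -- difference vanishes.
  have e4 : ∀ t, t ∉ Ici (0 : ℝ) →
      ∫ x, (stepFun dx (W ⌊(t + dt) / dt⌋₊) x - stepFun dx (W ⌊t / dt⌋₊) x) / dt *
      φ x t ∂Ω.measure = 0 := fun t ht => by
    have ht : t < 0 := not_le.1 ht
    have f1 : ⌊t / dt⌋₊ = 0 := Nat.floor_of_nonpos (div_nonpos_of_nonpos_of_nonneg ht.le hdt.le)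
    have f2 : ⌊(t + dt) / dt⌋₊ = 0 := by
      rw [Nat.floor_eq_zero, div_lt_one hdt]
      linarith
    simp [f1, f2]
  rw [e3, ← setIntegral_eq_integral_of_forall_compl_eq_zero e4, integral_Ici_eq_integral_Ioi,
    ← integral_neg]
  refine setIntegral_congr_fun measurableSet_Ioi fun t (ht : 0 < t) => ?_
  have f2 : ⌊(t + dt) / dt⌋₊ = ⌊t / dt⌋₊ + 1 := by
    rw [add_div, div_self hdt.ne', Nat.floor_add_one (by positivity)]
  rw [f2, h.integral_flux hB _ (D.test.per t), neg_neg]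
  · exact integrable_of_support (mx t) D.measurableSet D.measure_ne_top (fun x => D.bound x t)
      (fun x hx => z0 x t hx)
  · exact integrable_of_support ((mx t).comp (measurable_add_const dx)) D.measurableSet
      D.measure_ne_top (fun x => D.bound _ t)
      (fun x hx => D.space x t dx hx (by rwa [abs_of_pos hdx]))

end StableScheme

end ThetaScheme

/-! ### Passage to the limit in the grid functions -/

namespace ThetaScheme

/-- A uniform Lipschitz bound upgrades L¹ convergence to pointwise convergence through
`enorm_le_of_lipschitzWith`. It is needed for time levels that move with k. -/
lemma tendsto_zero_of_lintegral {Ω : Domain} {f : ℕ → ℝ → ℝ} {K : NNReal}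
    (hf : ∀ k, LipschitzWith K (f k)) (pf : ∀ k, Ω.Per (f k))
    (hlim : Tendsto (fun k => ∫⁻ x, ‖f k x‖ₑ ∂Ω.measure) atTop (𝓝 0)) (x : ℝ) :
    Tendsto (fun k => f k x) atTop (𝓝 0) := by
  rw [Metric.tendsto_atTop']
  intro ε hε
  set η := min 1 (ε / (4 * (K + 1))) with hη
  have hη0 : 0 < η := lt_min one_pos (by positivity)
  obtain ⟨N, hN⟩ := eventually_atTop.1 (hlim.eventually (ge_mem_nhds
    (ENNReal.ofReal_pos.2 (show 0 < η * (ε / 2) by positivity))))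
  refine ⟨N, fun n hn => ?_⟩
  have h2 := (enorm_le_of_lipschitzWith (hf n) (pf n) hη0 (min_le_left _ _) x).trans
    (add_le_add (hN n hn.le) le_rfl)
  rw [Real.enorm_eq_ofReal_abs, ← ENNReal.ofReal_mul hη0.le,
    ← ENNReal.ofReal_add (by positivity) (by positivity),
    ENNReal.ofReal_le_ofReal_iff (by positivity), ← mul_add, mul_le_mul_iff_right₀ hη0] at h2
  have h3 : (K : ℝ) * η ≤ ε / 4 := by
    calc (K : ℝ) * η ≤ (K + 1) * (ε / (4 * (K + 1))) := by
          gcongr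
          · linarith
          · exact min_le_right _ _
      _ = ε / 4 := by field_simp
  rw [Real.dist_eq, sub_zero]
  linarith

lemma tendsto_integral_of_support {μ : Measure ℝ} {a : ℕ → ℝ → ℝ} {b : ℝ → ℝ} {K : Set ℝ} {c : ℝ}
    (ha : ∀ k, Measurable (a k)) (hK : MeasurableSet K) (hμ : μ K ≠ ⊤)
    (hc : ∀ k x, |a k x| ≤ c) (h0 : ∀ k x, x ∉ K → a k x = 0)
    (hlim : ∀ᵐ x ∂μ, Tendsto (fun k => a k x) atTop (𝓝 (b x))) :
    Tendsto (fun k => ∫ x, a k x ∂μ) atTop (𝓝 (∫ x, b x ∂μ)) := by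
  refine tendsto_integral_of_dominated_convergence (K.indicator fun _ => c)
    (fun k => (ha k).aestronglyMeasurable) ?_ (fun k => ae_of_all _ fun x => ?_) hlim
  · rw [integrable_indicator_iff hK]
    exact integrableOn_const hμ
  · by_cases hx : x ∈ K
    · rw [indicator_of_mem hx]
      exact hc k x
    · rw [indicator_of_notMem hx, h0 k x hx, norm_zero]

/-- Products of boundedly convergent coefficients and `L¹`-convergent bounded functions. -/
lemma tendsto_integral_mul {μ : Measure ℝ} {a f : ℕ → ℝ → ℝ} {b g : ℝ → ℝ} {K : Set ℝ} {c H : ℝ}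
    (ha : ∀ k, Measurable (a k)) (hK : MeasurableSet K) (hμ : μ K ≠ ⊤)
    (hc : ∀ k x, |a k x| ≤ c) (h0 : ∀ k x, x ∉ K → a k x = 0)
    (hlim : ∀ x, Tendsto (fun k => a k x) atTop (𝓝 (b x)))
    (hf : ∀ k, Measurable (f k)) (hg : Measurable g) (hfH : ∀ k x, |f k x| ≤ H)
    (hgH : ∀ x, |g x| ≤ H)
    (hfg : Tendsto (fun k => ∫⁻ x, ‖f k x - g x‖ₑ ∂μ) atTop (𝓝 0)) :
    Tendsto (fun k => ∫ x, a k x * f k x ∂μ) atTop (𝓝 (∫ x, b x * g x ∂μ)) := by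
  have hc0 : 0 ≤ c := (abs_nonneg _).trans (hc 0 0)
  have hb : ∀ {k x} {y : ℝ}, |y| ≤ H → |a k x * y| ≤ c * H := fun {k x y} hy => by
    rw [abs_mul]
    exact mul_le_mul (hc k x) hy (abs_nonneg _) hc0
  have h1 : Tendsto (fun k => ∫ x, a k x * g x ∂μ) atTop (𝓝 (∫ x, b x * g x ∂μ)) :=
    tendsto_integral_of_support (fun k => (ha k).mul hg) hK hμ (fun k x => hb (hgH x))
      (fun k x hx => by rw [h0 k x hx, zero_mul]) (ae_of_all _ fun x => (hlim x).mul_const _)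
  -- Splitting off the fixed factor g leaves dominated convergence for a_k g and, here, a bounded
  -- coefficient times an L¹ null sequence.
  have h2 : Tendsto (fun k => ∫ x, a k x * (f k x - g x) ∂μ) atTop (𝓝 0) := by
    rw [tendsto_zero_iff_enorm_tendsto_zero]
    have h3 := ENNReal.Tendsto.const_mul hfg (.inr (ENNReal.ofReal_ne_top (r := c)))
    rw [mul_zero] at h3
    refine tendsto_of_tendsto_of_tendsto_of_le_of_le tendsto_const_nhds h3 (fun _ => bot_le)
      fun k => ?_
    refine (enorm_integral_le_lintegral_enorm _).trans ?_
    rw [← lintegral_const_mul' _ _ ENNReal.ofReal_ne_top]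
    refine lintegral_mono fun x => ?_
    dsimp only
    rw [enorm_mul]
    gcongr
    rw [Real.enorm_eq_ofReal_abs]
    exact ENNReal.ofReal_le_ofReal (hc k x)
  have h4 := h1.add h2
  rw [add_zero] at h4
  refine h4.congr fun k => ?_
  have i1 : Integrable (fun x => a k x * g x) μ :=
    integrable_of_support ((ha k).mul hg) hK hμ (fun x => hb (hgH x))
      (fun x hx => by rw [h0 k x hx, zero_mul])
  have i2 : Integrable (fun x => a k x * f k x) μ :=
    integrable_of_support ((ha k).mul (hf k)) hK hμ (fun x => hb (hfH k x))
      (fun x hx => by rw [h0 k x hx, zero_mul])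
  have e : ∀ x, a k x * (f k x - g x) = a k x * f k x - a k x * g x := fun x => by ring
  simp only [e]
  rw [integral_sub i2 i1]
  ring

/-- Hadamard's representation of difference quotients. -/
lemma exists_slope {B : ℝ → ℝ} (hB : ContDiff ℝ 1 B) : ∃ q : ℝ × ℝ → ℝ, Continuous q ∧
    (∀ a b, B b - B a = q (a, b) * (b - a)) ∧ ∀ a, q (a, a) = deriv B a := by
  have hc : Continuous (deriv B) := hB.continuous_deriv le_rfl
  refine ⟨fun p => ∫ s in (0 : ℝ)..1, deriv B (p.1 + s * (p.2 - p.1)), ?_, fun a b => ?_,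
    fun a => ?_⟩
  · refine intervalIntegral.continuous_parametric_intervalIntegral_of_continuous' ?_ 0 1
    exact hc.comp (by fun_prop)
  · have h1 : ∀ s ∈ uIcc (0 : ℝ) 1, HasDerivAt (fun s => B (a + s * (b - a)))
        (deriv B (a + s * (b - a)) * (b - a)) s := fun s _ => by
      have h2 : HasDerivAt (fun s : ℝ => a + s * (b - a)) (b - a) s := by
        simpa using ((hasDerivAt_id s).mul_const (b - a)).const_add a
      exact (hB.differentiable one_ne_zero _).hasDerivAt.comp s h2
    have h3 := intervalIntegral.integral_eq_sub_of_hasDerivAt h1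
      (Continuous.intervalIntegrable ((hc.comp (by fun_prop)).mul continuous_const) _ _)
    rw [intervalIntegral.integral_mul_const] at h3
    rw [h3]
    simp
  · simp

namespace SchemeFamily

variable {Ω : Domain} {B w₀ F h : ℝ → ℝ} {H V : NNReal} {θ : ℝ} {dx dt : ℕ → ℝ}
  {W : ℕ → ℕ → ℤ → ℝ}

lemma stepFun_thetaLevel (θ d : ℝ) (W : ℕ → ℤ → ℝ) (n : ℕ) (x : ℝ) :
    stepFun d (thetaLevel θ W n) x = θ * stepFun d (W (n + 1)) x + (1 - θ) * stepFun d (W n) x :=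
  rfl

lemma stepFun_diff1_thetaLevel (θ d : ℝ) (W : ℕ → ℤ → ℝ) (n : ℕ) (x : ℝ) :
    stepFun d (diff1 (thetaLevel θ W n)) x =
      θ * stepFun d (diff1 (W (n + 1))) x + (1 - θ) * stepFun d (diff1 (W n)) x := by
  simp only [stepFun, diff1, thetaLevel]
  ring

lemma theta_mem (S : SchemeFamily Ω B w₀ F h H V θ dx dt W) : 0 ≤ θ ∧ θ ≤ 1 := (S.stable 0).theta

lemma abs_convex_le {θ a b c : ℝ} (hθ : 0 ≤ θ ∧ θ ≤ 1) (ha : |a| ≤ c) (hb : |b| ≤ c) :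
    |θ * a + (1 - θ) * b| ≤ c := by
  refine (abs_add_le _ _).trans ?_
  rw [abs_mul, abs_mul, abs_of_nonneg hθ.1, abs_of_nonneg (sub_nonneg.2 hθ.2)]
  calc _ ≤ θ * c + (1 - θ) * c := add_le_add (mul_le_mul_of_nonneg_left ha hθ.1)
        (mul_le_mul_of_nonneg_left hb (sub_nonneg.2 hθ.2))
    _ = c := by ring

lemma abs_thetaLevel_le (S : SchemeFamily Ω B w₀ F h H V θ dx dt W) {M : ℝ} (hM : ∀ x, |F x| ≤ M)
    (k n : ℕ) (x : ℝ) : |stepFun (dx k) (thetaLevel θ (W k) n) x| ≤ M :=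
  abs_convex_le S.theta_mem (S.abs_le hM k _ _) (S.abs_le hM k _ _)

lemma abs_diff1_thetaLevel_le (S : SchemeFamily Ω B w₀ F h H V θ dx dt W) (k n : ℕ) (x : ℝ) :
    |stepFun (dx k) (diff1 (thetaLevel θ (W k) n)) x| ≤ H * dx k := by
  rw [stepFun_diff1_thetaLevel]
  exact abs_convex_le S.theta_mem (S.abs_diff1_le k _ _) (S.abs_diff1_le k _ _)

lemma abs_deriv_thetaLevel_le (S : SchemeFamily Ω B w₀ F h H V θ dx dt W) (k n : ℕ) (x : ℝ) :
    |stepFun (dx k) (diff1 (thetaLevel θ (W k) n)) x / dx k| ≤ H := by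
  rw [abs_div, abs_of_pos (S.dx_pos k), div_le_iff₀ (S.dx_pos k)]
  exact S.abs_diff1_thetaLevel_le k n x

lemma floor_add_dt (S : SchemeFamily Ω B w₀ F h H V θ dx dt W) (k : ℕ) {t : ℝ} (ht : 0 ≤ t) :
    ⌊(t + dt k) / dt k⌋₊ = ⌊t / dt k⌋₊ + 1 := by
  have := S.dt_pos k
  rw [add_div, div_self this.ne', Nat.floor_add_one (by positivity)]

lemma tendsto_of_abs_sub_le (S : SchemeFamily Ω B w₀ F h H V θ dx dt W) {a b : ℕ → ℝ} {c l : ℝ}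
    (ha : Tendsto a atTop (𝓝 l)) (hab : ∀ k, |a k - b k| ≤ c * dx k) : Tendsto b atTop (𝓝 l) := by
  have h1 : Tendsto (fun k => a k - b k) atTop (𝓝 0) :=
    squeeze_zero_norm hab (by simpa using S.dx_lim.const_mul c)
  simpa using ha.sub h1

variable {w : ℝ → ℝ → ℝ}

lemma tendsto_stepFun (S : SchemeFamily Ω B w₀ F h H V θ dx dt W)
    (hw : ApproxFamily.IsLimit Ω (fun k => interp (dx k) (dt k) (W k)) w) (x t : ℝ) :
    Tendsto (fun k => stepFun (dx k) (W k ⌊t / dt k⌋₊) x) atTop (𝓝 (w x t)) := by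
  refine S.tendsto_of_abs_sub_le (c := H) (hw.pointwise x t) fun k => ?_
  rw [S.interp_eq]
  exact abs_linInterp_sub_le (S.abs_diff1_le k _) x

/-- Consecutive levels differ by O(dx + dt) in L¹, hence by a null sequence at every point. -/
lemma tendsto_stepFun_succ (S : SchemeFamily Ω B w₀ F h H V θ dx dt W)
    (hw : ApproxFamily.IsLimit Ω (fun k => interp (dx k) (dt k) (W k)) w) (x : ℝ) {t : ℝ} (ht : 0 ≤ t) :
    Tendsto (fun k => stepFun (dx k) (W k (⌊t / dt k⌋₊ + 1)) x) atTop (𝓝 (w x t)) := by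
  obtain ⟨M, hM⟩ := S.rep.exists_bound
  have A := S.approxFamily hM
  have h1 : Tendsto (fun k => interp (dx k) (dt k) (W k) x (t + dt k) -
      interp (dx k) (dt k) (W k) x t) atTop (𝓝 0) := by
    refine tendsto_zero_of_lintegral (Ω := Ω) (f := fun k x => interp (dx k) (dt k) (W k) x
      (t + dt k) - interp (dx k) (dt k) (W k) x t) (K := H + H)
      (fun k => ApproxFamily.lipschitzWith_sub (A.lip k _) (A.lip k _))
      (fun k => (A.per k _).comp₂ (A.per k _) fun a b => a - b) ?_ x
    have h2 : Tendsto (fun k => ENNReal.ofReal (((8 * V : NNReal) : ℝ) *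
        (t + dt k - t + (dx k + dt k)))) atTop (𝓝 0) := by
      rw [← ENNReal.ofReal_zero]
      refine (ENNReal.continuous_ofReal.tendsto _).comp ?_
      have := ((S.dt_lim.add (S.dx_lim.add S.dt_lim)).const_mul ((8 * V : NNReal) : ℝ))
      simpa using this
    exact tendsto_of_tendsto_of_tendsto_of_le_of_le tendsto_const_nhds h2 (fun _ => bot_le)
      fun k => A.time k t (t + dt k) ht (by linarith [S.dt_pos k])
  have h3 := (hw.pointwise x t).add h1
  simp only [add_sub_cancel, add_zero] at h3
  refine S.tendsto_of_abs_sub_le (c := H) h3 fun k => ?_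
  rw [S.interp_eq, S.floor_add_dt k ht]
  exact abs_linInterp_sub_le (S.abs_diff1_le k _) x

lemma tendsto_thetaLevel (S : SchemeFamily Ω B w₀ F h H V θ dx dt W)
    (hw : ApproxFamily.IsLimit Ω (fun k => interp (dx k) (dt k) (W k)) w) (x : ℝ) {t : ℝ} (ht : 0 ≤ t) :
    Tendsto (fun k => stepFun (dx k) (thetaLevel θ (W k) ⌊t / dt k⌋₊) x) atTop (𝓝 (w x t)) := by
  simp only [stepFun_thetaLevel]
  have := ((S.tendsto_stepFun_succ hw x ht).const_mul θ).add
    ((S.tendsto_stepFun hw x t).const_mul (1 - θ))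
  rwa [← add_mul, add_sub_cancel, one_mul] at this

lemma tendsto_thetaLevel_shift (S : SchemeFamily Ω B w₀ F h H V θ dx dt W)
    (hw : ApproxFamily.IsLimit Ω (fun k => interp (dx k) (dt k) (W k)) w) (x : ℝ) {t : ℝ} (ht : 0 ≤ t) :
    Tendsto (fun k => stepFun (dx k) (thetaLevel θ (W k) ⌊t / dt k⌋₊) (x + dx k)) atTop
      (𝓝 (w x t)) := by
  refine S.tendsto_of_abs_sub_le (c := H) (S.tendsto_thetaLevel hw x ht) fun k => ?_
  rw [abs_sub_comm, ← stepFun_shift (S.dx_pos k)]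
  exact S.abs_diff1_thetaLevel_le k _ x

/-- Convergence of the derivatives at the intermediate time level. -/
lemma tendsto_deriv_thetaLevel (S : SchemeFamily Ω B w₀ F h H V θ dx dt W)
    (hw : ApproxFamily.IsLimit Ω (fun k => interp (dx k) (dt k) (W k)) w) {t : ℝ} (ht : 0 ≤ t) :
    Tendsto (fun k => ∫⁻ x, ‖stepFun (dx k) (diff1 (thetaLevel θ (W k) ⌊t / dt k⌋₊)) x / dx k -
      deriv (fun y => w y t) x‖ₑ ∂Ω.measure) atTop (𝓝 0) := by
  obtain ⟨M, hM⟩ := S.rep.exists_bound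
  have A := S.approxFamily hM
  rw [ENNReal.tendsto_nhds_zero]
  intro ε' hε'
  obtain ⟨ε, hε, hε2⟩ : ∃ ε : ℝ, 0 < ε ∧ ENNReal.ofReal (3 * ε) ≤ ε' := by
    rcases eq_or_ne ε' ⊤ with rfl | hne
    · exact ⟨1, one_pos, le_top⟩
    · refine ⟨ε'.toReal / 3, div_pos (ENNReal.toReal_pos hε'.ne' hne) (by norm_num), ?_⟩
      rw [mul_div_cancel₀ _ (by norm_num), ENNReal.ofReal_toReal hne]
  obtain ⟨κ, hκ, hκ2⟩ := A.limit_deriv_time hw hε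
  -- Level n+1 is the interpolation at time t + dt. Convergence uniform on [0,t+1] handles this
  -- moving time, and the continuity of w_x in time with values in L¹ brings it back to t.
  filter_upwards [A.uniform_deriv hw (t + 1) ε hε,
    S.dt_lim.eventually (ge_mem_nhds hκ)] with k hk hkκ
  have hdt := S.dt_pos k
  have h0 := hk t ht (by linarith)
  have h1 := hk (t + dt k) (by linarith) (by linarith [S.dt_le k])
  have h2 := hκ2 (t + dt k) t (by rw [add_sub_cancel_left, abs_of_pos hdt]; exact hkκ)
  simp only [S.floor_add_dt k ht] at h1
  set z0 := fun x => stepFun (dx k) (diff1 (W k ⌊t / dt k⌋₊)) x / dx k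
  set z1 := fun x => stepFun (dx k) (diff1 (W k (⌊t / dt k⌋₊ + 1))) x / dx k
  have m0 : Measurable z0 := (measurable_stepFun _ _).div_const _
  have m1 : Measurable z1 := (measurable_stepFun _ _).div_const _
  set d := deriv fun y => w y t
  have h3 : ∫⁻ x, ‖z1 x - d x‖ₑ ∂Ω.measure ≤ ENNReal.ofReal (2 * ε) := by
    refine (lintegral_enorm_sub_triangle m1 (measurable_deriv fun y => w y (t + dt k))).trans
      ((add_le_add h1 h2).trans (le_of_eq ?_))
    rw [← ENNReal.ofReal_add hε.le hε.le, two_mul]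
  have hθ := S.theta_mem
  calc _ ≤ ∫⁻ x, (‖z1 x - d x‖ₑ + ‖z0 x - d x‖ₑ) ∂Ω.measure := by
        refine lintegral_mono fun x => ?_
        have e : stepFun (dx k) (diff1 (thetaLevel θ (W k) ⌊t / dt k⌋₊)) x / dx k - d x =
            θ * (z1 x - d x) + (1 - θ) * (z0 x - d x) := by
          rw [stepFun_diff1_thetaLevel]
          simp only [z0, z1]
          ring
        dsimp only
        rw [e]
        simp only [Real.enorm_eq_ofReal_abs]
        rw [← ENNReal.ofReal_add (abs_nonneg _) (abs_nonneg _)]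
        refine ENNReal.ofReal_le_ofReal ((abs_add_le _ _).trans (add_le_add ?_ ?_))
        · rw [abs_mul, abs_of_nonneg hθ.1]
          exact mul_le_of_le_one_left (abs_nonneg _) hθ.2
        · rw [abs_mul, abs_of_nonneg (sub_nonneg.2 hθ.2)]
          exact mul_le_of_le_one_left (abs_nonneg _) (by linarith)
    _ = ∫⁻ x, ‖z1 x - d x‖ₑ ∂Ω.measure + ∫⁻ x, ‖z0 x - d x‖ₑ ∂Ω.measure :=
        lintegral_add_left (show Measurable fun x => ‖z1 x - d x‖ₑ from
          (m1.sub (measurable_deriv _)).enorm) _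
    _ ≤ ENNReal.ofReal (2 * ε) + ENNReal.ofReal ε := add_le_add h3 h0
    _ ≤ ε' := by
        rw [← ENNReal.ofReal_add (by positivity) hε.le]
        refine le_trans (le_of_eq ?_) hε2
        congr 1; ring

end SchemeFamily

end ThetaScheme

/-! ### Convergence of the spatial terms -/

namespace ThetaScheme

namespace SchemeFamily

variable {Ω : Domain} {B w₀ F h : ℝ → ℝ} {H V : NNReal} {θ : ℝ} {dx dt : ℕ → ℝ}
  {W : ℕ → ℕ → ℤ → ℝ} {w : ℝ → ℝ → ℝ} {φ : ℝ → ℝ → ℝ} {K : Set ℝ} {R C : ℝ}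

lemma measurable_fluxIntegrand {B : ℝ → ℝ} (hB : Continuous B)
    {f : ℝ → ℝ → ℝ} (hf : Measurable (fun p : ℝ × ℝ => f p.1 p.2)) (d s : ℝ) (Q : ℕ → ℤ → ℝ) :
    Measurable (fun p : ℝ × ℝ => fluxIntegrand B d (Q ⌊p.2 / s⌋₊) (fun x => f x p.2) p.1) := by
  have m1 := measurable_grid d s Q
  have m2 := measurable_grid d s (fun n => diff1 (Q n))
  have m3 : Measurable (fun p : ℝ × ℝ => (p.1 + d, p.2)) :=
    (measurable_fst.add_const d).prodMk measurable_snd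
  have m1' := hB.measurable.comp m1
  have m1'' := hB.measurable.comp (m1.comp m3)
  exact ((m1''.mul (((hf.comp m3).sub hf).div_const d)).mul (m2.div_const d)).add
    ((((m1''.sub m1').div_const d).mul hf).mul (m2.div_const d))

lemma exists_slope_bound {q : ℝ × ℝ → ℝ} (hq : Continuous q) (M : ℝ) :
    ∃ L, ∀ a b : ℝ, |a| ≤ M → |b| ≤ M → |q (a, b)| ≤ L := by
  obtain ⟨L, hL⟩ := ((isCompact_Icc (a := -M) (b := M)).prod
    (isCompact_Icc (a := -M) (b := M))).exists_bound_of_continuousOn hq.continuousOn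
  exact ⟨L, fun a b ha hb => hL (a, b) ⟨_root_.abs_le.1 ha, _root_.abs_le.1 hb⟩⟩

/-- The tested spatial terms converge at every time, and they are uniformly bounded. -/
lemma tendsto_flux (S : SchemeFamily Ω B w₀ F h H V θ dx dt W)
    (hw : ApproxFamily.IsLimit Ω (fun k => interp (dx k) (dt k) (W k)) w) (hB : ContDiff ℝ 1 B)
    (D : TestData Ω φ K R C) :
    (∀ t, 0 ≤ t → Tendsto (fun k => ∫ x, fluxIntegrand B (dx k) (thetaLevel θ (W k) ⌊t / dt k⌋₊)
      (fun x => φ x t) x ∂Ω.measure) atTop (𝓝 (∫ x, (B (w x t) * deriv (fun y => w y t) x *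
        deriv (fun y => φ y t) x + deriv B (w x t) * deriv (fun y => w y t) x ^ 2 * φ x t)
          ∂Ω.measure))) ∧
    ∃ c, ∀ k t, |∫ x, fluxIntegrand B (dx k) (thetaLevel θ (W k) ⌊t / dt k⌋₊)
      (fun x => φ x t) x ∂Ω.measure| ≤ c := by
  obtain ⟨M, hM⟩ := S.rep.exists_bound
  have A := S.approxFamily hM
  obtain ⟨q, hq, hq1, hq2⟩ := exists_slope hB
  obtain ⟨L, hL⟩ := exists_slope_bound hq M
  have hBb : ∀ s, |B s| ≤ 1 := fun s => by
    rw [abs_of_nonneg ((S.stable 0).coeff s).1]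
    exact ((S.stable 0).coeff s).2
  have mφ := D.test.1.continuous.measurable
  have mx : ∀ t, Measurable (fun x => φ x t) := fun t =>
    mφ.comp (measurable_id.prodMk measurable_const)
  have z0 : ∀ x t, x ∉ K → φ x t = 0 := fun x t hx => by
    simpa using D.space x t 0 hx (by simp)
  have z1 : ∀ k x t, x ∉ K → φ (x + dx k) t = 0 := fun k x t hx =>
    D.space x t _ hx (by rw [abs_of_pos (S.dx_pos k)]; exact S.dx_le k)
  set a : ℝ → ℕ → ℝ → ℝ := fun t k x => B (stepFun (dx k) (thetaLevel θ (W k) ⌊t / dt k⌋₊)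
    (x + dx k)) * ((φ (x + dx k) t - φ x t) / dx k) with ha
  set b : ℝ → ℕ → ℝ → ℝ := fun t k x => q (stepFun (dx k) (thetaLevel θ (W k) ⌊t / dt k⌋₊) x,
    stepFun (dx k) (thetaLevel θ (W k) ⌊t / dt k⌋₊) (x + dx k)) * φ x t with hb
  set Z : ℝ → ℕ → ℝ → ℝ := fun t k x =>
    stepFun (dx k) (diff1 (thetaLevel θ (W k) ⌊t / dt k⌋₊)) x / dx k with hZ
  have ma : ∀ t k, Measurable (a t k) := fun t k =>
    (hB.continuous.measurable.comp ((measurable_stepFun _ _).comp (measurable_add_const _))).mul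
      ((((mx t).comp (measurable_add_const _)).sub (mx t)).div_const _)
  have mb : ∀ t k, Measurable (b t k) := fun t k =>
    (hq.measurable.comp ((measurable_stepFun _ _).prodMk
      ((measurable_stepFun _ _).comp (measurable_add_const _)))).mul (mx t)
  have mZ : ∀ t k, Measurable (Z t k) := fun t k => (measurable_stepFun _ _).div_const _
  have ba : ∀ t k x, |a t k x| ≤ 1 * C := fun t k x => by
    rw [ha, abs_mul]
    refine mul_le_mul (hBb _) ?_ (abs_nonneg _) zero_le_one
    have hdx := S.dx_pos k
    rw [abs_div, abs_of_pos hdx, div_le_iff₀ hdx]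
    simpa [abs_of_pos hdx] using D.bound_space x t (dx k)
  have bb : ∀ t k x, |b t k x| ≤ L * C := fun t k x => by
    rw [hb, abs_mul]
    have h1 := hL _ _ (S.abs_thetaLevel_le hM k ⌊t / dt k⌋₊ x)
      (S.abs_thetaLevel_le hM k ⌊t / dt k⌋₊ (x + dx k))
    exact mul_le_mul h1 (D.bound _ _) (abs_nonneg _) ((abs_nonneg _).trans h1)
  have bZ : ∀ t k x, |Z t k x| ≤ H := fun t k x => S.abs_deriv_thetaLevel_le k _ x
  have bZ2 : ∀ t k x, |Z t k x ^ 2| ≤ (H : ℝ) ^ 2 := fun t k x => by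
    rw [abs_pow]
    exact pow_le_pow_left₀ (abs_nonneg _) (bZ t k x) 2
  have za : ∀ t k x, x ∉ K → a t k x = 0 := fun t k x hx => by
    simp only [ha, z0 x t hx, z1 k x t hx, sub_zero, zero_div, mul_zero]
  have zb : ∀ t k x, x ∉ K → b t k x = 0 := fun t k x hx => by
    simp only [hb, z0 x t hx, mul_zero]
  -- The difference of B equals the slope function `q` times the first difference of the grid
  -- function, so the second term becomes quadratic in the discrete derivative `Z`.
  have e1 : ∀ t k x, fluxIntegrand B (dx k) (thetaLevel θ (W k) ⌊t / dt k⌋₊) (fun x => φ x t) x =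
      a t k x * Z t k x + b t k x * Z t k x ^ 2 := fun t k x => by
    simp only [fluxIntegrand, ha, hb, hZ]
    rw [hq1]
    have h1 : stepFun (dx k) (thetaLevel θ (W k) ⌊t / dt k⌋₊) (x + dx k) -
        stepFun (dx k) (thetaLevel θ (W k) ⌊t / dt k⌋₊) x =
        stepFun (dx k) (diff1 (thetaLevel θ (W k) ⌊t / dt k⌋₊)) x := by
      rw [← stepFun_shift (S.dx_pos k)]
      rfl
    rw [h1]
    ring
  have ca : ∀ t k x, |a t k x * Z t k x| ≤ 1 * C * H := fun t k x => by
    rw [abs_mul]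
    exact mul_le_mul (ba t k x) (bZ t k x) (abs_nonneg _) ((abs_nonneg _).trans (ba t k x))
  have cb : ∀ t k x, |b t k x * Z t k x ^ 2| ≤ L * C * (H : ℝ) ^ 2 := fun t k x => by
    rw [abs_mul]
    exact mul_le_mul (bb t k x) (bZ2 t k x) (abs_nonneg _) ((abs_nonneg _).trans (bb t k x))
  have ia : ∀ t k, Integrable (fun x => a t k x * Z t k x) Ω.measure := fun t k =>
    integrable_of_support ((ma t k).mul (mZ t k)) D.measurableSet D.measure_ne_top (ca t k)
      (fun x hx => by rw [za t k x hx, zero_mul])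
  have ib : ∀ t k, Integrable (fun x => b t k x * Z t k x ^ 2) Ω.measure := fun t k =>
    integrable_of_support ((mb t k).mul ((mZ t k).pow_const 2)) D.measurableSet D.measure_ne_top
      (cb t k) (fun x hx => by rw [zb t k x hx, zero_mul])
  refine ⟨fun t ht => ?_, 1 * C * H * Ω.measure.real K + L * C * (H : ℝ) ^ 2 * Ω.measure.real K,
    fun k t => ?_⟩
  · set z := deriv (fun y => w y t) with hz
    have mz : Measurable z := measurable_deriv _
    have hzH : ∀ x, |z x| ≤ H := fun x => norm_deriv_le_of_lipschitz (A.limit_lip hw t)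
    have hΘ := fun x => S.tendsto_thetaLevel hw x ht
    have hΘ' := fun x => S.tendsto_thetaLevel_shift hw x ht
    have la : ∀ x, Tendsto (fun k => a t k x) atTop
        (𝓝 (B (w x t) * deriv (fun y => φ y t) x)) := fun x => by
      refine ((hB.continuous.tendsto _).comp (hΘ' x)).mul ?_
      have h1 := (D.test.hasDerivAt_space x t).tendsto_slope_zero
      have h2 : Tendsto dx atTop (𝓝[≠] 0) := tendsto_nhdsWithin_iff.2 ⟨S.dx_lim,
        .of_forall fun k => (S.dx_pos k).ne'⟩
      refine (h1.comp h2).congr fun k => ?_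
      simp only [Function.comp_apply, smul_eq_mul]
      rw [div_eq_inv_mul]
    have lb : ∀ x, Tendsto (fun k => b t k x) atTop (𝓝 (deriv B (w x t) * φ x t)) := fun x => by
      rw [← hq2]
      exact ((hq.tendsto _).comp ((hΘ x).prodMk_nhds (hΘ' x))).mul_const _
    have lZ := S.tendsto_deriv_thetaLevel hw ht
    -- The uniform bound H on both derivatives makes the square Lipschitz with constant 2H on their
    -- range, so L¹ convergence passes to the squares.
    have lZ2 : Tendsto (fun k => ∫⁻ x, ‖Z t k x ^ 2 - z x ^ 2‖ₑ ∂Ω.measure) atTop (𝓝 0) := by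
      have h1 := ENNReal.Tendsto.const_mul lZ
        (.inr (ENNReal.ofReal_ne_top (r := (H : ℝ) + H)))
      rw [mul_zero] at h1
      refine tendsto_of_tendsto_of_tendsto_of_le_of_le tendsto_const_nhds h1 (fun _ => bot_le)
        fun k => ?_
      dsimp only
      rw [← lintegral_const_mul' _ _ ENNReal.ofReal_ne_top]
      refine lintegral_mono fun x => ?_
      dsimp only
      rw [sq_sub_sq, enorm_mul]
      gcongr
      rw [Real.enorm_eq_ofReal_abs]
      exact ENNReal.ofReal_le_ofReal ((abs_add_le _ _).trans (add_le_add (bZ t k x) (hzH x)))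
    have l1 := tendsto_integral_mul (ma t) D.measurableSet D.measure_ne_top (ba t) (za t) la
      (mZ t) mz (bZ t) hzH lZ
    have l2 := tendsto_integral_mul (mb t) D.measurableSet D.measure_ne_top (bb t) (zb t) lb
      (fun k => (mZ t k).pow_const 2) (mz.pow_const 2) (bZ2 t) (fun x => by
        rw [abs_pow]
        exact pow_le_pow_left₀ (abs_nonneg _) (hzH x) 2) lZ2
    have mw := A.limit_measurable hw t
    have mφx : Measurable (deriv fun y => φ y t) := measurable_deriv _
    have hdB : Continuous (deriv B) := hB.continuous_deriv le_rfl
    have bla : ∀ x, |B (w x t) * deriv (fun y => φ y t) x| ≤ 1 * C := fun x =>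
      le_of_tendsto (la x).abs (.of_forall fun k => ba t k x)
    have blb : ∀ x, |deriv B (w x t) * φ x t| ≤ L * C := fun x =>
      le_of_tendsto (lb x).abs (.of_forall fun k => bb t k x)
    have j1 : Integrable (fun x => B (w x t) * deriv (fun y => φ y t) x * z x) Ω.measure := by
      refine integrable_of_support (c := 1 * C * H) (((hB.continuous.measurable.comp mw).mul mφx).mul
        mz) D.measurableSet D.measure_ne_top (fun x => ?_) (fun x hx => ?_)
      · rw [abs_mul]
        exact mul_le_mul (bla x) (hzH x) (abs_nonneg _) ((abs_nonneg _).trans (bla x))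
      · have h3 : B (w x t) * deriv (fun y => φ y t) x = 0 :=
          tendsto_nhds_unique (la x) (by simp only [za t _ x hx]; exact tendsto_const_nhds)
        rw [h3, zero_mul]
    have j2 : Integrable (fun x => deriv B (w x t) * φ x t * z x ^ 2) Ω.measure := by
      refine integrable_of_support (c := L * C * (H : ℝ) ^ 2) (((hdB.measurable.comp mw).mul
        (mx t)).mul (mz.pow_const 2)) D.measurableSet D.measure_ne_top (fun x => ?_)
        (fun x hx => ?_)
      · rw [abs_mul, abs_pow]
        exact mul_le_mul (blb x) (pow_le_pow_left₀ (abs_nonneg _) (hzH x) 2) (by positivity)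
          ((abs_nonneg _).trans (blb x))
      · rw [z0 x t hx, mul_zero, zero_mul]
    have l3 := l1.add l2
    rw [← integral_add j1 j2] at l3
    refine (l3.congr fun k => ?_).trans (le_of_eq ?_)
    · rw [← integral_add (ia t k) (ib t k)]
      simp only [e1]
    · congr 2
      funext x
      ring
  · simp only [e1]
    rw [integral_add (ia t k) (ib t k)]
    exact (abs_add_le _ _).trans (add_le_add
      (abs_integral_le_of_support D.measure_ne_top (ca t k)
        (fun x hx => by rw [za t k x hx, zero_mul]))
      (abs_integral_le_of_support D.measure_ne_top (cb t k)
        (fun x hx => by rw [zb t k x hx, zero_mul])))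

end SchemeFamily

end ThetaScheme

/-! ### The weak form of the limit -/

namespace ThetaScheme

namespace SchemeFamily

variable {Ω : Domain} {B w₀ F h : ℝ → ℝ} {H V : NNReal} {θ : ℝ} {dx dt : ℕ → ℝ}
  {W : ℕ → ℕ → ℤ → ℝ} {w : ℝ → ℝ → ℝ} {φ : ℝ → ℝ → ℝ} {K : Set ℝ} {R C : ℝ}

/-- The cell averages are within 2H dx of the Lipschitz representative, so the initial values are
attained at every point. -/
lemma limit_init (S : SchemeFamily Ω B w₀ F h H V θ dx dt W)
    (hw : ApproxFamily.IsLimit Ω (fun k => interp (dx k) (dt k) (W k)) w) (x : ℝ) :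
    w x 0 = F x := by
  have h1 := S.tendsto_stepFun hw x 0
  simp only [zero_div, Nat.floor_zero] at h1
  refine tendsto_nhds_unique (S.tendsto_of_abs_sub_le (c := H * 2) h1 (b := fun _ => F x)
    fun k => ?_) tendsto_const_nhds
  rw [mul_assoc]
  exact S.rep.abs_average_sub_le (S.dx_pos k) (S.init k) x

lemma deriv_time_eq_zero (D : TestData Ω φ K R C) (x : ℝ) {t : ℝ} (ht : R < |t|) :
    deriv (fun s => φ x s) t = 0 := by
  have h2 : ∀ᶠ s in 𝓝 t, R < |s| := (isOpen_lt continuous_const continuous_abs).mem_nhds ht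
  rw [Filter.EventuallyEq.deriv_eq (f := fun _ => 0) (h2.mono fun s hs => D.time x s hs),
    deriv_const]

lemma deriv_time_eq_zero_of_notMem (D : TestData Ω φ K R C) {x : ℝ} (hx : x ∉ K) (t : ℝ) :
    deriv (fun s => φ x s) t = 0 := by
  have h3 : (fun s => φ x s) = fun _ => 0 := funext fun s => by simpa using D.space x s 0 hx
  rw [h3, deriv_const]

lemma deriv_space_eq_zero_of_notMem (D : TestData Ω φ K R C) {x : ℝ} (hx : x ∉ K) (t : ℝ) :
    deriv (fun y => φ y t) x = 0 := by
  have h2 : ∀ᶠ y in 𝓝 x, φ y t = 0 := by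
    filter_upwards [Metric.ball_mem_nhds x one_pos] with y hy
    have := D.space x t (y - x) hx (by rw [← Real.dist_eq]; exact (Metric.mem_ball.1 hy).le)
    rwa [add_sub_cancel] at this
  rw [Filter.EventuallyEq.deriv_eq (f := fun _ => 0) h2, deriv_const]

lemma integral_Iic_deriv_time (D : TestData Ω φ K R C) (x : ℝ) :
    ∫ t in Iic (0 : ℝ), deriv (fun s => φ x s) t = φ x 0 := by
  have hz : ∀ t ≤ -(R + 1), φ x t = 0 := fun t ht => D.time x t (by
    rw [abs_of_nonpos (by linarith [D.R_nonneg])]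
    linarith)
  have hc : Continuous (deriv fun s => φ x s) :=
    D.test.deriv_time.1.continuous.comp (continuous_const.prodMk continuous_id)
  have h1 := integral_Iic_of_hasDerivAt_of_tendsto (f := fun s => φ x s) (m := 0) (a := 0)
    (D.test.hasDerivAt_time x 0).continuousAt.continuousWithinAt
    (fun t _ => D.test.hasDerivAt_time x t) ?_ ?_
  · rw [h1, sub_zero]
  · refine (integrable_of_support (K := Icc (-R) R) (c := C) hc.measurable measurableSet_Icc
      (by simp) (D.bound_deriv_time x) fun t ht => ?_).integrableOn
    have h2 : R < |t| := not_le.1 fun h => ht (_root_.abs_le.1 h)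
    exact deriv_time_eq_zero D x h2
  · exact tendsto_const_nhds.congr' ((eventually_le_atBot _).mono fun t ht => (hz t ht).symm)

/-- The weak form of the limit equation, with the time derivative integrated over all times. -/
lemma integral_limit (S : SchemeFamily Ω B w₀ F h H V θ dx dt W)
    (hw : ApproxFamily.IsLimit Ω (fun k => interp (dx k) (dt k) (W k)) w) (hB : ContDiff ℝ 1 B)
    (D : TestData Ω φ K R C) :
    ∫ t, (∫ x, w x t * deriv (fun s => φ x s) t ∂Ω.measure) =
      ∫ t in Ioi (0 : ℝ), (∫ x, (B (w x t) * deriv (fun y => w y t) x *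
        deriv (fun y => φ y t) x + deriv B (w x t) * deriv (fun y => w y t) x ^ 2 * φ x t)
          ∂Ω.measure) := by
  obtain ⟨M, hM⟩ := S.rep.exists_bound
  obtain ⟨hf1, c, hf2⟩ := S.tendsto_flux hw hB D
  have mφ := D.test.1.continuous.measurable
  have hM0 : 0 ≤ M := (abs_nonneg _).trans (hM 0)
  have z0 : ∀ x t, x ∉ K → φ x t = 0 := fun x t hx => by
    simpa using D.space x t 0 hx (by simp)
  have mS : ∀ k, Measurable (fun p : ℝ × ℝ => stepFun (dx k) (W k ⌊p.2 / dt k⌋₊) p.1 *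
      ((φ p.1 p.2 - φ p.1 (p.2 - dt k)) / dt k)) := fun k =>
    (measurable_grid (dx k) (dt k) (W k)).mul ((mφ.sub (mφ.comp (measurable_fst.prodMk
      (measurable_snd.sub_const (dt k))))).div_const _)
  have bS : ∀ k x t, |stepFun (dx k) (W k ⌊t / dt k⌋₊) x * ((φ x t - φ x (t - dt k)) / dt k)| ≤
      M * C := fun k x t => by
    rw [abs_mul]
    refine mul_le_mul (S.abs_le hM _ _ _) ?_ (abs_nonneg _) hM0
    have hdt := S.dt_pos k
    have h1 := D.bound_time x (t - dt k) (dt k)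
    rw [sub_add_cancel, abs_of_pos hdt] at h1
    rwa [abs_div, abs_of_pos hdt, div_le_iff₀ hdt]
  have zS : ∀ k t x, x ∉ K → stepFun (dx k) (W k ⌊t / dt k⌋₊) x *
      ((φ x t - φ x (t - dt k)) / dt k) = 0 := fun k t x hx => by
    rw [z0 x t hx, z0 x _ hx, sub_zero, zero_div, mul_zero]
  have l1 : ∀ t, Tendsto (fun k => ∫ x, stepFun (dx k) (W k ⌊t / dt k⌋₊) x *
      ((φ x t - φ x (t - dt k)) / dt k) ∂Ω.measure) atTop
      (𝓝 (∫ x, w x t * deriv (fun s => φ x s) t ∂Ω.measure)) := fun t => by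
    refine tendsto_integral_of_support (fun k => (mS k).comp (measurable_id.prodMk
      measurable_const)) D.measurableSet D.measure_ne_top (fun k x => bS k x t)
      (fun k x hx => zS k t x hx) (ae_of_all _ fun x => ?_)
    refine (S.tendsto_stepFun hw x t).mul ?_
    have h1 := (D.test.hasDerivAt_time x t).tendsto_slope_zero
    -- Summation by parts left a backward difference of φ in time, that is, a slope with the
    -- increment -dt.
    have h2 : Tendsto (fun k => -dt k) atTop (𝓝[≠] 0) := tendsto_nhdsWithin_iff.2
      ⟨by simpa using S.dt_lim.neg, .of_forall fun k => by simpa using (S.dt_pos k).ne'⟩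
    refine (h1.comp h2).congr fun k => ?_
    have := S.dt_pos k
    simp only [Function.comp_apply, smul_eq_mul, ← sub_eq_add_neg]
    field_simp
    ring
  have l2 : Tendsto (fun k => ∫ t, (∫ x, stepFun (dx k) (W k ⌊t / dt k⌋₊) x *
      ((φ x t - φ x (t - dt k)) / dt k) ∂Ω.measure)) atTop
      (𝓝 (∫ t, (∫ x, w x t * deriv (fun s => φ x s) t ∂Ω.measure))) := by
    -- The backward shift by dt ≤ 1 enlarges the time support by at most 1.
    refine tendsto_integral_of_support (K := Icc (-(R + 1)) (R + 1))
      (fun k => measurable_integral_left (mS k)) measurableSet_Icc (by simp)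
      (fun k t => abs_integral_le_of_support D.measure_ne_top (fun x => bS k x t) (zS k t))
      (fun k t ht => ?_) (ae_of_all _ l1)
    have h1 : R + 1 < |t| := not_le.1 fun h => ht (_root_.abs_le.1 h)
    have h2 : R < |t - dt k| := by
      have := abs_sub_abs_le_abs_sub t (dt k)
      rw [abs_of_pos (S.dt_pos k)] at this
      linarith [S.dt_le k]
    simp only [D.time _ _ h2, D.time _ _ (show R < |t| by linarith), sub_zero, zero_div, mul_zero,
      integral_zero]
  have l3 := tendsto_integral_of_support (μ := volume.restrict (Ioi 0)) (K := Icc (-R) R)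
    (fun k => measurable_integral_left (Ω := Ω) (measurable_fluxIntegrand hB.continuous mφ (dx k)
      (dt k) (thetaLevel θ (W k)))) measurableSet_Icc
    (ne_top_of_le_ne_top (by simp) (Measure.restrict_apply_le _ _)) hf2 (fun k t ht => ?_)
    ((ae_restrict_iff' measurableSet_Ioi).2 (ae_of_all _ fun t (ht : 0 < t) => hf1 t ht.le))
  · refine tendsto_nhds_unique l2 (l3.congr fun k => ?_)
    exact ((S.stable k).integral_weak hB.continuous (S.dx_le k) (fun n => S.abs_le hM k n) D).symm
  · have h1 : R < |t| := not_le.1 fun h => ht (_root_.abs_le.1 h)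
    simp only [fluxIntegrand, D.time _ _ h1, sub_zero, zero_div, mul_zero, zero_mul,
      add_zero, integral_zero]

/-- The initial values enter the weak form through the negative times. -/
lemma integral_init (D : TestData Ω φ K R C) {F : ℝ → ℝ} (mF : Measurable F) {M : ℝ}
    (hM : ∀ x, |F x| ≤ M) :
    ∫ t in Iic (0 : ℝ), (∫ x, F x * deriv (fun s => φ x s) t ∂Ω.measure) =
      ∫ x, F x * φ x 0 ∂Ω.measure := by
  have mφt := D.test.deriv_time.1.continuous.measurable
  have hM0 : 0 ≤ M := (abs_nonneg _).trans (hM 0)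
  have hint : Integrable (Function.uncurry fun t x => F x * deriv (fun s => φ x s) t)
      ((volume.restrict (Iic 0)).prod Ω.measure) := by
    have m1 : Measurable (fun p : ℝ × ℝ => F p.2 * deriv (fun s => φ p.2 s) p.1) :=
      (mF.comp measurable_snd).mul (mφt.comp (measurable_snd.prodMk measurable_fst))
    have hK : MeasurableSet (Icc (-R) R ×ˢ K) := measurableSet_Icc.prod D.measurableSet
    have hμ : ((volume.restrict (Iic 0)).prod Ω.measure) (Icc (-R) R ×ˢ K) < ⊤ := by
      rw [Measure.prod_prod]
      exact ENNReal.mul_lt_top (lt_of_le_of_lt (Measure.restrict_apply_le _ _) (by simp))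
        (lt_top_iff_ne_top.2 D.measure_ne_top)
    have h1 : IntegrableOn (fun p : ℝ × ℝ => F p.2 * deriv (fun s => φ p.2 s) p.1)
        (Icc (-R) R ×ˢ K) ((volume.restrict (Iic 0)).prod Ω.measure) := by
      refine Measure.integrableOn_of_bounded hμ.ne m1.aestronglyMeasurable (M := M * C)
        (ae_of_all _ fun p => ?_)
      rw [norm_mul]
      exact mul_le_mul (hM _) (D.bound_deriv_time _ _) (norm_nonneg _) hM0
    rw [← integrable_indicator_iff hK] at h1
    refine h1.congr (ae_of_all _ fun p => ?_)
    by_cases hp : p ∈ Icc (-R) R ×ˢ K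
    · rw [indicator_of_mem hp]
      rfl
    · rw [indicator_of_notMem hp]
      rw [mem_prod, not_and_or] at hp
      simp only [Function.uncurry]
      rcases hp with hp | hp
      · rw [deriv_time_eq_zero D _ (not_le.1 fun h => hp (_root_.abs_le.1 h)), mul_zero]
      · rw [deriv_time_eq_zero_of_notMem D hp, mul_zero]
  rw [integral_integral_swap hint]
  simp only [integral_const_mul, integral_Iic_deriv_time D]

lemma measurable_limit (hw : Continuous (fun p : ℝ × ℝ => w p.2 p.1)) :
    Measurable (fun p : ℝ × ℝ => w p.1 p.2) := (hw.comp continuous_swap).measurable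

/-- Joint continuity of the limit gives a jointly measurable choice of its spatial derivative, as
the definition of weak solution demands. -/
lemma measurable_deriv_limit (hw : Continuous (fun p : ℝ × ℝ => w p.2 p.1)) :
    Measurable (fun p : ℝ × ℝ => deriv (fun y => w y p.2) p.1) :=
  (measurable_deriv_with_param (f := fun t y => w y t) hw).comp measurable_swap

/-- The limit satisfies the weak form of the differential equation. -/
theorem weak_form (S : SchemeFamily Ω B w₀ F h H V θ dx dt W)
    (hw : ApproxFamily.IsLimit Ω (fun k => interp (dx k) (dt k) (W k)) w) (hB : ContDiff ℝ 1 B)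
    (hφ : IsTestFunction Ω φ) :
    (∫ t in Ioi (0 : ℝ), ∫ x,
        (w x t * deriv (fun s => φ x s) t
          - B (w x t) * deriv (fun y => w y t) x * deriv (fun y => φ y t) x
          - deriv B (w x t) * deriv (fun y => w y t) x ^ 2 * φ x t) ∂Ω.measure)
      + ∫ x, w₀ x * φ x 0 ∂Ω.measure = 0 := by
  obtain ⟨K, R, C, D⟩ := hφ.exists_testData
  obtain ⟨M, hM⟩ := S.rep.exists_bound
  have A := S.approxFamily hM
  have h1 := S.integral_limit hw hB D
  have cw := A.limit_continuous hw
  have mw := measurable_limit cw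
  have mz := measurable_deriv_limit cw
  have mφ := hφ.1.continuous.measurable
  have mφt := hφ.deriv_time.1.continuous.measurable
  have mφx := hφ.deriv_space.1.continuous.measurable
  have cB : Continuous (deriv B) := hB.continuous_deriv le_rfl
  obtain ⟨L, hL⟩ := (isCompact_Icc (a := -M) (b := M)).exists_bound_of_continuousOn cB.continuousOn
  have hM0 : 0 ≤ M := (abs_nonneg _).trans (hM 0)
  have hwM := A.limit_bdd hw
  have hzH : ∀ x t, |deriv (fun y => w y t) x| ≤ H := fun x t =>
    norm_deriv_le_of_lipschitz (A.limit_lip hw t)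
  have z0 : ∀ x t, x ∉ K → φ x t = 0 := fun x t hx => by
    simpa using D.space x t 0 hx (by simp)
  set f1 : ℝ → ℝ → ℝ := fun x t => w x t * deriv (fun s => φ x s) t with hf1
  set f2 : ℝ → ℝ → ℝ := fun x t => B (w x t) * deriv (fun y => w y t) x *
    deriv (fun y => φ y t) x + deriv B (w x t) * deriv (fun y => w y t) x ^ 2 * φ x t with hf2
  have m1 : Measurable (fun p : ℝ × ℝ => f1 p.1 p.2) := mw.mul mφt
  have m2 : Measurable (fun p : ℝ × ℝ => f2 p.1 p.2) :=
    (((hB.continuous.measurable.comp mw).mul mz).mul mφx).add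
      (((cB.measurable.comp mw).mul (mz.pow_const 2)).mul mφ)
  have b1 : ∀ x t, |f1 x t| ≤ M * C := fun x t => by
    rw [hf1, abs_mul]
    exact mul_le_mul (hwM x t) (D.bound_deriv_time x t) (abs_nonneg _) hM0
  have b2 : ∀ x t, |f2 x t| ≤ 1 * H * C + L * (H : ℝ) ^ 2 * C := fun x t => by
    have hB1 : |B (w x t)| ≤ 1 := by
      rw [abs_of_nonneg ((S.stable 0).coeff _).1]
      exact ((S.stable 0).coeff _).2
    have hL1 : |deriv B (w x t)| ≤ L := hL _ (_root_.abs_le.1 (hwM x t))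
    refine (abs_add_le _ _).trans (add_le_add ?_ ?_)
    · rw [abs_mul, abs_mul]
      exact mul_le_mul (mul_le_mul hB1 (hzH x t) (abs_nonneg _) zero_le_one)
        (D.bound_deriv_space x t) (abs_nonneg _) (by positivity)
    · have hL0 := (abs_nonneg _).trans hL1
      rw [abs_mul, abs_mul, abs_pow]
      exact mul_le_mul (mul_le_mul hL1 (pow_le_pow_left₀ (abs_nonneg _) (hzH x t) 2)
        (by positivity) hL0) (D.bound x t) (abs_nonneg _) (by positivity)
  have s1 : ∀ t x, x ∉ K → f1 x t = 0 := fun t x hx => by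
    simp only [hf1, deriv_time_eq_zero_of_notMem D hx, mul_zero]
  have s2 : ∀ t x, x ∉ K → f2 x t = 0 := fun t x hx => by
    simp only [hf2, deriv_space_eq_zero_of_notMem D hx, z0 x t hx, mul_zero, add_zero]
  have i1 : ∀ t, Integrable (fun x => f1 x t) Ω.measure := fun t =>
    integrable_of_support (m1.comp (measurable_id.prodMk measurable_const)) D.measurableSet
      D.measure_ne_top (fun x => b1 x t) (s1 t)
  have i2 : ∀ t, Integrable (fun x => f2 x t) Ω.measure := fun t =>
    integrable_of_support (m2.comp (measurable_id.prodMk measurable_const)) D.measurableSet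
      D.measure_ne_top (fun x => b2 x t) (s2 t)
  have ht : ∀ {t : ℝ}, t ∉ Icc (-R) R → R < |t| := fun ht =>
    not_le.1 fun h => ht (_root_.abs_le.1 h)
  have j1 : Integrable (fun t => ∫ x, f1 x t ∂Ω.measure) :=
    integrable_of_support (measurable_integral_left m1) (measurableSet_Icc (a := -R) (b := R))
      (by simp) (fun t => abs_integral_le_of_support D.measure_ne_top (fun x => b1 x t) (s1 t))
      fun t h => by simp only [hf1, deriv_time_eq_zero D _ (ht h), mul_zero, integral_zero]
  have j2 : Integrable (fun t => ∫ x, f2 x t ∂Ω.measure) := by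
    refine integrable_of_support (measurable_integral_left m2)
      (measurableSet_Icc (a := -R) (b := R)) (by simp)
      (fun t => abs_integral_le_of_support D.measure_ne_top (fun x => b2 x t) (s2 t)) fun t h => ?_
    simp only [hf2, D.time _ _ (ht h), deriv_const, mul_zero, add_zero, integral_zero]
  have e0 : ∀ t, ∫ x, (w x t * deriv (fun s => φ x s) t
      - B (w x t) * deriv (fun y => w y t) x * deriv (fun y => φ y t) x
      - deriv B (w x t) * deriv (fun y => w y t) x ^ 2 * φ x t) ∂Ω.measure =
      ∫ x, f1 x t ∂Ω.measure - ∫ x, f2 x t ∂Ω.measure := fun t => by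
    rw [← integral_sub (i1 t) (i2 t)]
    congr 1
    funext x
    simp only [hf1, hf2]
    ring
  -- For t ≤ 0 the limit equals `F`, so the time integral of φ_t can be evaluated and leaves φ at
  -- time 0.
  have e1 : ∫ t in Iic (0 : ℝ), (∫ x, f1 x t ∂Ω.measure) = ∫ x, F x * φ x 0 ∂Ω.measure := by
    rw [← integral_init D S.rep.lip.continuous.measurable hM]
    refine setIntegral_congr_fun measurableSet_Iic fun t ht => ?_
    simp only [hf1, A.limit_neg hw _ ht, S.limit_init hw]
  have e2 : ∫ x, w₀ x * φ x 0 ∂Ω.measure = ∫ x, F x * φ x 0 ∂Ω.measure :=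
    integral_congr_ae (((ApproxFamily.measure_absolutelyContinuous Ω).ae_eq S.rep.ae_eq).mul
      (ae_eq_refl _))
  have e3 := intervalIntegral.integral_Iic_add_Ioi (b := 0) (μ := volume)
    j1.integrableOn j1.integrableOn
  simp only [e0]
  rw [integral_sub j1.integrableOn j2.integrableOn, e2, ← e1, ← h1, ← e3]
  ring

end SchemeFamily

end ThetaScheme

/-! ### Function spaces of the limit, and the conclusion -/

namespace ThetaScheme

lemma normW11_le {Ω : Domain} {f g : ℝ → ℝ} (h : HasWeakDeriv f g) :
    normW11 Ω f ≤ ∫⁻ x, ‖f x‖ₑ ∂Ω.measure + ∫⁻ x, ‖g x‖ₑ ∂Ω.measure := by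
  refine (iInf₂_le g h).trans (le_of_eq ?_)
  rw [eLpNorm_one_eq_lintegral_enorm, eLpNorm_one_eq_lintegral_enorm]

/-- Interpolation between L^∞ and L¹: f² ≤ M|f|. -/
lemma exists_eLpNorm_two_le {μ : Measure ℝ} (M : ℝ) {A : ℝ≥0∞} (hA : A ≠ ⊤) :
    ∃ C : NNReal, ∀ f : ℝ → ℝ, (∀ x, |f x| ≤ M) → ∫⁻ x, ‖f x‖ₑ ∂μ ≤ A → eLpNorm f 2 μ ≤ C := by
  refine ⟨((ENNReal.ofReal M * A) ^ (1 / 2 : ℝ)).toNNReal, fun f hM hf => ?_⟩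
  rw [ENNReal.coe_toNNReal (ENNReal.rpow_ne_top_of_nonneg (by norm_num)
    (ENNReal.mul_ne_top ENNReal.ofReal_ne_top hA)),
    eLpNorm_eq_lintegral_rpow_enorm_toReal (by norm_num) (by norm_num), ENNReal.toReal_ofNat]
  refine ENNReal.rpow_le_rpow ?_ (by norm_num)
  calc ∫⁻ x, ‖f x‖ₑ ^ (2 : ℝ) ∂μ ≤ ∫⁻ x, ENNReal.ofReal M * ‖f x‖ₑ ∂μ := by
        refine lintegral_mono fun x => ?_
        dsimp only
        rw [ENNReal.rpow_two, sq]
        gcongr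
        rw [Real.enorm_eq_ofReal_abs]
        exact ENNReal.ofReal_le_ofReal (hM x)
    _ = ENNReal.ofReal M * ∫⁻ x, ‖f x‖ₑ ∂μ := lintegral_const_mul' _ _ ENNReal.ofReal_ne_top
    _ ≤ _ := mul_le_mul_right hf _

lemma Domain.lintegral_circle_le {f : ℝ → ℝ} {M : ℝ} (hM : ∀ x, |f x| ≤ M) :
    ∫⁻ x, ‖f x‖ₑ ∂Domain.circle.measure ≤ ENNReal.ofReal M := by
  calc _ ≤ ∫⁻ _, ENNReal.ofReal M ∂Domain.circle.measure := by
        refine lintegral_mono fun x => ?_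
        rw [Real.enorm_eq_ofReal_abs]
        exact ENNReal.ofReal_le_ofReal (hM x)
    _ = _ := by
        rw [lintegral_const, Domain.measure_circle, Measure.restrict_apply_univ, Real.volume_Ioc]
        simp

namespace ApproxFamily

variable {Ω : Domain} {u z : ℕ → ℝ → ℝ → ℝ} {δ : ℕ → ℝ} {M : ℝ} {H V : NNReal} {A : ℝ≥0∞}
  {w : ℝ → ℝ → ℝ}

lemma limit_hasWeakDeriv (h : ApproxFamily Ω u z δ M H V A) (hw : IsLimit Ω u w) (t : ℝ) :
    HasWeakDeriv (fun x => w x t) (deriv fun x => w x t) :=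
  hasWeakDeriv_of_lipschitzWith (h.limit_lip hw t)

lemma memCW11_limit (h : ApproxFamily Ω u z δ M H V A) (hw : IsLimit Ω u w) : MemCW11 Ω w := by
  refine ⟨fun t ht => ⟨Domain.isFunctionOn_iff_per.2 (h.limit_per hw t),
    ⟨(h.limit_measurable hw t).aestronglyMeasurable, ?_⟩, _, h.limit_hasWeakDeriv hw t,
    ⟨(measurable_deriv _).aestronglyMeasurable, ?_⟩⟩, fun t _ => ?_⟩
  · rw [eLpNorm_one_eq_lintegral_enorm]
    exact (h.limit_lintegral_le hw ht).trans_lt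
      (ENNReal.add_lt_top.2 ⟨ENNReal.ofReal_lt_top, lt_top_iff_ne_top.2 h.bound_ne_top⟩)
  · rw [eLpNorm_one_eq_lintegral_enorm]
    exact (h.limit_lintegral_deriv_le hw t).trans_lt (lt_top_iff_ne_top.2 h.bound_ne_top)
  · refine Tendsto.mono_left ?_ nhdsWithin_le_nhds
    have h1 : Tendsto (fun s => ∫⁻ x, ‖w x s - w x t‖ₑ ∂Ω.measure) (𝓝 t) (𝓝 0) := by
      have h2 : Tendsto (fun s => ENNReal.ofReal (V * |s - t|)) (𝓝 t) (𝓝 0) := by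
        have : Continuous fun s => ENNReal.ofReal (V * |s - t|) :=
          ENNReal.continuous_ofReal.comp (by fun_prop)
        simpa using this.tendsto t
      exact tendsto_of_tendsto_of_tendsto_of_le_of_le tendsto_const_nhds h2 (fun _ => bot_le)
        fun s => h.limit_time_abs hw t s
    have h2 : Tendsto (fun s => ∫⁻ x, ‖deriv (fun x => w x s) x - deriv (fun x => w x t) x‖ₑ
        ∂Ω.measure) (𝓝 t) (𝓝 0) := by
      rw [ENNReal.tendsto_nhds_zero]
      intro ε' hε'
      obtain ⟨ε, -, hε, hε2⟩ := ENNReal.lt_iff_exists_real_btwn.1 hε'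
      obtain ⟨κ, hκ, hκ2⟩ := h.limit_deriv_time hw (ENNReal.ofReal_pos.1 hε)
      filter_upwards [Metric.ball_mem_nhds t hκ] with s hs
      exact (hκ2 s t (Metric.mem_ball.1 hs).le).trans hε2.le
    have h3 := h1.add h2
    rw [add_zero] at h3
    exact tendsto_of_tendsto_of_tendsto_of_le_of_le tendsto_const_nhds h3 (fun _ => bot_le)
      fun s => normW11_le ((h.limit_hasWeakDeriv hw s).sub (h.limit_hasWeakDeriv hw t))

lemma tendstoCW11_limit (h : ApproxFamily Ω u z δ M H V A) (hw : IsLimit Ω u w)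
    (hz : ∀ k t, HasWeakDeriv (fun x => u k x t) (fun x => z k x t)) : TendstoCW11 Ω u w := by
  intro T _
  rw [ENNReal.tendsto_nhds_zero]
  intro ε' hε'
  obtain ⟨ε, -, hε, hε2⟩ := ENNReal.lt_iff_exists_real_btwn.1 hε'
  have hε0 := ENNReal.ofReal_pos.1 hε
  filter_upwards [hw.uniform T (ε / 2) (by linarith), h.uniform_deriv hw T (ε / 2) (by linarith)]
    with k h1 h2
  refine iSup₂_le fun t ht => ?_
  refine (normW11_le ((hz k t).sub (h.limit_hasWeakDeriv hw t))).trans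
    ((add_le_add (h1 t ht.1 ht.2) (h2 t ht.1 ht.2)).trans ?_)
  rw [← ENNReal.ofReal_add (by linarith) (by linarith), add_halves]
  exact hε2.le

/-- On the line the L¹ bound grows linearly in time, so the L² bound depends on T. On the circle the
sup bound on a set of measure 1 works for all times at once. -/
lemma essBoundedL2_limit (h : ApproxFamily Ω u z δ M H V A) (hw : IsLimit Ω u w) :
    ∀ I ∈ Ω.timeIntervals, EssBoundedL2 Ω I w := by
  intro I hI
  cases Ω with
  | line =>
    obtain ⟨T, hT, rfl⟩ := hI
    obtain ⟨C, hC⟩ := exists_eLpNorm_two_le (μ := Domain.line.measure) M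
      (A := ENNReal.ofReal (V * T) + A)
      (ENNReal.add_ne_top.2 ⟨ENNReal.ofReal_ne_top, h.bound_ne_top⟩)
    refine ⟨C, (ae_restrict_iff' measurableSet_Ioo).2 (ae_of_all _ fun t ht => ?_)⟩
    refine hC _ (fun x => h.limit_bdd hw x t) ((h.limit_lintegral_le hw ht.1.le).trans ?_)
    gcongr
    exact ht.2.le
  | circle =>
    obtain ⟨C, hC⟩ := exists_eLpNorm_two_le (μ := Domain.circle.measure) M
      (A := ENNReal.ofReal M) ENNReal.ofReal_ne_top
    exact ⟨C, ae_of_all _ fun t => hC _ (fun x => h.limit_bdd hw x t)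
      (Domain.lintegral_circle_le fun x => h.limit_bdd hw x t)⟩

lemma essBoundedL2_deriv_limit (h : ApproxFamily Ω u z δ M H V A) (hw : IsLimit Ω u w) :
    EssBoundedL2 Ω (Ioi 0) (fun x t => deriv (fun y => w y t) x) := by
  obtain ⟨C, hC⟩ := exists_eLpNorm_two_le (μ := Ω.measure) H h.bound_ne_top
  exact ⟨C, ae_of_all _ fun t => hC _ (fun x => norm_deriv_le_of_lipschitz (h.limit_lip hw t))
    (h.limit_lintegral_deriv_le hw t)⟩

end ApproxFamily

namespace SchemeFamily

variable {Ω : Domain} {B w₀ F h : ℝ → ℝ} {H V : NNReal} {θ : ℝ} {dx dt : ℕ → ℝ}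
  {W : ℕ → ℕ → ℤ → ℝ} {w : ℝ → ℝ → ℝ}

lemma isWeakSolution_limit (S : SchemeFamily Ω B w₀ F h H V θ dx dt W)
    (hw : ApproxFamily.IsLimit Ω (fun k => interp (dx k) (dt k) (W k)) w)
    (hB : ContDiff ℝ 1 B) : IsWeakSolution Ω B w₀ w := by
  obtain ⟨M, hM⟩ := S.rep.exists_bound
  have A := S.approxFamily hM
  have cw := A.limit_continuous hw
  exact ⟨fun t _ => Domain.isFunctionOn_iff_per.2 (A.limit_per hw t),
    memLp_top_of_bound (measurable_limit cw).aestronglyMeasurable M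
      (ae_of_all _ fun p => A.limit_bdd hw p.1 p.2),
    fun x t => deriv (fun y => w y t) x, (measurable_deriv_limit cw).aestronglyMeasurable,
    ae_of_all _ fun t => A.limit_hasWeakDeriv hw t, A.essBoundedL2_limit hw,
    A.essBoundedL2_deriv_limit hw, fun φ hφ => S.weak_form hw hB hφ⟩

/-- Convergence of a subsequence of the schemes to a weak solution. -/
theorem exists_weakSolution (S : SchemeFamily Ω B w₀ F h H V θ dx dt W) (hB : ContDiff ℝ 1 B) :
    ∃ σ : ℕ → ℕ, StrictMono σ ∧ ∃ w : ℝ → ℝ → ℝ, MemCW11 Ω w ∧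
      TendstoCW11 Ω (fun k => interp (dx (σ k)) (dt (σ k)) (W (σ k))) w ∧
      IsWeakSolution Ω B w₀ w := by
  obtain ⟨M, hM⟩ := S.rep.exists_bound
  obtain ⟨σ, hσ, w, hw⟩ := (S.approxFamily hM).exists_limit
  have S' := S.comp hσ
  have A := S'.approxFamily hM
  refine ⟨σ, hσ, w, A.memCW11_limit hw, A.tendstoCW11_limit hw fun k t => ?_,
    S'.isWeakSolution_limit hw hB⟩
  simp only [S'.interp_eq]
  exact hasWeakDeriv_linInterp (S'.dx_pos k) (S'.abs_diff1_le k _)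

end SchemeFamily

end ThetaScheme

theorem theorem1 (Ω : Domain) (B : ℝ → ℝ) (hB : ContDiff ℝ 2 B)
    (hB01 : ∀ s, 0 ≤ B s ∧ B s ≤ 1)
    (w₀ : ℝ → ℝ) (hw₀ : IsInitialDatum Ω w₀)
    (θ : ℝ) (hθ : θ ∈ Set.Icc (0 : ℝ) 1)
    (dx dt : ℕ → ℝ) (hdx : ∀ k, 0 < dx k) (hdt : ∀ k, 0 < dt k)
    (hdx0 : Tendsto dx atTop (𝓝 0)) (hdt0 : Tendsto dt atTop (𝓝 0))
    (hCFL : ∀ k, CFL θ (dx k) (dt k))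
    (W : ℕ → ℕ → ℤ → ℝ)
    (hW : ∀ k, IsSchemeSolution Ω B w₀ θ (dx k) (dt k) (W k)) :
    ∃ σ : ℕ → ℕ, StrictMono σ ∧ ∃ w : ℝ → ℝ → ℝ,
      MemCW11 Ω w ∧
      TendstoCW11 Ω (fun k => interp (dx (σ k)) (dt (σ k)) (W (σ k))) w ∧
      IsWeakSolution Ω B w₀ w := by
  obtain ⟨F, h, H, V, hR⟩ := hw₀.exists_initialRep
  -- Finitely many indices are dropped to have dx, dt ≤ 1, which the shift estimates and the support
  -- margins presuppose.
  obtain ⟨N, hN⟩ := eventually_atTop.1 ((hdx0.eventually (ge_mem_nhds one_pos)).and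
    (hdt0.eventually (ge_mem_nhds one_pos)))
  have S : SchemeFamily Ω B w₀ F h H V θ (fun k => dx (k + N)) (fun k => dt (k + N))
      (fun k => W (k + N)) :=
    { stable := fun k => ⟨hW _, hB01, hθ, hdx _, hdt _, hCFL _⟩
      rep := hR
      dx_le := fun k => (hN _ (Nat.le_add_left N k)).1
      dt_le := fun k => (hN _ (Nat.le_add_left N k)).2
      dx_lim := hdx0.comp (tendsto_add_atTop_nat N)
      dt_lim := hdt0.comp (tendsto_add_atTop_nat N) }
  obtain ⟨σ, hσ, hw⟩ := S.exists_weakSolution (hB.of_le (by norm_num))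
  exact ⟨fun k => σ k + N, fun a b hab => Nat.add_lt_add_right (hσ hab) N, hw⟩
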